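/- **Setting.** An instance consists of $n$ vertices $V$, a metric $d:V\times V\to\mathbb{R}_{\ge 0}$ and an integer $k$ with $2\le k\le n$. In (unconnected) *$k$-median* one chooses centers $c_1,\dots,c_k\in V$ so as to minimize $\sum_{v\in V}\min_i d(v,c_i)$. In *connected $k$-median* one is also given an undirected graph $G=(V,E)$; a feasible solution is a partition of $V$ into $k$ clusters $P_1,\dots,P_k$ with centers $c_i\in P_i$ such that each $P_i$ induces a connected subgraph of $G$, and the cost $\sum_{i}\sum_{v\in P_i}d(v,c_i)$ is to be minimized. An algorithm is a *$\rho$-approximation* if on every instance that has a feasible solution it outputs a feasible solution of cost at most $\rho$ times the minimum cost. A *tree decomposition* of $G$ is a tree $T$ with a bag $B_t\subseteq V$ for each node $t$ such that the bags cover $V$, both ends of every edge of $G$ lie together in some bag, and for every $v\in V$ the nodes whose bags contain $v$ form a connected subtree; its width is the size of the largest bag minus one. It is *nice* if $T$ is rooted at a node $z$ with $B_z=\emptyset$ and each node $t$ is of one of the following types: a leaf with $B_t=\emptyset$; an introduce vertex node, with one child $s$ and $B_t=B_s\cup\{v\}$, $v\notin B_s$; an introduce edge node, labeled with an edge $\{u,v\}\in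 E$, $u,v\in B_t$, with one child $s$ and $B_t=B_s$; a forget node, with one child $s$ and $B_t=B_s\setminus\{v\}$, $v\in B_s$; a join node, with exactly two children, whose bags both equal $B_t$; and every edge of $G$ is introduced exactly once and every vertex is forgotten exactly once. Algorithms are programs of a unit-cost real RAM with read-only random-access input: one step per integer addition, subtraction and comparison, per real $+,-,\times,\div$ and comparison, and per memory or input access. **Theorem.** Suppose that there is an $\alpha$-approximation algorithm for unconnected $k$-median with running time $p(n)$. Then there is an algorithm that, given a connected $k$-median instance together with a nice tree decomposition of $G$ of width $w$ with $O(nw)$ nodes, computes a $(2\alpha+4)$-approximation for connected $k$-median in time $$O\bigl(p(n)+n\cdot(wk)^{O(w)}\bigr).$$ The constant in the exponent is absolute, and the outer hidden constant depends only on the constant in the bound $O(nw)$ on the number of nodes. In particular, if $p$ is bounded by a polynomial, then the running time is bounded by the product of a polynomial in $n$ and a function of $\max(w,k)$, i.e. the algorithm is FPT with respect to the parameter $\max(w,k)$. -/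

import Mathlib

/-! ## The machine: a unit-cost real RAM, programmed by structured programs

The memory consists of arrays of natural numbers and arrays of real numbers, named by natural
numbers (a program mentions only finitely many of them). The input is read-only and random access:
it consists of integer tables, named by the elements of a type `Q`, and of one table of reals.
On natural numbers the machine can only add, subtract (truncated at `0`) and compare; on reals
it can add, subtract, multiply, divide and compare. There is no rounding of reals to integers.
Every operation, comparison and memory or input access costs one step. -/

namespace RealRAM

/-- The read-only input. Integer tables are addressed by two indices. -/
structure Input (Q : Type) where
  nat : Q → ℕ → ℕ → ℕ
  real : ℕ → ℕ → ℝ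

/-- The memory: `nat a i` and `real a i` are the `i`-th cells of the arrays with name `a`. -/
structure State where
  nat : ℕ → ℕ → ℕ
  real : ℕ → ℕ → ℝ

/-- The initial memory: all cells are `0`. -/
def State.init : State := ⟨fun _ _ => 0, fun _ _ => 0⟩

/-- Integer expressions. -/
inductive NExp (Q : Type) : Type
  | const : ℕ → NExp Q
  | read : ℕ → NExp Q → NExp Q
  | input : Q → NExp Q → NExp Q → NExp Q
  | plus : NExp Q → NExp Q → NExp Q
  | minus : NExp Q → NExp Q → NExp Q

/-- Real expressions. -/
inductive RExp (Q : Type) : Type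
  | ofNat : NExp Q → RExp Q
  | read : ℕ → NExp Q → RExp Q
  | input : NExp Q → NExp Q → RExp Q
  | plus : RExp Q → RExp Q → RExp Q
  | minus : RExp Q → RExp Q → RExp Q
  | times : RExp Q → RExp Q → RExp Q
  | divide : RExp Q → RExp Q → RExp Q

/-- Tests. -/
inductive BExp (Q : Type) : Type
  | natLe : NExp Q → NExp Q → BExp Q
  | realLe : RExp Q → RExp Q → BExp Q

/-- Programs. `setNat a i e` stores the value of `e` in the cell `i` of the integer array `a`;
`cond b P P'` executes `P` if `b` holds and `P'` otherwise; `loop b P` executes `P` as long as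
`b` holds. -/
inductive Prog (Q : Type) : Type
  | skip : Prog Q
  | setNat : ℕ → NExp Q → NExp Q → Prog Q
  | setReal : ℕ → NExp Q → RExp Q → Prog Q
  | seq : Prog Q → Prog Q → Prog Q
  | cond : BExp Q → Prog Q → Prog Q → Prog Q
  | loop : BExp Q → Prog Q → Prog Q

variable {Q : Type}

/-- The value of an integer expression. -/
def NExp.eval (x : Input Q) (s : State) : NExp Q → ℕ
  | .const c => c
  | .read a i => s.nat a (i.eval x s)
  | .input q i j => x.nat q (i.eval x s) (j.eval x s)
  | .plus e f => e.eval x s + f.eval x s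
  | .minus e f => e.eval x s - f.eval x s

/-- The number of steps to evaluate an integer expression. -/
def NExp.cost : NExp Q → ℕ
  | .const _ => 1
  | .read _ i => 1 + i.cost
  | .input _ i j => 1 + i.cost + j.cost
  | .plus e f => 1 + e.cost + f.cost
  | .minus e f => 1 + e.cost + f.cost

/-- The value of a real expression (division by zero yields `0`). -/
noncomputable def RExp.eval (x : Input Q) (s : State) : RExp Q → ℝ
  | .ofNat e => (e.eval x s : ℝ)
  | .read a i => s.real a (i.eval x s)
  | .input i j => x.real (i.eval x s) (j.eval x s)
  | .plus e f => e.eval x s + f.eval x s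
  | .minus e f => e.eval x s - f.eval x s
  | .times e f => e.eval x s * f.eval x s
  | .divide e f => e.eval x s / f.eval x s

/-- The number of steps to evaluate a real expression. -/
def RExp.cost : RExp Q → ℕ
  | .ofNat e => 1 + e.cost
  | .read _ i => 1 + i.cost
  | .input i j => 1 + i.cost + j.cost
  | .plus e f => 1 + e.cost + f.cost
  | .minus e f => 1 + e.cost + f.cost
  | .times e f => 1 + e.cost + f.cost
  | .divide e f => 1 + e.cost + f.cost

/-- Whether a test succeeds. -/
def BExp.Holds (x : Input Q) (s : State) : BExp Q → Prop
  | .natLe e f => e.eval x s ≤ f.eval x s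
  | .realLe e f => e.eval x s ≤ f.eval x s

/-- The number of steps to evaluate a test. -/
def BExp.cost : BExp Q → ℕ
  | .natLe e f => 1 + e.cost + f.cost
  | .realLe e f => 1 + e.cost + f.cost

/-- Storing a natural number. -/
def State.setNat (s : State) (a i v : ℕ) : State :=
  ⟨fun b j => if b = a ∧ j = i then v else s.nat b j, s.real⟩

/-- Storing a real number. -/
noncomputable def State.setReal (s : State) (a i : ℕ) (v : ℝ) : State :=
  ⟨s.nat, fun b j => if b = a ∧ j = i then v else s.real b j⟩

/-- `Exec x P s s' t`: on input `x`, the program `P` started in memory `s` halts after exactly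
`t` steps in memory `s'`. -/
inductive Exec (x : Input Q) : Prog Q → State → State → ℕ → Prop
  | skip (s : State) : Exec x .skip s s 1
  | setNat (a : ℕ) (i e : NExp Q) (s : State) :
      Exec x (.setNat a i e) s (s.setNat a (i.eval x s) (e.eval x s)) (1 + i.cost + e.cost)
  | setReal (a : ℕ) (i : NExp Q) (e : RExp Q) (s : State) :
      Exec x (.setReal a i e) s (s.setReal a (i.eval x s) (e.eval x s)) (1 + i.cost + e.cost)
  | seq {P P' : Prog Q} {s s' s'' : State} {t t' : ℕ} :
      Exec x P s s' t → Exec x P' s' s'' t' → Exec x (.seq P P') s s'' (t + t')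
  | condTrue {b : BExp Q} {P P' : Prog Q} {s s' : State} {t : ℕ} :
      b.Holds x s → Exec x P s s' t → Exec x (.cond b P P') s s' (1 + b.cost + t)
  | condFalse {b : BExp Q} {P P' : Prog Q} {s s' : State} {t : ℕ} :
      ¬ b.Holds x s → Exec x P' s s' t → Exec x (.cond b P P') s s' (1 + b.cost + t)
  | loopTrue {b : BExp Q} {P : Prog Q} {s s' s'' : State} {t t' : ℕ} :
      b.Holds x s → Exec x P s s' t → Exec x (.loop b P) s' s'' t' →
        Exec x (.loop b P) s s'' (1 + b.cost + t + t')
  | loopFalse {b : BExp Q} {P : Prog Q} {s : State} :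
      ¬ b.Holds x s → Exec x (.loop b P) s s (1 + b.cost)

end RealRAM

/-! ## The clustering problems -/

/-- An instance of `k`-median: `n` points, a number `2 ≤ k ≤ n` of clusters, and a metric. -/
structure KMedianInstance where
  n : ℕ
  k : ℕ
  two_le_k : 2 ≤ k
  k_le_n : k ≤ n
  d : Fin n → Fin n → ℝ
  d_nonneg : ∀ u v, 0 ≤ d u v
  d_eq_zero : ∀ u v, d u v = 0 ↔ u = v
  d_symm : ∀ u v, d u v = d v u
  d_triangle : ∀ u v w, d u w ≤ d u v + d v w

namespace KMedianInstance

/-- The unconnected `k`-median cost of a choice of `k` centers: the sum over all points of the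
distance to the nearest center. -/
noncomputable def cost (I : KMedianInstance) (c : Fin I.k → Fin I.n) : ℝ :=
  ∑ v, ⨅ i, I.d v (c i)

/-- The vertex `v` belongs to the cluster with index `cluster v`, and `center i` is the center of
the `i`-th cluster. Feasible: every cluster contains its center (so no cluster is empty) and
induces a connected subgraph of `G`. -/
def IsConnectedSolution (I : KMedianInstance) (G : SimpleGraph (Fin I.n))
    (cluster : Fin I.n → Fin I.k) (center : Fin I.k → Fin I.n) : Prop :=
  ∀ i, cluster (center i) = i ∧ (G.induce {v | cluster v = i}).Connected

/-- The connected `k`-median objective. -/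
noncomputable def clusteringCost (I : KMedianInstance)
    (cluster : Fin I.n → Fin I.k) (center : Fin I.k → Fin I.n) : ℝ :=
  ∑ i, ∑ v with cluster v = i, I.d v (center i)

/-- The table of distances. -/
noncomputable def distTable (I : KMedianInstance) (i j : ℕ) : ℝ :=
  if h : i < I.n ∧ j < I.n then I.d ⟨i, h.1⟩ ⟨j, h.2⟩ else 0

end KMedianInstance

/-! ## Nice tree decompositions -/

/-- The type of a node, with the vertex or edge it introduces or forgets and its children. -/
inductive NodeType (n N : ℕ) : Type
  | leaf : NodeType n N
  | introVertex (v : Fin n) (s : Fin N) : NodeType n N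
  | introEdge (u v : Fin n) (s : Fin N) : NodeType n N
  | forget (v : Fin n) (s : Fin N) : NodeType n N
  | join (s₁ s₂ : Fin N) : NodeType n N

/-- The children of `t` in a tree `T` rooted at `z`. -/
def treeChildren {N : ℕ} (T : SimpleGraph (Fin N)) (z t : Fin N) : Set (Fin N) :=
  {s | T.Adj t s ∧ T.dist z s = T.dist z t + 1}

/-- The conditions on a node `t` of the given type in a nice tree decomposition of `G`. -/
def NodeType.IsValid {n N : ℕ} (G : SimpleGraph (Fin n)) (T : SimpleGraph (Fin N)) (z : Fin N)
    (bag : Fin N → Finset (Fin n)) (t : Fin N) : NodeType n N → Prop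
  | .leaf => treeChildren T z t = ∅ ∧ bag t = ∅
  | .introVertex v s => treeChildren T z t = {s} ∧ v ∉ bag s ∧ bag t = insert v (bag s)
  | .introEdge u v s =>
      treeChildren T z t = {s} ∧ G.Adj u v ∧ bag t = bag s ∧ u ∈ bag t ∧ v ∈ bag t
  | .forget v s => treeChildren T z t = {s} ∧ v ∈ bag s ∧ bag t = (bag s).erase v
  | .join s₁ s₂ =>
      s₁ ≠ s₂ ∧ treeChildren T z t = {s₁, s₂} ∧ bag s₁ = bag t ∧ bag s₂ = bag t

/-- The node introduces the edge `{u, v}`. -/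
def NodeType.IntroducesEdge {n N : ℕ} (u v : Fin n) : NodeType n N → Prop
  | .introEdge a b _ => s(a, b) = s(u, v)
  | _ => False

/-- The node forgets the vertex `v`. -/
def NodeType.Forgets {n N : ℕ} (v : Fin n) : NodeType n N → Prop
  | .forget a _ => a = v
  | _ => False

/-- A nice tree decomposition of `G` with `N` nodes. The first group of fields says that it is a
tree decomposition. -/
structure NiceTreeDecomposition {n : ℕ} (G : SimpleGraph (Fin n)) where
  N : ℕ
  T : SimpleGraph (Fin N)
  isTree : T.IsTree
  bag : Fin N → Finset (Fin n)
  bag_cover : ∀ v, ∃ t, v ∈ bag t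
  bag_edge : ∀ u v, G.Adj u v → ∃ t, u ∈ bag t ∧ v ∈ bag t
  bag_connected : ∀ v, (T.induce {t | v ∈ bag t}).Connected
  root : Fin N
  bag_root : bag root = ∅
  node : Fin N → NodeType n N
  node_valid : ∀ t, (node t).IsValid G T root bag t
  edge_once : ∀ u v, G.Adj u v → ∃! t, (node t).IntroducesEdge u v
  forget_once : ∀ v, ∃! t, (node t).Forgets v

/-- The width of the decomposition is `w`: the largest bag has `w + 1` elements. -/
def NiceTreeDecomposition.HasWidth {n : ℕ} {G : SimpleGraph (Fin n)}
    (D : NiceTreeDecomposition G) (w : ℕ) : Prop :=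
  (Finset.univ.sup fun t => (D.bag t).card) = w + 1

/-! ## How instances are presented to the machine -/

/-- The integer inputs of a `k`-median instance. -/
inductive KMedianQuery : Type
  | numPoints | numClusters

/-- The integer inputs of a connected `k`-median instance with a nice tree decomposition. -/
inductive ConnectedQuery : Type
  | numPoints | numClusters | adjacent
  | numNodes | root | nodeTag | vertex₁ | vertex₂ | child₁ | child₂ | bagSize | bagMember

namespace NodeType

variable {n N : ℕ}

/-- The tag by which the type of a node is presented. -/
def tag : NodeType n N → ℕ
  | .leaf => 0
  | .introVertex _ _ => 1
  | .introEdge _ _ _ => 2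
  | .forget _ _ => 3
  | .join _ _ => 4

/-- The (first) vertex introduced or forgotten, `0` if there is none. -/
def vertex₁ : NodeType n N → ℕ
  | .introVertex v _ => v
  | .introEdge u _ _ => u
  | .forget v _ => v
  | _ => 0

/-- The second vertex of an introduced edge, `0` if there is none. -/
def vertex₂ : NodeType n N → ℕ
  | .introEdge _ v _ => v
  | _ => 0

/-- The (first) child, `0` if there is none. -/
def child₁ : NodeType n N → ℕ
  | .leaf => 0
  | .introVertex _ s => s
  | .introEdge _ _ s => s
  | .forget _ s => s
  | .join s _ => s

/-- The second child, `0` if there is none. -/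
def child₂ : NodeType n N → ℕ
  | .join _ s => s
  | _ => 0

end NodeType

/-- The presentation of a `k`-median instance: `n`, `k` and the table of distances. -/
noncomputable def kMedianInput (I : KMedianInstance) : RealRAM.Input KMedianQuery where
  nat q _ _ := match q with
    | .numPoints => I.n
    | .numClusters => I.k
  real := I.distTable

/-- A table indexed by nodes, continued by `0`. -/
def nodeTable {N : ℕ} (f : Fin N → ℕ) (i : ℕ) : ℕ :=
  if h : i < N then f ⟨i, h⟩ else 0

open Classical in
/-- The presentation of a connected `k`-median instance with a nice tree decomposition: `n`, `k`,
the distances, the adjacency matrix of `G`, the rooted tree by its child pointers, the types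
and labels of the nodes, and the bags as lists. -/
noncomputable def connectedInput (I : KMedianInstance) (G : SimpleGraph (Fin I.n))
    (D : NiceTreeDecomposition G) : RealRAM.Input ConnectedQuery where
  nat q i j := match q with
    | .numPoints => I.n
    | .numClusters => I.k
    | .adjacent => if ∃ u v : Fin I.n, (u : ℕ) = i ∧ (v : ℕ) = j ∧ G.Adj u v then 1 else 0
    | .numNodes => D.N
    | .root => D.root
    | .nodeTag => nodeTable (fun t => (D.node t).tag) i
    | .vertex₁ => nodeTable (fun t => (D.node t).vertex₁) i
    | .vertex₂ => nodeTable (fun t => (D.node t).vertex₂) i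
    | .child₁ => nodeTable (fun t => (D.node t).child₁) i
    | .child₂ => nodeTable (fun t => (D.node t).child₂) i
    | .bagSize => nodeTable (fun t => (D.bag t).card) i
    | .bagMember => nodeTable (fun t => (((D.bag t).sort (· ≤ ·)).map Fin.val).getD j 0) i
  real := I.distTable

/-! ## Approximation algorithms -/

/-- `A` is an `α`-approximation algorithm for unconnected `k`-median with running time `p n`:
on every instance it halts within `p n` steps, with `k` centers in the first `k` cells of the
integer array `0`, whose cost is at most `α` times the cost of any choice of `k` centers. -/
def IsKMedianApprox (A : RealRAM.Prog KMedianQuery) (α : ℝ) (p : ℕ → ℕ) : Prop :=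
  ∀ I : KMedianInstance, ∃ (s : RealRAM.State) (t : ℕ),
    RealRAM.Exec (kMedianInput I) A RealRAM.State.init s t ∧ t ≤ p I.n ∧
    ∃ c : Fin I.k → Fin I.n, (∀ i : Fin I.k, s.nat 0 i = c i) ∧
      ∀ c' : Fin I.k → Fin I.n, I.cost c ≤ α * I.cost c'

/-- `P` is a `ρ`-approximation algorithm for connected `k`-median, given a nice tree decomposition
of width `w` with at most `B * n * w` nodes, with running time `time n k w`: it always halts
within `time n k w` steps, and if the instance has a feasible solution, then the integer arrays
`0` and `1` hold the clusters of the vertices and the centers of the clusters of a feasible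
solution whose cost is at most `ρ` times the cost of any feasible solution. -/
def IsConnectedApprox (P : RealRAM.Prog ConnectedQuery) (ρ : ℝ) (B : ℕ)
    (time : ℕ → ℕ → ℕ → ℕ) : Prop :=
  ∀ (I : KMedianInstance) (G : SimpleGraph (Fin I.n)) (D : NiceTreeDecomposition G) (w : ℕ),
    D.HasWidth w → D.N ≤ B * (I.n * w) →
    ∃ (s : RealRAM.State) (t : ℕ),
      RealRAM.Exec (connectedInput I G D) P RealRAM.State.init s t ∧ t ≤ time I.n I.k w ∧
      ((∃ cluster center, I.IsConnectedSolution G cluster center) →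
        ∃ (cluster : Fin I.n → Fin I.k) (center : Fin I.k → Fin I.n),
          (∀ v : Fin I.n, s.nat 0 v = cluster v) ∧ (∀ i : Fin I.k, s.nat 1 i = center i) ∧
          I.IsConnectedSolution G cluster center ∧
          ∀ cluster' center', I.IsConnectedSolution G cluster' center' →
            I.clusteringCost cluster center ≤ ρ * I.clusteringCost cluster' center')

/-! Approximation. The centers `c` returned by the unconnected algorithm are used as facilities. In
a connected solution of cost `C`, let every cluster use the facility nearest to its center `z`. For
a vertex `v` of that cluster and the facility `c j` nearest to `v`, the triangle inequality bounds
the distance from `v` to the chosen facility by `d v z + d z (c j) ≤ 2 * d v z + d v (c j)`. Summing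
over `v` gives at most `(2 + α) * C`, because the centers of the connected solution are themselves
candidates for the unconnected problem (`exists_facilities`, `cost_le_clusteringCost`). It therefore
suffices to find a connected partition, with one facility per cluster, that minimizes the total
distance to the facilities. Replacing each facility afterwards by the nearest vertex of its cluster
at most doubles the cost (`clusteringCost_le`), which gives `2 * (2 + α)`.

Dynamic program. This minimization is exact. An entry at a node `t` stores for each bag vertex its
facility and a label, the number of clusters completely forgotten below `t`, and the cost of the
vertices forgotten below `t`. Equal labels mean: connected, inside the own cluster, by edges
introduced below `t`. There are at most `(k * W) ^ W * (k + 1)` entries with `W = w + 1`; of entries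
differing only in cost and origin the cheapest is kept.

Completeness (`exists_entry_of_clustering`): going from the leaves to the root, each node has an
entry that describes the given clustering below that node and costs no more. A cluster is finished
when a vertex without a companion of its label is forgotten; this is where connectivity of the
clusters is used.

Soundness (`Consistent.clustering`): following the stored origins from a root entry with count `k`
selects one entry per node. From the root downwards, a vertex without a companion at its forget node
founds a new cluster, and any other vertex joins the cluster of a companion. Equal labels imply a
common facility and connectedness inside the cluster, so exactly `k` connected clusters with
well-defined facilities arise, and their cost is that of the root entry.

Machine. Each subprogram is verified in a small program logic in which `Runs` bounds the steps by a
polynomial in a bound `X` on the iteration counts (`Prog.exists_bound_le`). With `X = maxIter k w ≤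
(w * k) ^ (7 * w)`, a fixed polynomial in `X` remains of the form `(w * k) ^ O(w)`. Only the loops
over all nodes and over all vertices contribute the factors depending on `n`. The given algorithm is
run with its arrays renamed (`Exec.lift`), so that it cannot interfere with the rest. -/

namespace RealRAM

variable {Q : Type}

/-! ### A program logic with step counting -/

/-- `P` writes to the integer array `b`. -/
def Prog.wn : Prog Q → ℕ → Bool
  | .skip, _ => false
  | .setNat a _ _, b => Nat.beq b a
  | .setReal _ _ _, _ => false
  | .seq P P', b => P.wn b || P'.wn b
  | .cond _ P P', b => P.wn b || P'.wn b
  | .loop _ P, b => P.wn b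

/-- `P` writes to the real array `b`. -/
def Prog.wr : Prog Q → ℕ → Bool
  | .skip, _ => false
  | .setNat _ _ _, _ => false
  | .setReal a _ _, b => Nat.beq b a
  | .seq P P', b => P.wr b || P'.wr b
  | .cond _ P P', b => P.wr b || P'.wr b
  | .loop _ P, b => P.wr b

/-- The memories `s` and `s'` agree on all arrays that `P` does not write. -/
structure Frame (P : Prog Q) (s s' : State) : Prop where
  nat : ∀ b, P.wn b = false → s'.nat b = s.nat b
  real : ∀ b, P.wr b = false → s'.real b = s.real b

theorem Frame.refl (P : Prog Q) (s : State) : Frame P s s := ⟨fun _ _ => rfl, fun _ _ => rfl⟩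

theorem Frame.trans {P : Prog Q} {s s' s'' : State} (h : Frame P s s') (h' : Frame P s' s'') :
    Frame P s s'' :=
  ⟨fun b hb => (h'.nat b hb).trans (h.nat b hb), fun b hb => (h'.real b hb).trans (h.real b hb)⟩

theorem Frame.mono {P P' : Prog Q} {s s' : State} (h : Frame P s s')
    (hn : ∀ b, P'.wn b = false → P.wn b = false) (hr : ∀ b, P'.wr b = false → P.wr b = false) :
    Frame P' s s' :=
  ⟨fun b hb => h.nat b (hn b hb), fun b hb => h.real b (hr b hb)⟩

/-- The write sets `Prog.wn` and `Prog.wr` are Boolean functions of the program text. For concrete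
programs the claim that an array is untouched is therefore settled by `rfl`, and this lemma turns it
into equality of memory contents. -/
theorem Exec.frame {x : Input Q} {P : Prog Q} {s s' : State} {t : ℕ} (h : Exec x P s s' t) :
    Frame P s s' := by
  induction h with
  | skip s => exact Frame.refl _ _
  | setNat a i e s =>
    refine ⟨fun b hb => ?_, fun b _ => rfl⟩
    have hb : b ≠ a := by
      rintro rfl
      simp [Prog.wn] at hb
    funext j
    simp [State.setNat, hb]
  | setReal a i e s =>
    refine ⟨fun b _ => rfl, fun b hb => ?_⟩
    have hb : b ≠ a := by
      rintro rfl
      simp [Prog.wr] at hb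
    funext j
    simp [State.setReal, hb]
  | seq _ _ ih ih' =>
    exact (ih.mono (by simp +contextual [Prog.wn]) (by simp +contextual [Prog.wr])).trans
      (ih'.mono (by simp +contextual [Prog.wn]) (by simp +contextual [Prog.wr]))
  | condTrue _ _ ih => exact ih.mono (by simp +contextual [Prog.wn]) (by simp +contextual [Prog.wr])
  | condFalse _ _ ih =>
    exact ih.mono (by simp +contextual [Prog.wn]) (by simp +contextual [Prog.wr])
  | loopTrue _ _ _ ih ih' =>
    exact (ih.mono (by simp [Prog.wn]) (by simp [Prog.wr])).trans ih'
  | loopFalse _ => exact Frame.refl _ _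

/-- Started in `s`, the program `P` halts within `T` steps in a memory satisfying `R`. -/
def RunsIn (x : Input Q) (T : ℕ) (P : Prog Q) (s : State) (R : State → Prop) : Prop :=
  ∃ s' t, Exec x P s s' t ∧ t ≤ T ∧ R s'

/-- A bound for the number of steps of `P` if every loop is iterated at most `X` times. -/
def Prog.bound (X : ℕ) : Prog Q → ℕ
  | .skip => 1
  | .setNat _ i e => 1 + i.cost + e.cost
  | .setReal _ i e => 1 + i.cost + e.cost
  | .seq P P' => P.bound X + P'.bound X
  | .cond b P P' => 1 + b.cost + (P.bound X + P'.bound X)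
  | .loop b P => X * (1 + b.cost + P.bound X) + (1 + b.cost)

/-- Each loop costs one more factor `X`, so for a fixed program the bound is polynomial in `X`.
Exponents are simply added where a maximum would do, since only the existence of some degree
matters. -/
theorem Prog.exists_bound_le (P : Prog Q) :
    ∃ K d : ℕ, ∀ X, 1 ≤ X → P.bound X ≤ K * X ^ d := by
  have key : ∀ {K d K' d' X : ℕ}, 1 ≤ X → K * X ^ d + K' * X ^ d' ≤ (K + K') * X ^ (d + d') := by
    intro K d K' d' X hX
    rw [add_mul]
    gcongr <;> omega
  induction P with
  | skip => exact ⟨1, 0, fun X _ => by simp [Prog.bound]⟩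
  | setNat a i e => exact ⟨1 + i.cost + e.cost, 0, fun X _ => by simp [Prog.bound]⟩
  | setReal a i e => exact ⟨1 + i.cost + e.cost, 0, fun X _ => by simp [Prog.bound]⟩
  | seq P P' ih ih' =>
    obtain ⟨K, d, h⟩ := ih
    obtain ⟨K', d', h'⟩ := ih'
    exact ⟨K + K', d + d', fun X hX => (add_le_add (h X hX) (h' X hX)).trans (key hX)⟩
  | cond b P P' ih ih' =>
    obtain ⟨K, d, h⟩ := ih
    obtain ⟨K', d', h'⟩ := ih'
    refine ⟨1 + b.cost + (K + K'), 0 + (d + d'), fun X hX => ?_⟩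
    refine le_trans ?_ (key hX)
    have := (add_le_add (h X hX) (h' X hX)).trans (key hX)
    simpa [Prog.bound] using this
  | loop b P ih =>
    obtain ⟨K, d, h⟩ := ih
    refine ⟨2 * (1 + b.cost) + K, d + 1, fun X hX => ?_⟩
    have h1 : X * P.bound X ≤ K * X ^ (d + 1) := by
      calc X * P.bound X ≤ X * (K * X ^ d) := by gcongr; exact h X hX
        _ = _ := by ring
    have h2 : X ≤ X ^ (d + 1) := Nat.le_self_pow (by omega) X
    have h3 : (1 + b.cost) * X ≤ (1 + b.cost) * X ^ (d + 1) := by gcongr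
    have h4 : (1 + b.cost) * 1 ≤ (1 + b.cost) * X := by gcongr
    simp only [Prog.bound]
    nlinarith

/-- `RunsIn` with the bound on the number of steps that `X` bounds all numbers of iterations. -/
def Runs (x : Input Q) (X : ℕ) (P : Prog Q) (s : State) (R : State → Prop) : Prop :=
  RunsIn x (P.bound X) P s R

section rules

variable {x : Input Q} {X T T' : ℕ} {P P' : Prog Q} {s : State} {R R' : State → Prop}

theorem RunsIn.mono (h : RunsIn x T P s R) (hT : T ≤ T') (hR : ∀ s', R s' → R' s') :
    RunsIn x T' P s R' := by
  obtain ⟨s', t, h1, h2, h3⟩ := h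
  exact ⟨s', t, h1, h2.trans hT, hR s' h3⟩

theorem RunsIn.frame (h : RunsIn x T P s R) : RunsIn x T P s fun s' => R s' ∧ Frame P s s' := by
  obtain ⟨s', t, h1, h2, h3⟩ := h
  exact ⟨s', t, h1, h2, h3, h1.frame⟩

theorem RunsIn.seq (h : RunsIn x T P s fun s' => RunsIn x T' P' s' R) :
    RunsIn x (T + T') (.seq P P') s R := by
  obtain ⟨s', t, h1, h2, s'', t', h3, h4, h5⟩ := h
  exact ⟨s'', t + t', h1.seq h3, add_le_add h2 h4, h5⟩

theorem Runs.mono (h : Runs x X P s R) (hR : ∀ s', R s' → R' s') : Runs x X P s R' :=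
  RunsIn.mono h le_rfl hR

theorem Runs.frame (h : Runs x X P s R) : Runs x X P s fun s' => R s' ∧ Frame P s s' :=
  RunsIn.frame h

theorem Runs.seq (h : Runs x X P s fun s' => Runs x X P' s' R) : Runs x X (.seq P P') s R :=
  RunsIn.seq h

/-- The second program may use both the postcondition of the first and the fact that all arrays not
written by it are unchanged; hence postconditions need to mention only what changes. -/
theorem Runs.seq' {R₁ : State → Prop} (h : Runs x X P s R₁)
    (h' : ∀ s', R₁ s' → Frame P s s' → Runs x X P' s' R) : Runs x X (.seq P P') s R :=
  Runs.seq (h.frame.mono fun s' hs' => h' s' hs'.1 hs'.2)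

theorem Runs.skip (h : R s) : Runs x X .skip s R := ⟨s, 1, .skip s, le_rfl, h⟩

theorem Runs.setNat {a : ℕ} {i e : NExp Q} (h : R (s.setNat a (i.eval x s) (e.eval x s))) :
    Runs x X (.setNat a i e) s R := ⟨_, _, .setNat a i e s, le_rfl, h⟩

theorem Runs.setReal {a : ℕ} {i : NExp Q} {e : RExp Q}
    (h : R (s.setReal a (i.eval x s) (e.eval x s))) :
    Runs x X (.setReal a i e) s R := ⟨_, _, .setReal a i e s, le_rfl, h⟩

theorem Runs.setNat_seq {a : ℕ} {i e : NExp Q}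
    (h : Runs x X P (s.setNat a (i.eval x s) (e.eval x s)) R) :
    Runs x X (.seq (.setNat a i e) P) s R := Runs.seq (Runs.setNat h)

theorem Runs.setReal_seq {a : ℕ} {i : NExp Q} {e : RExp Q}
    (h : Runs x X P (s.setReal a (i.eval x s) (e.eval x s)) R) :
    Runs x X (.seq (.setReal a i e) P) s R := Runs.seq (Runs.setReal h)

theorem Runs.cond {b : BExp Q} (h : b.Holds x s → Runs x X P s R)
    (h' : ¬ b.Holds x s → Runs x X P' s R) : Runs x X (.cond b P P') s R := by
  by_cases hb : b.Holds x s
  · obtain ⟨s', t, h1, h2, h3⟩ := h hb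
    exact ⟨s', _, .condTrue hb h1, by simp only [Prog.bound]; omega, h3⟩
  · obtain ⟨s', t, h1, h2, h3⟩ := h' hb
    exact ⟨s', _, .condFalse hb h1, by simp only [Prog.bound]; omega, h3⟩

/-! ### Scalar variables, equality tests and counting loops. -/

/-- A scalar variable. -/
abbrev NExp.var (a : ℕ) : NExp Q := .read a (.const 0)

/-- Assignment to a scalar variable. -/
abbrev Prog.assign (a : ℕ) (e : NExp Q) : Prog Q := .setNat a (.const 0) e

/-- The test for equality. -/
def BExp.eq (e f : NExp Q) : BExp Q := .natLe (.plus (.minus e f) (.minus f e)) (.const 0)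

theorem BExp.holds_eq {e f : NExp Q} :
    (BExp.eq e f).Holds x s ↔ e.eval x s = f.eval x s := by
  simp only [BExp.eq, BExp.Holds, NExp.eval]
  omega

/-- The loop `for c := lo to hi - 1 do P`. -/
def Prog.for (c : ℕ) (lo hi : NExp Q) (P : Prog Q) : Prog Q :=
  .seq (.assign c lo)
    (.loop (.natLe (.plus (.var c) (.const 1)) hi)
      (.seq P (.assign c (.plus (.var c) (.const 1)))))

/-- Induction on the number `m` of remaining iterations. The bound `hi` is evaluated anew before
each iteration, so it must have the value `b` in every state satisfying the invariant. The constants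
are `hi.cost + 5` for the test and `6` for the increment. -/
theorem RunsIn.for_aux {c : ℕ} {lo hi : NExp Q} {a b : ℕ} {I : ℕ → State → Prop} {s₀ : State}
    (hI : ∀ j s v, I j s → I j (s.setNat c 0 v))
    (hP : P.wn c = false)
    (hhi : ∀ j s, Frame (Prog.for c lo hi P) s₀ s → I j s → hi.eval x s = b)
    (hstep : ∀ j s, a ≤ j → j < b → Frame (Prog.for c lo hi P) s₀ s → I j s → s.nat c 0 = j →
      RunsIn x T P s (I (j + 1))) (m : ℕ) :
    ∀ j s, a ≤ j → j + m = b → Frame (Prog.for c lo hi P) s₀ s → I j s → s.nat c 0 = j →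
      RunsIn x (m * (1 + (hi.cost + 5) + (T + 6)) + (1 + (hi.cost + 5)))
        (.loop (.natLe (.plus (.var c) (.const 1)) hi)
          (.seq P (.assign c (.plus (.var c) (.const 1))))) s
        fun s' => I b s' ∧ Frame (Prog.for c lo hi P) s₀ s' := by
  induction m with
  | zero =>
    intro j s haj hj hF hIj hc
    refine ⟨s, _, .loopFalse ?_, ?_, ?_⟩
    · simp only [BExp.Holds, NExp.eval, hhi j s hF hIj, hc]
      omega
    · simp only [BExp.cost, NExp.cost]
      omega
    · obtain rfl : j = b := by omega
      exact ⟨hIj, hF⟩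
  | succ m ih =>
    intro j s haj hj hF hIj hc
    obtain ⟨s', t, h1, h2, h3⟩ := hstep j s haj (by omega) hF hIj hc
    have hc' : s'.nat c 0 = j := by rw [h1.frame.nat c hP, hc]
    have hF' : Frame (Prog.for c lo hi P) s₀ (s'.setNat c 0 (j + 1)) := by
      refine hF.trans ?_
      refine Frame.trans (h1.frame.mono ?_ ?_) (s' := s') ⟨fun e he => ?_, fun e _ => rfl⟩
      · simp +contextual [Prog.for, Prog.wn]
      · simp +contextual [Prog.for, Prog.wr]
      · have : e ≠ c := by
          rintro rfl
          simp [Prog.for, Prog.wn] at he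
        funext i
        simp [State.setNat, this]
    obtain ⟨s'', t', h4, h5, h6⟩ := ih (j + 1) (s'.setNat c 0 (j + 1)) (by omega) (by omega)
      hF' (hI _ _ _ h3) (by simp [State.setNat])
    have hassign : Exec x (.assign c (.plus (.var c) (.const 1))) s' (s'.setNat c 0 (j + 1)) 6 := by
      have := Exec.setNat (x := x) c (.const 0) (.plus (.var c) (.const 1)) s'
      simpa only [NExp.eval, hc', NExp.cost] using this
    refine ⟨s'', _, .loopTrue ?_ (h1.seq hassign) h4, ?_, h6⟩
    · simp only [BExp.Holds, NExp.eval, hhi j s hF hIj, hc]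
      omega
    · simp only [BExp.cost, NExp.cost, add_mul]
      omega

theorem RunsIn.for {c : ℕ} {lo hi : NExp Q} (a b : ℕ) (I : ℕ → State → Prop)
    (hI : ∀ j s v, I j s → I j (s.setNat c 0 v))
    (hP : P.wn c = false)
    (hlo : lo.eval x s = a)
    (hab : a ≤ b)
    (hhi : ∀ j s', Frame (Prog.for c lo hi P) s s' → I j s' → hi.eval x s' = b)
    (h0 : I a s)
    (hstep : ∀ j s', a ≤ j → j < b → Frame (Prog.for c lo hi P) s s' → I j s' → s'.nat c 0 = j →
      RunsIn x T P s' (I (j + 1)))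
    (hR : ∀ s', I b s' → Frame (Prog.for c lo hi P) s s' → R s') :
    RunsIn x (2 + lo.cost + ((b - a) * (1 + (hi.cost + 5) + (T + 6)) + (1 + (hi.cost + 5))))
      (Prog.for c lo hi P) s R := by
  refine RunsIn.seq ?_
  refine ⟨_, _, .setNat c (.const 0) lo s, by simp only [NExp.cost]; omega, ?_⟩
  refine (RunsIn.for_aux hI hP hhi hstep (b - a) a _ le_rfl (by omega) ?_ ?_ ?_).mono le_rfl
    (fun s' hs' => hR s' hs'.1 hs'.2)
  · refine ⟨fun e he => ?_, fun e _ => rfl⟩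
    have : e ≠ c := by
      rintro rfl
      simp [Prog.for, Prog.wn] at he
    funext i
    simp [State.setNat, this]
  · rw [hlo]
    exact hI _ _ _ h0
  · simp [State.setNat, NExp.eval, hlo]

theorem Runs.for {c : ℕ} {lo hi : NExp Q} (a b : ℕ) (I : ℕ → State → Prop)
    (hI : ∀ j s v, I j s → I j (s.setNat c 0 v))
    (hP : P.wn c = false)
    (hlo : lo.eval x s = a)
    (hab : a ≤ b) (hX : b - a ≤ X)
    (hhi : ∀ j s', Frame (Prog.for c lo hi P) s s' → I j s' → hi.eval x s' = b)
    (h0 : I a s)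
    (hstep : ∀ j s', a ≤ j → j < b → Frame (Prog.for c lo hi P) s s' → I j s' → s'.nat c 0 = j →
      Runs x X P s' (I (j + 1)))
    (hR : ∀ s', I b s' → Frame (Prog.for c lo hi P) s s' → R s') :
    Runs x X (Prog.for c lo hi P) s R := by
  refine (RunsIn.for a b I hI hP hlo hab hhi h0 hstep hR).mono ?_ fun _ h => h
  simp only [Prog.for, Prog.bound, Prog.assign, NExp.cost, BExp.cost]
  have : (b - a) * (1 + (hi.cost + 5) + (P.bound X + 6)) ≤
      X * (1 + (hi.cost + 5) + (P.bound X + 6)) := Nat.mul_le_mul_right _ hX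
  have e : 1 + (1 + (1 + (1 + 1) + 1) + hi.cost) + (P.bound X + (1 + 1 + (1 + (1 + 1) + 1)))
      = 1 + (hi.cost + 5) + (P.bound X + 6) := by omega
  rw [e]
  omega

end rules

end RealRAM

/-! ### The rooted tree of a nice tree decomposition -/

namespace NodeType

/-- `s` is a child of a node of the given type. -/
def HasChild {n N : ℕ} (s : Fin N) : NodeType n N → Prop
  | .leaf => False
  | .introVertex _ s₁ => s = s₁
  | .introEdge _ _ s₁ => s = s₁
  | .forget _ s₁ => s = s₁
  | .join s₁ s₂ => s = s₁ ∨ s = s₂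

end NodeType

namespace NiceTreeDecomposition

variable {n : ℕ} {G : SimpleGraph (Fin n)} (D : NiceTreeDecomposition G)

/-- `s` is a child of `t`. -/
def Child (t s : Fin D.N) : Prop := s ∈ treeChildren D.T D.root t

theorem child_iff (t s : Fin D.N) : D.Child t s ↔ (D.node t).HasChild s := by
  have h := D.node_valid t
  unfold Child
  generalize D.node t = a at h
  cases a <;> simp only [NodeType.IsValid] at h <;> simp only [NodeType.HasChild]
  · simp [h.1]
  · simp [h.1]
  · simp [h.1]
  · simp [h.1]
  · simp [h.2.1]

variable {D}

theorem Child.dist {t s : Fin D.N} (h : D.Child t s) :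
    D.T.dist D.root s = D.T.dist D.root t + 1 := h.2

theorem Child.ne_root {t s : Fin D.N} (h : D.Child t s) : s ≠ D.root := by
  rintro rfl
  have := h.dist
  simp at this

/-- Extending shortest paths from the root to `t` and to `t'` by one edge gives two paths to `s`. In
a tree they coincide, hence so do their penultimate vertices. -/
theorem Child.unique {t t' s : Fin D.N} (h : D.Child t s) (h' : D.Child t' s) : t = t' := by
  obtain ⟨p, hp, hpl⟩ := D.isTree.connected.exists_path_of_dist D.root t
  obtain ⟨p', hp', hpl'⟩ := D.isTree.connected.exists_path_of_dist D.root t'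
  have hl := h.dist
  have hl' := h'.dist
  have key : ∀ {r : Fin D.N} (q : D.T.Walk D.root r), q.IsPath → (h : D.Child r s) →
      q.length = D.T.dist D.root r → (q.concat h.1).IsPath := by
    intro r q hq h hql
    refine hq.concat (fun hs => ?_) h.1
    have := D.T.dist_le (q.takeUntil s hs)
    have := q.length_takeUntil_le_length hs
    have := h.dist
    omega
  have e := D.isTree.isAcyclic.subsingleton_path D.root s |>.elim
    ⟨_, key p hp h hpl⟩ ⟨_, key p' hp' h' hpl'⟩
  have e' := congrArg (fun q : D.T.Path D.root s => (q : D.T.Walk D.root s).penultimate) e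
  simpa using e'

theorem exists_parent {s : Fin D.N} (hs : s ≠ D.root) : ∃ t, D.Child t s := by
  obtain ⟨p, hp, hpl⟩ := D.isTree.connected.exists_path_of_dist D.root s
  have hnil : ¬ p.Nil := by
    intro h
    exact hs h.eq.symm
  refine ⟨p.penultimate, p.adj_penultimate hnil, ?_⟩
  have h1 := D.T.dist_le p.dropLast
  have h2 : p.dropLast.length + 1 = p.length := by
    have := p.length_dropLast_add_one hnil
    simpa using this
  rcases D.isTree.dist_eq_dist_add_one_of_adj D.root (p.adj_penultimate hnil) with h | h <;> omega

theorem Child.of_adj {t s : Fin D.N} (h : D.T.Adj t s) : D.Child t s ∨ D.Child s t := by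
  rcases D.isTree.dist_eq_dist_add_one_of_adj D.root h with h' | h'
  · exact Or.inr ⟨h.symm, h'⟩
  · exact Or.inl ⟨h, h'⟩

/-- Induction from the leaves to the root. -/
theorem up_induction {P : Fin D.N → Prop} (h : ∀ t, (∀ s, D.Child t s → P s) → P t) (t : Fin D.N) :
    P t := by
  obtain ⟨M, hM⟩ : ∃ M, ∀ s, D.T.dist D.root s ≤ M :=
    ⟨Finset.univ.sup (D.T.dist D.root), fun s => Finset.le_sup (f := D.T.dist D.root) (by simp)⟩
  induction hm : M - D.T.dist D.root t using Nat.strong_induction_on generalizing t with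
  | _ m ih =>
    refine h t fun s hs => ih _ ?_ s rfl
    have := hs.dist
    have := hM s
    omega

/-- Induction from the root to the leaves. -/
theorem down_induction {P : Fin D.N → Prop} (h0 : P D.root) (h : ∀ t s, D.Child t s → P t → P s)
    (t : Fin D.N) : P t := by
  induction hm : D.T.dist D.root t generalizing t with
  | zero =>
    obtain rfl := D.isTree.connected.dist_eq_zero_iff.1 hm
    exact h0
  | succ m ih =>
    have : t ≠ D.root := by
      rintro rfl
      simp at hm
    obtain ⟨p, hp⟩ := exists_parent this
    exact h p t hp (ih p (by have := hp.dist; omega))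

variable (D) in
/-- `s` lies in the subtree below `t`. -/
def Desc (t s : Fin D.N) : Prop := Relation.ReflTransGen D.Child t s

theorem Desc.refl (t : Fin D.N) : D.Desc t t := Relation.ReflTransGen.refl

theorem Child.desc {t s q : Fin D.N} (h : D.Child t s) (h' : D.Desc s q) : D.Desc t q :=
  Relation.ReflTransGen.head h h'

theorem Desc.trans {t s q : Fin D.N} (h : D.Desc t s) (h' : D.Desc s q) : D.Desc t q :=
  Relation.ReflTransGen.trans h h'

theorem desc_iff {t q : Fin D.N} : D.Desc t q ↔ q = t ∨ ∃ s, D.Child t s ∧ D.Desc s q := by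
  constructor
  · intro h
    rcases Relation.ReflTransGen.cases_head h with h | h
    · exact Or.inl h.symm
    · exact Or.inr h
  · rintro (rfl | ⟨s, h, h'⟩)
    · exact Desc.refl _
    · exact h.desc h'

theorem Desc.dist_le {t s : Fin D.N} (h : D.Desc t s) :
    D.T.dist D.root t ≤ D.T.dist D.root s := by
  induction h with
  | refl => rfl
  | tail _ h ih => have := Child.dist h; omega

theorem Child.not_desc {t s : Fin D.N} (h : D.Child t s) : ¬ D.Desc s t := fun h' => by
  have := h'.dist_le
  have := h.dist
  omega

theorem root_desc (t : Fin D.N) : D.Desc D.root t :=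
  down_induction (Desc.refl _) (fun _ _ h h' => Relation.ReflTransGen.tail h' h) t

/-- The ancestors of a node form a chain, on which the depth is injective. -/
theorem Desc.eq_of_dist {a a' b : Fin D.N} (h : D.Desc a b) (h' : D.Desc a' b)
    (hd : D.T.dist D.root a = D.T.dist D.root a') : a = a' := by
  induction h using Relation.ReflTransGen.trans_induction_on with
  | refl a =>
    rcases Relation.ReflTransGen.cases_tail h' with h | ⟨c, hc, hcb⟩
    · exact h
    · have := Child.dist hcb
      have := Desc.dist_le hc
      omega
  | single h =>
    rename_i a b
    rcases Relation.ReflTransGen.cases_tail h' with h1 | ⟨c, hc, hcb⟩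
    · subst h1
      have := Child.dist h
      omega
    · obtain rfl := Child.unique hcb h
      rcases Relation.ReflTransGen.cases_tail hc with h1 | ⟨e, he, hec⟩
      · exact h1
      · have := Child.dist hec
        have := Desc.dist_le he
        omega
  | trans h1 h2 ih1 ih2 =>
    rename_i a b c
    by_cases hab : D.Desc a' b
    · exact ih1 hab hd
    · exfalso
      -- Climb from `q` to `b` through the unique parents. The node `a'` cannot be met strictly
      -- below `b`, because it has the depth of `a`, which is at most that of `b`.
      have : ∀ q, D.Desc b q → D.Desc a' q → D.Desc a' b := by
        intro q hq
        induction hq with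
        | refl => exact id
        | tail h3 h4 ih =>
          intro h5
          rcases Relation.ReflTransGen.cases_tail h5 with h6 | ⟨e, he, hec⟩
          · subst h6
            have := Child.dist h4
            have := Desc.dist_le h3
            have := Desc.dist_le h1
            omega
          · obtain rfl := Child.unique hec h4
            exact ih he
      exact hab (this c h2 h')

/-- The nodes containing `v` are connected through the edges of the tree. -/
theorem mem_bag_of_desc {v : Fin n} {a b s t : Fin D.N} (ha : v ∈ D.bag a) (hb : v ∈ D.bag b)
    (hts : D.Child t s) (hsa : D.Desc s a) (hsb : ¬ D.Desc s b) : v ∈ D.bag s ∧ v ∈ D.bag t := by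
  -- A walk through bags containing `v` leaves the subtree below `s`, and the only tree edge leaving
  -- it joins `s` to its parent `t`.
  obtain ⟨p⟩ := (D.bag_connected v).preconnected ⟨a, ha⟩ ⟨b, hb⟩
  obtain ⟨d, hd, h1, h2⟩ := p.exists_boundary_dart {q | D.Desc s q} hsa hsb
  have hadj : D.T.Adj d.fst d.snd := d.adj
  rcases Child.of_adj hadj with h | h
  · exact absurd (Relation.ReflTransGen.tail h1 h) h2
  · rcases Relation.ReflTransGen.cases_tail h1 with h3 | ⟨c, hc, hcb⟩
    · have e : t = d.snd := by
        rw [h3] at h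
        exact hts.unique h
      refine ⟨?_, ?_⟩
      · rw [← h3]
        exact d.fst.2
      · rw [e]
        exact d.snd.2
    · obtain rfl := Child.unique hcb h
      exact absurd hc h2

end NiceTreeDecomposition

namespace NodeType

variable {n N : ℕ}

theorem forgets_iff {v : Fin n} {a : NodeType n N} : a.Forgets v ↔ ∃ s, a = .forget v s := by
  cases a <;> simp [Forgets]

theorem introducesEdge_symm {u v : Fin n} {a : NodeType n N} (h : a.IntroducesEdge u v) :
    a.IntroducesEdge v u := by
  cases a <;> simp only [IntroducesEdge] at h ⊢
  rw [h, Sym2.eq_swap]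

end NodeType

namespace NiceTreeDecomposition

variable {n : ℕ} {G : SimpleGraph (Fin n)} {D : NiceTreeDecomposition G}

/-! ### Vertices and edges below a node -/

theorem valid_of_node {t : Fin D.N} {a : NodeType n D.N} (h : D.node t = a) :
    a.IsValid G D.T D.root D.bag t := h ▸ D.node_valid t

theorem child_of_node {t s : Fin D.N} {a : NodeType n D.N} (h : D.node t = a) (hs : a.HasChild s) :
    D.Child t s := (D.child_iff t s).2 (h ▸ hs)

variable (D) in
/-- The vertex `v` is forgotten in the subtree below `t`. -/
def Below (t : Fin D.N) (v : Fin n) : Prop := ∃ q, D.Desc t q ∧ (D.node q).Forgets v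

variable (D) in
/-- The vertex `v` occurs in the subtree below `t`. -/
def Occurs (t : Fin D.N) (v : Fin n) : Prop := ∃ q, D.Desc t q ∧ v ∈ D.bag q

variable (D) in
/-- The edge `{u, v}` is introduced in the subtree below `t`. -/
def EdgeBelow (t : Fin D.N) (u v : Fin n) : Prop :=
  ∃ q, D.Desc t q ∧ (D.node q).IntroducesEdge u v

theorem below_iff {t : Fin D.N} {v : Fin n} :
    D.Below t v ↔ (D.node t).Forgets v ∨ ∃ s, D.Child t s ∧ D.Below s v := by
  unfold Below
  simp only [D.desc_iff (t := t)]
  grind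

theorem edgeBelow_iff {t : Fin D.N} {u v : Fin n} :
    D.EdgeBelow t u v ↔ (D.node t).IntroducesEdge u v ∨ ∃ s, D.Child t s ∧ D.EdgeBelow s u v := by
  unfold EdgeBelow
  simp only [D.desc_iff (t := t)]
  grind

theorem mem_bag_of_introducesEdge {t : Fin D.N} {u v : Fin n} (h : (D.node t).IntroducesEdge u v) :
    u ∈ D.bag t ∧ v ∈ D.bag t := by
  have hv := D.node_valid t
  generalize D.node t = a at h hv
  cases a <;> simp only [NodeType.IntroducesEdge] at h
  rename_i a b s
  obtain ⟨-, -, -, h1, h2⟩ := hv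
  rcases Sym2.eq_iff.1 h with ⟨rfl, rfl⟩ | ⟨rfl, rfl⟩
  · exact ⟨h1, h2⟩
  · exact ⟨h2, h1⟩

theorem EdgeBelow.occurs {t : Fin D.N} {u v : Fin n} (h : D.EdgeBelow t u v) :
    D.Occurs t u ∧ D.Occurs t v := by
  obtain ⟨q, hq, h⟩ := h
  have := mem_bag_of_introducesEdge h
  exact ⟨⟨q, hq, this.1⟩, ⟨q, hq, this.2⟩⟩

theorem EdgeBelow.symm {t : Fin D.N} {u v : Fin n} (h : D.EdgeBelow t u v) : D.EdgeBelow t v u := by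
  obtain ⟨q, hq, h⟩ := h
  exact ⟨q, hq, NodeType.introducesEdge_symm h⟩

theorem forget_spec {q : Fin D.N} {v : Fin n} (h : (D.node q).Forgets v) :
    ∃ s, D.node q = .forget v s ∧ D.Child q s ∧ v ∈ D.bag s ∧ D.bag q = (D.bag s).erase v := by
  obtain ⟨s, hs⟩ := NodeType.forgets_iff.1 h
  have := valid_of_node hs
  exact ⟨s, hs, child_of_node hs rfl, this.2⟩

/-- At the node `q` forgetting `v`, the vertex lies in the bag of the child but not in that of `q`.
If it occurred again above, the bags containing `v` would have to be connected through `q`. -/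
theorem Below.not_mem_bag {t : Fin D.N} {v : Fin n} (h : D.Below t v) : v ∉ D.bag t := by
  obtain ⟨q, hq, h⟩ := h
  obtain ⟨s, hs, hc, hv, hb⟩ := forget_spec h
  intro ht
  have hd : ¬ D.Desc s t := fun h' => by
    have := h'.dist_le
    have := hq.dist_le
    have := hc.dist
    omega
  have := (mem_bag_of_desc hv ht hc (Desc.refl _) hd).2
  simp [hb] at this

theorem Below.occurs {t : Fin D.N} {v : Fin n} (h : D.Below t v) : D.Occurs t v := by
  obtain ⟨q, hq, h⟩ := h
  obtain ⟨s, hs, hc, hv, hb⟩ := forget_spec h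
  exact ⟨s, hq.trans (hc.desc (Desc.refl _)), hv⟩

/-- When passing from a child to its parent, only a forgotten vertex leaves the bag. -/
theorem Child.mem_bag_or_forgets {t s : Fin D.N} (h : D.Child t s) {v : Fin n} (hv : v ∈ D.bag s) :
    v ∈ D.bag t ∨ (D.node t).Forgets v := by
  have hc := (D.child_iff t s).1 h
  have hval := D.node_valid t
  generalize D.node t = a at hc hval
  cases a <;> simp only [NodeType.HasChild] at hc <;>
    simp only [NodeType.IsValid, NodeType.Forgets] at hval ⊢
  · subst hc
    left
    rw [hval.2.2]
    exact Finset.mem_insert_of_mem hv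
  · subst hc
    left
    rw [hval.2.2.1]
    exact hv
  · subst hc
    rename_i u
    by_cases huv : u = v
    · exact Or.inr huv
    · left
      rw [hval.2.2]
      exact Finset.mem_erase.2 ⟨fun h => huv h.symm, hv⟩
  · left
    rcases hc with rfl | rfl
    · rwa [← hval.2.2.1]
    · rwa [← hval.2.2.2]

/-- While climbing from an occurrence of `v` to `t`, the vertex can leave the bag only at the node
that forgets it. -/
theorem Occurs.mem_bag_or_below {t : Fin D.N} {v : Fin n} (h : D.Occurs t v) :
    v ∈ D.bag t ∨ D.Below t v := by
  induction t using up_induction with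
  | h t ih =>
    obtain ⟨q, hq, hv⟩ := h
    rcases desc_iff.1 hq with rfl | ⟨s, hs, hsq⟩
    · exact Or.inl hv
    · rcases ih s hs ⟨q, hsq, hv⟩ with h1 | h1
      · rcases hs.mem_bag_or_forgets h1 with h2 | h2
        · exact Or.inl h2
        · exact Or.inr ⟨t, Desc.refl _, h2⟩
      · exact Or.inr (below_iff.2 (Or.inr ⟨s, hs, h1⟩))

/-- All edges at a vertex that is forgotten below `t` are introduced below `t`. -/
theorem Below.edgeBelow {t : Fin D.N} {v y : Fin n} (h : D.Below t v) (hvy : G.Adj v y) :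
    D.EdgeBelow t v y := by
  obtain ⟨q, hq, h⟩ := h
  obtain ⟨s, hs, hc, hv, hb⟩ := forget_spec h
  -- The bag of the introducing node `r` contains `v`. If `r` were not below the child `s` of the
  -- forget node `q`, then `v` would have to be in the bag of `q`.
  obtain ⟨r, hr, -⟩ := D.edge_once v y hvy
  have hvr := (mem_bag_of_introducesEdge hr).1
  by_cases hd : D.Desc s r
  · exact ⟨r, hq.trans (hc.desc hd), hr⟩
  · have := (mem_bag_of_desc hv hvr hc (Desc.refl _) hd).2
    simp [hb] at this

theorem not_occurs_of_not_mem_bag {t s : Fin D.N} {v : Fin n} (h : D.Child t s)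
    (hv : v ∈ D.bag t) (hv' : v ∉ D.bag s) : ¬ D.Occurs s v := by
  rintro ⟨q, hq, hvq⟩
  exact hv' (mem_bag_of_desc hvq hv h hq h.not_desc).1

/-- The subtrees below two distinct children are disjoint, so the bags containing `v` connect them
only through `t`. This is what separates the two sides of a join. -/
theorem mem_bag_of_occurs_of_occurs {t s₁ s₂ : Fin D.N} {v : Fin n} (h₁ : D.Child t s₁)
    (h₂ : D.Child t s₂) (hne : s₁ ≠ s₂) (hv₁ : D.Occurs s₁ v) (hv₂ : D.Occurs s₂ v) :
    v ∈ D.bag t := by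
  obtain ⟨q₁, hq₁, hvq₁⟩ := hv₁
  obtain ⟨q₂, hq₂, hvq₂⟩ := hv₂
  refine (mem_bag_of_desc hvq₁ hvq₂ h₁ hq₁ fun h => hne ?_).2
  exact h.eq_of_dist hq₂ (by rw [h₁.dist, h₂.dist])

theorem below_root (v : Fin n) : D.Below D.root v := by
  obtain ⟨q, hq, -⟩ := D.forget_once v
  exact ⟨q, root_desc q, hq⟩

end NiceTreeDecomposition

/-! ### The dynamic program -/

/-- An entry of the dynamic program at a node: facilities and labels of the vertices of the bag,
the number of finished clusters, the cost of the forgotten vertices, and the entries of the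
children from which it was obtained. -/
structure Entry (n : ℕ) where
  fac : Fin n → ℕ
  lab : Fin n → ℕ
  cnt : ℕ
  cost : ℝ
  p₁ : ℕ
  p₂ : ℕ

/-- The entries agree up to cost and origin. -/
def Entry.Same {n : ℕ} (B : Finset (Fin n)) (E E' : Entry n) : Prop :=
  E.cnt = E'.cnt ∧ ∀ u ∈ B, E.fac u = E'.fac u ∧ E.lab u = E'.lab u

open Classical in
/-- `1` if `v` has a label different from those in `B`, and `0` otherwise. -/
noncomputable def Entry.alone {n : ℕ} (B : Finset (Fin n)) (v : Fin n) (E : Entry n) : ℕ :=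
  if ∃ u ∈ B, E.lab u = E.lab v then 0 else 1

namespace NodeType

variable {n N : ℕ}

/-- The choice `c` can be made for the entries `E₁`, `E₂` of the children. -/
def Feas (B : Finset (Fin n)) (k : ℕ) (c : ℕ × ℕ) (E₁ E₂ : Entry n) : NodeType n N → Prop
  | .leaf => True
  | .introVertex v _ => c.1 < k ∧ c.2 < B.card ∧ ∀ u ∈ B, u ≠ v → E₁.lab u ≠ c.2
  | .introEdge u v _ => c.1 = 0 ∨ c.1 = 1 ∧ E₁.fac u = E₁.fac v
  | .forget v _ => E₁.cnt + E₁.alone B v ≤ k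
  | .join _ _ => (∀ u ∈ B, E₁.fac u = E₂.fac u) ∧ E₁.cnt + E₂.cnt ≤ k

/-- The choice `c` leads from the entries `E₁`, `E₂` of the children to the entry `E`. -/
def Leads (B : Finset (Fin n)) (c : ℕ × ℕ) (E₁ E₂ E : Entry n) : NodeType n N → Prop
  | .leaf => E.cnt = 0
  | .introVertex v _ => E.cnt = E₁.cnt ∧ E.fac v = c.1 ∧ E.lab v = c.2 ∧
      ∀ u ∈ B, u ≠ v → E.fac u = E₁.fac u ∧ E.lab u = E₁.lab u
  | .introEdge u v _ => E.cnt = E₁.cnt ∧ ∀ x ∈ B, E.fac x = E₁.fac x ∧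
      E.lab x = if c.1 = 1 ∧ E₁.lab x = E₁.lab u then E₁.lab v else E₁.lab x
  | .forget v _ => E.cnt = E₁.cnt + E₁.alone B v ∧
      ∀ u ∈ B, E.fac u = E₁.fac u ∧ E.lab u = E₁.lab u
  | .join _ _ => E.cnt = E₁.cnt + E₂.cnt ∧ (∀ u ∈ B, E.fac u = E₁.fac u) ∧
      (∀ u ∈ B, ∀ v ∈ B, E₁.lab u = E₁.lab v → E.lab u = E.lab v) ∧
      (∀ u ∈ B, ∀ v ∈ B, E₂.lab u = E₂.lab v → E.lab u = E.lab v) ∧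
      -- The new labels are the finest common coarsening of both partitions. Testing against an
      -- arbitrary equivalence relation lets completeness insert reachability and soundness insert
      -- reachability together with equality of facilities.
      ∀ R : Setoid (Fin n), (∀ u ∈ B, ∀ v ∈ B, E₁.lab u = E₁.lab v → R u v) →
        (∀ u ∈ B, ∀ v ∈ B, E₂.lab u = E₂.lab v → R u v) →
        ∀ u ∈ B, ∀ v ∈ B, E.lab u = E.lab v → R u v

/-- The cost of an entry obtained from the entries `E₁`, `E₂` of the children. -/
def newCost (g : Fin n → ℕ → ℝ) (E₁ E₂ : Entry n) : NodeType n N → ℝ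
  | .leaf => 0
  | .introVertex _ _ => E₁.cost
  | .introEdge _ _ _ => E₁.cost
  | .forget v _ => E₁.cost + g v (E₁.fac v)
  | .join _ _ => E₁.cost + E₂.cost

end NodeType

namespace NiceTreeDecomposition

variable {n : ℕ} {G : SimpleGraph (Fin n)} (D : NiceTreeDecomposition G)

/-- The entries `F t ≤ e < L t` of the node `t` contain the best entry for every choice. -/
def Complete (k : ℕ) (g : Fin n → ℕ → ℝ) (ent : ℕ → Entry n) (F L : ℕ → ℕ) (t : Fin D.N) : Prop :=
  ∀ (c : ℕ × ℕ) (e₁ e₂ : ℕ),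
    (1 ≤ (D.node t).tag → F (D.node t).child₁ ≤ e₁ ∧ e₁ < L (D.node t).child₁) →
    (4 ≤ (D.node t).tag → F (D.node t).child₂ ≤ e₂ ∧ e₂ < L (D.node t).child₂) →
    (D.node t).Feas (D.bag t) k c (ent e₁) (ent e₂) →
    ∃ e, F t ≤ e ∧ e < L t ∧ (D.node t).Leads (D.bag t) c (ent e₁) (ent e₂) (ent e) ∧
      (ent e).cost ≤ (D.node t).newCost g (ent e₁) (ent e₂)

variable {D}

/-- The edges introduced below `t` inside of the clusters. -/
def clusterGraph {k : ℕ} (D : NiceTreeDecomposition G) (cl : Fin n → Fin k) (t : Fin D.N) :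
    SimpleGraph (Fin n) where
  Adj u v := cl u = cl v ∧ G.Adj u v ∧ D.EdgeBelow t u v
  symm := ⟨fun _ _ h => ⟨h.1.symm, h.2.1.symm, h.2.2.symm⟩⟩
  loopless := ⟨fun _ h => h.2.1.ne rfl⟩

theorem reachable_cl {k : ℕ} {cl : Fin n → Fin k} {t : Fin D.N} {u v : Fin n}
    (h : (D.clusterGraph cl t).Reachable u v) : cl u = cl v := by
  obtain ⟨p⟩ := h
  induction p with
  | nil => rfl
  | cons h _ ih => exact h.1.trans ih

theorem occurs_of_reachable {k : ℕ} {cl : Fin n → Fin k} {t : Fin D.N} {u v : Fin n}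
    (h : (D.clusterGraph cl t).Reachable u v) (hu : D.Occurs t u) : D.Occurs t v := by
  obtain ⟨p⟩ := h
  induction p with
  | nil => exact hu
  | cons h _ ih => exact ih h.2.2.occurs.2

theorem clusterGraph_le_of_child {k : ℕ} {cl : Fin n → Fin k} {t s : Fin D.N} (h : D.Child t s) :
    D.clusterGraph cl s ≤ D.clusterGraph cl t := fun _ _ hab =>
  ⟨hab.1, hab.2.1, edgeBelow_iff.2 (Or.inr ⟨s, h, hab.2.2⟩)⟩

open Classical in
/-- The clusters that are finished at `t`. -/
noncomputable def finished {k : ℕ} (D : NiceTreeDecomposition G) (cl : Fin n → Fin k)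
    (t : Fin D.N) : Finset (Fin k) :=
  {i | ∀ v, cl v = i → D.Below t v}

open Classical in
/-- The vertices forgotten below `t`. -/
noncomputable def belowSet (D : NiceTreeDecomposition G) (t : Fin D.N) : Finset (Fin n) :=
  {v | D.Below t v}

/-- If one vertex of a connected cluster has a property that is passed on along edges of the
cluster, then so do all. -/
theorem forall_of_connected {k : ℕ} {cl : Fin n → Fin k} {i : Fin k}
    (hcon : (G.induce {v | cl v = i}).Connected) {S : Fin n → Prop} {v : Fin n} (hv : cl v = i)
    (hSv : S v) (h : ∀ x y, cl x = i → cl y = i → G.Adj x y → S x → S y) {y : Fin n}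
    (hy : cl y = i) : S y := by
  obtain ⟨p⟩ := hcon.preconnected ⟨v, hv⟩ ⟨y, hy⟩
  by_contra hSy
  obtain ⟨d, hd, h1, h2⟩ := p.exists_boundary_dart {q | S q} hSv hSy
  exact h2 (h d.fst d.snd d.fst.2 d.snd.2 d.adj h1)

end NiceTreeDecomposition

/-! ### Completeness: entries describing a given connected clustering. -/

namespace NiceTreeDecomposition

variable {n : ℕ} {G : SimpleGraph (Fin n)} {D : NiceTreeDecomposition G}

section completeness

variable {k : ℕ} {cl : Fin n → Fin k}

/-- The entry describes the restriction of the clustering `cl` with facilities `fc` to the part of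
the graph below `t`. -/
structure Describes (D : NiceTreeDecomposition G) (cl : Fin n → Fin k) (fc : Fin n → ℕ)
    (g : Fin n → ℕ → ℝ) (t : Fin D.N) (E : Entry n) : Prop where
  fac : ∀ u ∈ D.bag t, E.fac u = fc u
  lab : ∀ u ∈ D.bag t, ∀ v ∈ D.bag t, E.lab u = E.lab v ↔ (D.clusterGraph cl t).Reachable u v
  cnt : E.cnt = (D.finished cl t).card
  cost : E.cost ≤ ∑ v ∈ D.belowSet t, g v (fc v)

theorem card_finished_le (t : Fin D.N) : (D.finished cl t).card ≤ k := by
  simpa using Finset.card_le_univ (D.finished cl t)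

theorem below_congr {t s : Fin D.N} (h : ∀ q, D.Child t q ↔ q = s)
    (hf : ∀ v, ¬ (D.node t).Forgets v) (v : Fin n) : D.Below t v ↔ D.Below s v := by
  rw [below_iff]
  simp [h, hf]

theorem clusterGraph_congr {t s : Fin D.N} (h : ∀ q, D.Child t q ↔ q = s)
    (hf : ∀ u v, ¬ (D.node t).IntroducesEdge u v) : D.clusterGraph cl t = D.clusterGraph cl s := by
  ext u v
  simp [clusterGraph, edgeBelow_iff (t := t), h, hf]

theorem belowSet_congr {t s : Fin D.N} (h : ∀ v, D.Below t v ↔ D.Below s v) :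
    D.belowSet t = D.belowSet s := by
  ext v
  simp [belowSet, h]

theorem finished_congr {t s : Fin D.N} (h : ∀ v, D.Below t v ↔ D.Below s v) :
    D.finished cl t = D.finished cl s := by
  ext i
  simp [finished, h]

theorem occurs_of_mem_bag {t : Fin D.N} {v : Fin n} (h : v ∈ D.bag t) : D.Occurs t v :=
  ⟨t, Desc.refl _, h⟩

/-- Surjectivity of `cl` matters here: an empty cluster would vacuously be finished at a leaf,
whereas the count starts at `0`. -/
theorem describes_leaf {fc : Fin n → ℕ} {g : Fin n → ℕ → ℝ} {t : Fin D.N} {E : Entry n}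
    (hcl : Function.Surjective cl) (ht : D.node t = .leaf) (hcnt : E.cnt = 0)
    (hcost : E.cost ≤ 0) : Describes D cl fc g t E := by
  have hbag : D.bag t = ∅ := (valid_of_node ht).2
  have hbelow : ∀ v, ¬ D.Below t v := by
    intro v
    rw [below_iff, ht]
    simp [D.child_iff, ht, NodeType.HasChild, NodeType.Forgets]
  refine ⟨by simp [hbag], by simp [hbag], ?_, ?_⟩
  · rw [hcnt, eq_comm, Finset.card_eq_zero]
    ext i
    obtain ⟨v, hv⟩ := hcl i
    simpa [finished] using ⟨v, hv, hbelow v⟩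
  · simpa [belowSet, hbelow] using hcost

/-- The new vertex does not occur below the child, so no introduced edge meets it. It is isolated in
the cluster graph and receives a label of its own. -/
theorem describes_introVertex {fc : Fin n → ℕ} {g : Fin n → ℕ → ℝ} {t s : Fin D.N} {v : Fin n}
    (ht : D.node t = .introVertex v s) {E₁ : Entry n} (h₁ : Describes D cl fc g s E₁)
    (hfc : ∀ v, fc v < k) :
    ∃ c, (D.node t).Feas (D.bag t) k c E₁ E₁ ∧ ∀ E, (D.node t).Leads (D.bag t) c E₁ E₁ E →
      E.cost ≤ (D.node t).newCost g E₁ E₁ → Describes D cl fc g t E := by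
  obtain ⟨-, hv, hbag⟩ := valid_of_node ht
  have hvt : v ∈ D.bag t := by simp [hbag]
  have hmem : ∀ u ∈ D.bag t, u ≠ v → u ∈ D.bag s := by
    intro u hu huv
    simpa [hbag, huv] using hu
  have hchild : ∀ q, D.Child t q ↔ q = s := fun q => by
    simp [D.child_iff, ht, NodeType.HasChild]
  -- Pigeonhole: the bag of `s` uses at most `(D.bag s).card` labels, and one more than that is
  -- available.
  obtain ⟨l, hl, hl'⟩ : ∃ l ∈ Finset.range (D.bag t).card, l ∉ (D.bag s).image E₁.lab := by
    refine Finset.exists_mem_notMem_of_card_lt_card ?_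
    rw [Finset.card_range, hbag, Finset.card_insert_of_notMem hv]
    exact Nat.lt_succ_of_le Finset.card_image_le
  rw [Finset.mem_range] at hl
  have hl'' : ∀ u ∈ D.bag s, E₁.lab u ≠ l := by simpa using hl'
  refine ⟨(fc v, l), ?_, fun E hE hcost => ?_⟩
  · rw [ht]
    exact ⟨hfc v, hl, fun u hu huv => hl'' u (hmem u hu huv)⟩
  · rw [ht] at hE hcost
    obtain ⟨hcnt, hfv, hlv, hE⟩ := hE
    have hb := below_congr hchild (by simp [ht, NodeType.Forgets])
    have hH : D.clusterGraph cl t = D.clusterGraph cl s :=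
      clusterGraph_congr hchild (by simp [ht, NodeType.IntroducesEdge])
    have hiso : ∀ u ∈ D.bag s, ¬ (D.clusterGraph cl s).Reachable u v := fun u hu h =>
      not_occurs_of_not_mem_bag ((hchild s).2 rfl) hvt hv
        (occurs_of_reachable h (occurs_of_mem_bag hu))
    refine ⟨?_, ?_, ?_, ?_⟩
    · intro u hu
      by_cases huv : u = v
      · rw [huv, hfv]
      · rw [(hE u hu huv).1, h₁.fac u (hmem u hu huv)]
    · intro x hx y hy
      rw [hH]
      by_cases hxv : x = v <;> by_cases hyv : y = v
      · simp [hxv, hyv]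
      · rw [hxv, hlv, (hE y hy hyv).2]
        exact iff_of_false (fun h => hl'' y (hmem y hy hyv) h.symm)
          fun h => hiso y (hmem y hy hyv) h.symm
      · rw [hyv, hlv, (hE x hx hxv).2]
        exact iff_of_false (hl'' x (hmem x hx hxv)) (hiso x (hmem x hx hxv))
      · rw [(hE x hx hxv).2, (hE y hy hyv).2, h₁.lab x (hmem x hx hxv) y (hmem y hy hyv)]
    · rw [hcnt, h₁.cnt, finished_congr hb]
    · rw [belowSet_congr hb]
      exact le_trans hcost h₁.cost

/-- The right choice is to merge exactly when both ends belong to the same cluster; otherwise the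
cluster graph does not change at all. -/
theorem describes_introEdge {fc : Fin n → ℕ} {g : Fin n → ℕ → ℝ} {t s : Fin D.N} {u v : Fin n}
    (ht : D.node t = .introEdge u v s) {E₁ : Entry n} (h₁ : Describes D cl fc g s E₁)
    (hfc : ∀ u v, cl u = cl v → fc u = fc v) :
    ∃ c, (D.node t).Feas (D.bag t) k c E₁ E₁ ∧ ∀ E, (D.node t).Leads (D.bag t) c E₁ E₁ E →
      E.cost ≤ (D.node t).newCost g E₁ E₁ → Describes D cl fc g t E := by
  obtain ⟨-, huv, hbag, hu, hv⟩ := valid_of_node ht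
  have hchild : ∀ q, D.Child t q ↔ q = s := fun q => by
    simp [D.child_iff, ht, NodeType.HasChild]
  have hb := below_congr hchild (by simp [ht, NodeType.Forgets])
  rw [hbag] at hu hv
  rw [hbag, ht]
  have hle : D.clusterGraph cl s ≤ D.clusterGraph cl t := clusterGraph_le_of_child ((hchild s).2 rfl)
  have hadj : ∀ x y, (D.clusterGraph cl t).Adj x y → (D.clusterGraph cl s).Adj x y ∨
      cl u = cl v ∧ (x = u ∧ y = v ∨ x = v ∧ y = u) := by
    rintro x y ⟨h1, h2, h3⟩
    rw [edgeBelow_iff, ht] at h3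
    rcases h3 with h3 | ⟨q, hq, h3⟩
    · right
      rcases Sym2.eq_iff.1 h3 with ⟨rfl, rfl⟩ | ⟨rfl, rfl⟩
      · exact ⟨h1, by simp⟩
      · exact ⟨h1.symm, by simp⟩
    · rw [hchild] at hq
      subst hq
      exact Or.inl ⟨h1, h2, h3⟩
  by_cases hcl : cl u = cl v
  · refine ⟨(1, 0), Or.inr ⟨rfl, ?_⟩, fun E hE hcost => ⟨?_, ?_, ?_, ?_⟩⟩
    · rw [h₁.fac u hu, h₁.fac v hv, hfc u v hcl]
    · intro x hx
      rw [hbag] at hx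
      rw [(hE.2 x hx).1, h₁.fac x hx]
    · intro x hx y hy
      rw [hbag] at hx hy
      have huvt : (D.clusterGraph cl t).Reachable u v := SimpleGraph.Adj.reachable
        ⟨hcl, huv, edgeBelow_iff.2 (Or.inl (by rw [ht]; rfl))⟩
      -- A connection using the new edge can be shortened so that it uses the edge at most once, in
      -- one of its two directions.
      have hsplit : ∀ x y, (D.clusterGraph cl t).Reachable x y →
          (D.clusterGraph cl s).Reachable x y ∨
          ((D.clusterGraph cl s).Reachable x u ∧ (D.clusterGraph cl s).Reachable v y) ∨
          ((D.clusterGraph cl s).Reachable x v ∧ (D.clusterGraph cl s).Reachable u y) := by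
        rintro x y ⟨p⟩
        induction p with
        | nil => exact Or.inl .rfl
        | cons h p ih =>
          rcases hadj _ _ h with h' | ⟨-, ⟨rfl, rfl⟩ | ⟨rfl, rfl⟩⟩
          · rcases ih with h1 | ⟨h1, h2⟩ | ⟨h1, h2⟩
            · exact Or.inl (h'.reachable.trans h1)
            · exact Or.inr (Or.inl ⟨h'.reachable.trans h1, h2⟩)
            · exact Or.inr (Or.inr ⟨h'.reachable.trans h1, h2⟩)
          · rcases ih with h1 | ⟨h1, h2⟩ | ⟨h1, h2⟩
            · exact Or.inr (Or.inl ⟨.rfl, h1⟩)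
            · exact Or.inr (Or.inl ⟨.rfl, h2⟩)
            · exact Or.inl h2
          · rcases ih with h1 | ⟨h1, h2⟩ | ⟨h1, h2⟩
            · exact Or.inr (Or.inr ⟨.rfl, h1⟩)
            · exact Or.inl h2
            · exact Or.inr (Or.inr ⟨.rfl, h2⟩)
      rw [(hE.2 x hx).2, (hE.2 y hy).2]
      simp only [true_and]
      constructor
      · intro h
        split_ifs at h with h1 h2 h2
        · exact (((h₁.lab x hx u hu).1 h1).trans ((h₁.lab u hu y hy).1 h2.symm)).mono hle
        · exact (((h₁.lab x hx u hu).1 h1).mono hle).trans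
            (huvt.trans (((h₁.lab v hv y hy).1 h).mono hle))
        · exact (((h₁.lab x hx v hv).1 h).mono hle).trans
            (huvt.symm.trans (((h₁.lab u hu y hy).1 h2.symm).mono hle))
        · exact ((h₁.lab x hx y hy).1 h).mono hle
      · intro h
        rcases hsplit x y h with h | ⟨h, h'⟩ | ⟨h, h'⟩
        · rw [(h₁.lab x hx y hy).2 h]
        · have e1 := (h₁.lab x hx u hu).2 h
          have e2 := (h₁.lab v hv y hy).2 h'
          simp [e1, e2]
        · have e1 := (h₁.lab x hx v hv).2 h
          have e2 := (h₁.lab u hu y hy).2 h'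
          simp [e1, e2]
    · rw [hE.1, h₁.cnt, finished_congr hb]
    · rw [belowSet_congr hb]
      exact le_trans hcost h₁.cost
  · have hH : D.clusterGraph cl t = D.clusterGraph cl s := by
      refine le_antisymm (fun x y h => ?_) hle
      rcases hadj x y h with h | ⟨h, -⟩
      · exact h
      · exact absurd h hcl
    refine ⟨(0, 0), Or.inl rfl, fun E hE hcost => ⟨?_, ?_, ?_, ?_⟩⟩
    · intro x hx
      rw [hbag] at hx
      rw [(hE.2 x hx).1, h₁.fac x hx]
    · intro x hx y hy
      rw [hbag] at hx hy
      rw [(hE.2 x hx).2, (hE.2 y hy).2, hH, ← h₁.lab x hx y hy]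
      simp
    · rw [hE.1, h₁.cnt, finished_congr hb]
    · rw [belowSet_congr hb]
      exact le_trans hcost h₁.cost

/-- Forgetting `v` can finish only the cluster of `v`, and does so exactly if no remaining bag
vertex shares its label. The count thus grows by `Entry.alone`. -/
theorem describes_forget {fc : Fin n → ℕ} {g : Fin n → ℕ → ℝ} {t s : Fin D.N} {v : Fin n}
    (ht : D.node t = .forget v s) {E₁ : Entry n} (h₁ : Describes D cl fc g s E₁)
    (hcon : ∀ i, (G.induce {v | cl v = i}).Connected) :
    ∃ c, (D.node t).Feas (D.bag t) k c E₁ E₁ ∧ ∀ E, (D.node t).Leads (D.bag t) c E₁ E₁ E →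
      E.cost ≤ (D.node t).newCost g E₁ E₁ → Describes D cl fc g t E := by
  classical
  obtain ⟨-, hv, hbag⟩ := valid_of_node ht
  have hchild : ∀ q, D.Child t q ↔ q = s := fun q => by
    simp [D.child_iff, ht, NodeType.HasChild]
  have hH : D.clusterGraph cl t = D.clusterGraph cl s :=
    clusterGraph_congr hchild (by simp [ht, NodeType.IntroducesEdge])
  have hb : ∀ x, D.Below t x ↔ x = v ∨ D.Below s x := by
    intro x
    rw [below_iff, ht]
    simp [hchild, NodeType.Forgets, eq_comm]
  have hvs : ¬ D.Below s v := fun h => h.not_mem_bag hv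
  have hsub : ∀ u ∈ D.bag t, u ∈ D.bag s := fun u hu => by
    rw [hbag] at hu
    exact Finset.mem_of_mem_erase hu
  have hcard : E₁.cnt + E₁.alone (D.bag t) v = (D.finished cl t).card := by
    have hss : D.finished cl s ⊆ D.finished cl t := by
      intro i
      simp only [finished, Finset.mem_filter, Finset.mem_univ, true_and]
      exact fun h x hx => (hb x).2 (Or.inr (h x hx))
    have hother : ∀ i, i ≠ cl v → (i ∈ D.finished cl t ↔ i ∈ D.finished cl s) := by
      intro i hi
      refine ⟨?_, fun h => hss h⟩
      simp only [finished, Finset.mem_filter, Finset.mem_univ, true_and]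
      intro h x hx
      rcases (hb x).1 (h x hx) with rfl | h
      · exact absurd hx.symm hi
      · exact h
    have hnv : cl v ∉ D.finished cl s := by
      simp only [finished, Finset.mem_filter, Finset.mem_univ, true_and]
      exact fun h => hvs (h v rfl)
    rw [h₁.cnt, Entry.alone]
    split_ifs with hal
    · obtain ⟨u, hu, hlab⟩ := hal
      have hr := (h₁.lab u (hsub u hu) v hv).1 hlab
      have : cl v ∉ D.finished cl t := by
        simp only [finished, Finset.mem_filter, Finset.mem_univ, true_and]
        exact fun h => (h u (reachable_cl hr)).not_mem_bag hu
      rw [add_zero]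
      congr 1
      ext i
      by_cases hi : i = cl v
      · subst hi
        simp [this, hnv]
      · exact (hother i hi).symm
    · have hmem : cl v ∈ D.finished cl t := by
        -- If `v` has no companion, everything connected to `v` so far is `v` itself or already
        -- forgotten, because another bag vertex in its component would carry the same label.
        have key : ∀ x, (D.clusterGraph cl s).Reachable v x → D.Below t x := by
          intro x hx
          rcases (occurs_of_reachable hx (occurs_of_mem_bag hv)).mem_bag_or_below with h | h
          · by_cases hxv : x = v
            · exact (hb x).2 (Or.inl hxv)
            · exfalso
              refine hal ⟨x, ?_, (h₁.lab x h v hv).2 hx.symm⟩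
              rw [hbag]
              exact Finset.mem_erase.2 ⟨hxv, h⟩
          · exact (hb x).2 (Or.inr h)
        simp only [finished, Finset.mem_filter, Finset.mem_univ, true_and]
        intro x hx
        -- All edges at forgotten vertices have been introduced, so the component of `v` is closed
        -- under edges of the cluster. As the cluster is connected, the component is the whole
        -- cluster.
        refine key x (forall_of_connected (hcon (cl v)) (S := (D.clusterGraph cl s).Reachable v)
          rfl .rfl ?_ hx)
        intro a b ha hb' hab har
        have := (key a har).edgeBelow hab
        rw [← hH] at har ⊢
        exact har.trans (SimpleGraph.Adj.reachable ⟨ha.trans hb'.symm, hab, this⟩)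
      have : D.finished cl t = insert (cl v) (D.finished cl s) := by
        ext i
        by_cases hi : i = cl v
        · subst hi
          simp [hmem]
        · rw [hother i hi]
          simp [hi]
      rw [this, Finset.card_insert_of_notMem hnv]
  rw [ht]
  refine ⟨(0, 0), ?_, fun E hE hcost => ⟨?_, ?_, ?_, ?_⟩⟩
  · exact hcard.trans_le (card_finished_le t)
  · intro u hu
    rw [(hE.2 u hu).1, h₁.fac u (hsub u hu)]
  · intro x hx y hy
    rw [(hE.2 x hx).2, (hE.2 y hy).2, hH, h₁.lab x (hsub x hx) y (hsub y hy)]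
  · rw [hE.1, hcard]
  · have : D.belowSet t = insert v (D.belowSet s) := by
      ext x
      simp [belowSet, hb]
    rw [this, Finset.sum_insert (by simpa [belowSet] using hvs)]
    simp only [NodeType.newCost, h₁.fac v hv] at hcost
    linarith [h₁.cost]

/-- The two sides share only bag vertices. Counts and costs therefore add up, and the components
below `t` restricted to the bag are generated by the components on the two sides. -/
theorem describes_join {fc : Fin n → ℕ} {g : Fin n → ℕ → ℝ} {t s₁ s₂ : Fin D.N}
    (ht : D.node t = .join s₁ s₂) {E₁ E₂ : Entry n} (h₁ : Describes D cl fc g s₁ E₁)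
    (h₂ : Describes D cl fc g s₂ E₂)
    (hcon : ∀ i, (G.induce {v | cl v = i}).Connected) :
    ∃ c, (D.node t).Feas (D.bag t) k c E₁ E₂ ∧ ∀ E, (D.node t).Leads (D.bag t) c E₁ E₂ E →
      E.cost ≤ (D.node t).newCost g E₁ E₂ → Describes D cl fc g t E := by
  classical
  obtain ⟨hne, -, hbag₁, hbag₂⟩ := valid_of_node ht
  have hchild : ∀ q, D.Child t q ↔ q = s₁ ∨ q = s₂ := fun q => by
    simp [D.child_iff, ht, NodeType.HasChild]
  have hc₁ := (hchild s₁).2 (Or.inl rfl)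
  have hc₂ := (hchild s₂).2 (Or.inr rfl)
  have hb : ∀ x, D.Below t x ↔ D.Below s₁ x ∨ D.Below s₂ x := by
    intro x
    rw [below_iff, ht]
    simp [hchild, NodeType.Forgets]
  have hdisj : ∀ x, D.Below s₁ x → ¬ D.Occurs s₂ x := by
    intro x h1 h2
    have := mem_bag_of_occurs_of_occurs hc₁ hc₂ hne h1.occurs h2
    rw [← hbag₁] at this
    exact h1.not_mem_bag this
  have hdisj' : ∀ x, D.Below s₂ x → ¬ D.Occurs s₁ x := by
    intro x h1 h2
    have := mem_bag_of_occurs_of_occurs hc₁ hc₂ hne h2 h1.occurs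
    rw [← hbag₂] at this
    exact h1.not_mem_bag this
  -- A cluster forgotten below `t` lies on one side only: an edge from a vertex forgotten on one
  -- side is introduced there, so its other end occurs there and cannot have been forgotten on the
  -- other side. Nonemptiness makes the two families disjoint.
  have hcard : (D.finished cl t).card = (D.finished cl s₁).card + (D.finished cl s₂).card := by
    rw [← Finset.card_union_of_disjoint]
    · congr 1
      ext i
      simp only [finished, Finset.mem_filter, Finset.mem_univ, true_and, Finset.mem_union]
      constructor
      · intro h
        obtain ⟨⟨v, hv⟩⟩ := (hcon i).nonempty
        rcases (hb v).1 (h v hv) with h' | h'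
        · left
          intro y hy
          refine forall_of_connected (hcon i) (S := D.Below s₁) hv h' ?_ hy
          intro a b ha hb' hab has
          exact ((hb b).1 (h b hb')).resolve_right fun hbs =>
            hdisj' b hbs (has.edgeBelow hab).occurs.2
        · right
          intro y hy
          refine forall_of_connected (hcon i) (S := D.Below s₂) hv h' ?_ hy
          intro a b ha hb' hab has
          exact ((hb b).1 (h b hb')).resolve_left fun hbs =>
            hdisj b hbs (has.edgeBelow hab).occurs.2
      · rintro (h | h) v hv
        · exact (hb v).2 (Or.inl (h v hv))
        · exact (hb v).2 (Or.inr (h v hv))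
    · rw [Finset.disjoint_left]
      intro i h1 h2
      simp only [finished, Finset.mem_filter, Finset.mem_univ, true_and] at h1 h2
      obtain ⟨⟨v, hv⟩⟩ := (hcon i).nonempty
      exact hdisj v (h1 v hv) (h2 v hv).occurs
  rw [ht]
  refine ⟨(0, 0), ⟨?_, ?_⟩, fun E hE hcost => ⟨?_, ?_, ?_, ?_⟩⟩
  · intro u hu
    rw [h₁.fac u (hbag₁ ▸ hu), h₂.fac u (hbag₂ ▸ hu)]
  · rw [h₁.cnt, h₂.cnt, ← hcard]
    exact card_finished_le t
  · intro u hu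
    rw [hE.2.1 u hu, h₁.fac u (hbag₁ ▸ hu)]
  · obtain ⟨-, -, hl₁, hl₂, hmin⟩ := hE
    have lab₁ := h₁.lab
    have lab₂ := h₂.lab
    rw [hbag₁] at lab₁
    rw [hbag₂] at lab₂
    intro x hx y hy
    constructor
    · refine hmin (D.clusterGraph cl t).reachableSetoid ?_ ?_ x hx y hy
      · intro u hu v hv h
        exact ((lab₁ u hu v hv).1 h).mono (clusterGraph_le_of_child hc₁)
      · intro u hu v hv h
        exact ((lab₂ u hu v hv).1 h).mono (clusterGraph_le_of_child hc₂)
    · intro h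
      -- Follow the connection edge by edge, with `a` the last bag vertex at which it changed sides.
      -- At a change the current vertex occurs on both sides, so it lies in the bag and becomes the
      -- new `a`.
      have key : ∃ a ∈ D.bag t, E.lab x = E.lab a ∧ ((D.clusterGraph cl s₁).Reachable a y ∨
          (D.clusterGraph cl s₂).Reachable a y) := by
        clear hy
        rw [SimpleGraph.reachable_iff_reflTransGen] at h
        induction h with
        | refl => exact ⟨x, hx, rfl, Or.inl .rfl⟩
        | tail _ h ih =>
          rename_i b c _
          obtain ⟨a, ha, hxa, hab⟩ := ih
          have ha₁ : a ∈ D.bag s₁ := hbag₁ ▸ ha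
          have ha₂ : a ∈ D.bag s₂ := hbag₂ ▸ ha
          have hbc : (D.clusterGraph cl s₁).Adj b c ∨ (D.clusterGraph cl s₂).Adj b c := by
            obtain ⟨h1, h2, h3⟩ := h
            rw [edgeBelow_iff, ht] at h3
            rcases h3 with h3 | ⟨q, hq, h3⟩
            · exact absurd h3 (by simp [NodeType.IntroducesEdge])
            · rcases (hchild q).1 hq with rfl | rfl
              · exact Or.inl ⟨h1, h2, h3⟩
              · exact Or.inr ⟨h1, h2, h3⟩
          rcases hab with hab | hab <;> rcases hbc with hbc | hbc
          · exact ⟨a, ha, hxa, Or.inl (hab.trans hbc.reachable)⟩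
          · have hbt := mem_bag_of_occurs_of_occurs hc₁ hc₂ hne
              (occurs_of_reachable hab (occurs_of_mem_bag ha₁)) hbc.2.2.occurs.1
            exact ⟨b, hbt, hxa.trans (hl₁ a ha b hbt ((lab₁ a ha b hbt).2 hab)),
              Or.inr hbc.reachable⟩
          · have hbt := mem_bag_of_occurs_of_occurs hc₁ hc₂ hne hbc.2.2.occurs.1
              (occurs_of_reachable hab (occurs_of_mem_bag ha₂))
            exact ⟨b, hbt, hxa.trans (hl₂ a ha b hbt ((lab₂ a ha b hbt).2 hab)),
              Or.inl hbc.reachable⟩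
          · exact ⟨a, ha, hxa, Or.inr (hab.trans hbc.reachable)⟩
      obtain ⟨a, ha, hxa, h1 | h1⟩ := key
      · exact hxa.trans (hl₁ a ha y hy ((lab₁ a ha y hy).2 h1))
      · exact hxa.trans (hl₂ a ha y hy ((lab₂ a ha y hy).2 h1))
  · rw [hE.1, h₁.cnt, h₂.cnt, hcard]
  · have : D.belowSet t = D.belowSet s₁ ∪ D.belowSet s₂ := by
      ext x
      simp [belowSet, hb]
    rw [this, Finset.sum_union]
    · simp only [NodeType.newCost] at hcost
      linarith [h₁.cost, h₂.cost]
    · rw [Finset.disjoint_left]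
      intro x h1 h2
      simp only [belowSet, Finset.mem_filter, Finset.mem_univ, true_and] at h1 h2
      exact hdisj x h1 h2.occurs

/-- A complete table contains a root entry at most as expensive as any given clustering. -/
theorem exists_entry_of_clustering {fc : Fin n → ℕ} {g : Fin n → ℕ → ℝ} {ent : ℕ → Entry n}
    {F L : ℕ → ℕ} (hcomp : ∀ t : Fin D.N, D.Complete k g ent F L t)
    (hcon : ∀ i, (G.induce {v | cl v = i}).Connected)
    (hfc : ∀ u v, cl u = cl v → fc u = fc v) (hfk : ∀ v, fc v < k) :
    ∃ e, F D.root ≤ e ∧ e < L D.root ∧ (ent e).cnt = k ∧ (ent e).cost ≤ ∑ v, g v (fc v) := by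
  have hsurj : Function.Surjective cl := fun i => by
    obtain ⟨⟨v, hv⟩⟩ := (hcon i).nonempty
    exact ⟨v, hv⟩
  have key : ∀ t : Fin D.N, ∃ e, F t ≤ e ∧ e < L t ∧ Describes D cl fc g t (ent e) := by
    intro t
    induction t using up_induction with
    | h t ih =>
      have hch : ∀ s, (D.node t).HasChild s → ∃ e, F s ≤ e ∧ e < L s ∧
          Describes D cl fc g s (ent e) := fun s hs => ih s ((D.child_iff t s).2 hs)
      have hct := hcomp t
      unfold Complete at hct
      rcases ht : D.node t with _ | ⟨v, s⟩ | ⟨u, v, s⟩ | ⟨v, s⟩ | ⟨s₁, s₂⟩ <;>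
        simp only [ht, NodeType.tag, NodeType.child₁, NodeType.child₂, NodeType.HasChild] at hct hch
      · obtain ⟨e, h1, h2, h3, h4⟩ := hct (0, 0) 0 0 (by simp) (by simp) trivial
        exact ⟨e, h1, h2, describes_leaf hsurj ht h3 h4⟩
      · obtain ⟨e₁, h1, h2, h3⟩ := hch s rfl
        obtain ⟨c, hf, hc⟩ := describes_introVertex ht h3 hfk
        rw [ht] at hf hc
        obtain ⟨e, h4, h5, h6, h7⟩ := hct c e₁ e₁ (fun _ => ⟨h1, h2⟩) (by simp) hf
        exact ⟨e, h4, h5, hc _ h6 h7⟩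
      · obtain ⟨e₁, h1, h2, h3⟩ := hch s rfl
        obtain ⟨c, hf, hc⟩ := describes_introEdge ht h3 hfc
        rw [ht] at hf hc
        obtain ⟨e, h4, h5, h6, h7⟩ := hct c e₁ e₁ (fun _ => ⟨h1, h2⟩) (by simp) hf
        exact ⟨e, h4, h5, hc _ h6 h7⟩
      · obtain ⟨e₁, h1, h2, h3⟩ := hch s rfl
        obtain ⟨c, hf, hc⟩ := describes_forget ht h3 hcon
        rw [ht] at hf hc
        obtain ⟨e, h4, h5, h6, h7⟩ := hct c e₁ e₁ (fun _ => ⟨h1, h2⟩) (by simp) hf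
        exact ⟨e, h4, h5, hc _ h6 h7⟩
      · obtain ⟨e₁, h1, h2, h3⟩ := hch s₁ (Or.inl rfl)
        obtain ⟨e₂, h1', h2', h3'⟩ := hch s₂ (Or.inr rfl)
        obtain ⟨c, hf, hc⟩ := describes_join ht h3 h3' hcon
        rw [ht] at hf hc
        obtain ⟨e, h4, h5, h6, h7⟩ := hct c e₁ e₂ (fun _ => ⟨h1, h2⟩) (fun _ => ⟨h1', h2'⟩) hf
        exact ⟨e, h4, h5, hc _ h6 h7⟩
  obtain ⟨e, h1, h2, h3⟩ := key D.root
  refine ⟨e, h1, h2, ?_, h3.cost.trans_eq ?_⟩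
  · rw [h3.cnt]
    -- Every vertex has been forgotten at the root, so all `k` clusters are finished there.
    have : D.finished cl D.root = Finset.univ := by
      ext i
      simp [finished, below_root]
    simp [this]
  · congr 1
    ext v
    simp [belowSet, below_root]

end completeness

end NiceTreeDecomposition

/-! ### Soundness: a consistent choice of entries yields a clustering. -/

namespace NiceTreeDecomposition

variable {n : ℕ} {G : SimpleGraph (Fin n)} {D : NiceTreeDecomposition G}

section soundness

/-- The node that forgets `v`. -/
noncomputable def forgetNode (D : NiceTreeDecomposition G) (v : Fin n) : Fin D.N :=
  (D.forget_once v).choose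

theorem forgetNode_eq {t s : Fin D.N} {v : Fin n} (h : D.node t = .forget v s) :
    D.forgetNode v = t := by
  have := (D.forget_once v).choose_spec.2 t (by simp [h, NodeType.Forgets])
  exact this.symm

theorem exists_node_forgetNode (v : Fin n) : ∃ s, D.node (D.forgetNode v) = .forget v s :=
  NodeType.forgets_iff.1 (D.forget_once v).choose_spec.1

/-- A vertex of the bag of `t` is forgotten at a proper ancestor of `t`. Passing from `v` to a
companion in the bag of its forget node therefore moves closer to the root, which makes recursion on
cluster numbers terminate. -/
theorem dist_forgetNode_lt {t : Fin D.N} {u : Fin n} (hu : u ∈ D.bag t) :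
    D.T.dist D.root (D.forgetNode u) < D.T.dist D.root t := by
  induction t using down_induction with
  | h0 => simp [D.bag_root] at hu
  | h p t h ih =>
    rcases h.mem_bag_or_forgets hu with h' | h'
    · have := ih h'
      have := h.dist
      omega
    · obtain ⟨s, hs⟩ := NodeType.forgets_iff.1 h'
      rw [forgetNode_eq hs, h.dist]
      omega

/-- A quantity that is computed from the leaves to the root is a sum over the forgotten
vertices. -/
theorem eq_sum_belowSet {M : Type*} [AddCommMonoid M] {A : Fin D.N → M} {f : Fin n → M}
    (hleaf : ∀ t, D.node t = .leaf → A t = 0)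
    (hvertex : ∀ t v s, D.node t = .introVertex v s → A t = A s)
    (hedge : ∀ t u v s, D.node t = .introEdge u v s → A t = A s)
    (hforget : ∀ t v s, D.node t = .forget v s → A t = A s + f v)
    (hjoin : ∀ t s₁ s₂, D.node t = .join s₁ s₂ → A t = A s₁ + A s₂) (t : Fin D.N) :
    A t = ∑ v ∈ D.belowSet t, f v := by
  classical
  induction t using up_induction with
  | h t ih =>
    have ih' : ∀ s, (D.node t).HasChild s → A s = ∑ v ∈ D.belowSet s, f v :=
      fun s hs => ih s ((D.child_iff t s).2 hs)
    rcases ht : D.node t with _ | ⟨v, s⟩ | ⟨u, v, s⟩ | ⟨v, s⟩ | ⟨s₁, s₂⟩ <;>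
      simp only [ht, NodeType.HasChild] at ih'
    · rw [hleaf t ht]
      have : D.belowSet t = ∅ := by
        ext v
        simp [belowSet, below_iff (t := t), D.child_iff, ht, NodeType.HasChild, NodeType.Forgets]
      simp [this]
    · rw [hvertex t v s ht, ih' s rfl]
      congr 1
      exact (belowSet_congr (below_congr (fun q => by simp [D.child_iff, ht, NodeType.HasChild])
        (by simp [ht, NodeType.Forgets]))).symm
    · rw [hedge t u v s ht, ih' s rfl]
      congr 1
      exact (belowSet_congr (below_congr (fun q => by simp [D.child_iff, ht, NodeType.HasChild])
        (by simp [ht, NodeType.Forgets]))).symm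
    · have hvs : v ∉ D.belowSet s := by
        have : ¬ D.Below s v := fun h => h.not_mem_bag (valid_of_node ht).2.1
        simpa [belowSet] using this
      have : D.belowSet t = insert v (D.belowSet s) := by
        ext x
        simp [belowSet, below_iff (t := t), D.child_iff, ht, NodeType.HasChild, NodeType.Forgets,
          eq_comm]
      rw [hforget t v s ht, ih' s rfl, this, Finset.sum_insert hvs, add_comm]
    · obtain ⟨hne, -, hbag₁, hbag₂⟩ := valid_of_node ht
      have hc₁ : D.Child t s₁ := child_of_node ht (Or.inl rfl)
      have hc₂ : D.Child t s₂ := child_of_node ht (Or.inr rfl)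
      have : D.belowSet t = D.belowSet s₁ ∪ D.belowSet s₂ := by
        ext x
        simp [belowSet, below_iff (t := t), D.child_iff, ht, NodeType.HasChild, NodeType.Forgets]
      rw [hjoin t s₁ s₂ ht, ih' s₁ (Or.inl rfl), ih' s₂ (Or.inr rfl), this, Finset.sum_union]
      rw [Finset.disjoint_left]
      intro x h1 h2
      simp only [belowSet, Finset.mem_filter, Finset.mem_univ, true_and] at h1 h2
      have := mem_bag_of_occurs_of_occurs hc₁ hc₂ hne h1.occurs h2.occurs
      rw [← hbag₁] at this
      exact h1.not_mem_bag this

/-- The entries `E t`, one for each node, fit together. -/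
def Consistent (D : NiceTreeDecomposition G) (k : ℕ) (g : Fin n → ℕ → ℝ) (E : ℕ → Entry n) : Prop :=
  ∀ t : Fin D.N, ∃ c,
    (D.node t).Feas (D.bag t) k c (E (D.node t).child₁) (E (D.node t).child₂) ∧
    (D.node t).Leads (D.bag t) c (E (D.node t).child₁) (E (D.node t).child₂) (E t) ∧
    (E t).cost = (D.node t).newCost g (E (D.node t).child₁) (E (D.node t).child₂)

/-- The entry in which `v` occurs last. -/
noncomputable def lastEntry (D : NiceTreeDecomposition G) (E : ℕ → Entry n) (v : Fin n) : Entry n :=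
  E (D.node (D.forgetNode v)).child₁

theorem lastEntry_eq {E : ℕ → Entry n} {t s : Fin D.N} {v : Fin n} (h : D.node t = .forget v s) :
    D.lastEntry E v = E s := by
  simp [lastEntry, forgetNode_eq h, h, NodeType.child₁]

/-- `v` is the last vertex of its cluster. -/
def Founder (D : NiceTreeDecomposition G) (E : ℕ → Entry n) (v : Fin n) : Prop :=
  (D.lastEntry E v).alone (D.bag (D.forgetNode v)) v = 1

theorem founder_iff {E : ℕ → Entry n} {t s : Fin D.N} {v : Fin n} (h : D.node t = .forget v s) :
    D.Founder E v ↔ ¬ ∃ u ∈ D.bag t, (E s).lab u = (E s).lab v := by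
  rw [Founder, lastEntry_eq h, forgetNode_eq h, Entry.alone]
  split_ifs with h' <;> simp [h']

/-- Vertices that are not founders belong to the cluster of a vertex with the same label. -/
def Follows (D : NiceTreeDecomposition G) (E : ℕ → Entry n) (clus : Fin n → ℕ) : Prop :=
  ∀ v, ¬ D.Founder E v → ∃ u ∈ D.bag (D.forgetNode v),
    (D.lastEntry E v).lab u = (D.lastEntry E v).lab v ∧ clus v = clus u

variable {k : ℕ} {g : Fin n → ℕ → ℝ} {E : ℕ → Entry n} {clus : Fin n → ℕ}

/-- Labels equal at a child stay equal at its parent, so the claim descends from the root. The only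
new vertex on the way down is one forgotten at `t`: if it has a companion it is not a founder, and
`Follows` gives it the number of some vertex with the same label. -/
theorem Consistent.clus_eq (hE : D.Consistent k g E) (hf : D.Follows E clus) (t : Fin D.N) :
    ∀ x ∈ D.bag t, ∀ y ∈ D.bag t, (E t).lab x = (E t).lab y → clus x = clus y := by
  induction t using down_induction with
  | h0 => simp [D.bag_root]
  | h t s hts ih =>
    obtain ⟨c, h1, h2, -⟩ := hE t
    have hc := (D.child_iff t s).1 hts
    rcases ht : D.node t with _ | ⟨v, s'⟩ | ⟨u, v, s'⟩ | ⟨v, s'⟩ | ⟨s₁, s₂⟩ <;>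
      simp only [ht, NodeType.HasChild, NodeType.child₁, NodeType.child₂] at h1 h2 hc
    · subst hc
      obtain ⟨-, hv, hbag⟩ := valid_of_node ht
      intro x hx y hy hxy
      have hx' : x ≠ v := fun h => hv (h ▸ hx)
      have hy' : y ≠ v := fun h => hv (h ▸ hy)
      have hxt : x ∈ D.bag t := by simp [hbag, hx]
      have hyt : y ∈ D.bag t := by simp [hbag, hy]
      refine ih x hxt y hyt ?_
      rw [(h2.2.2.2 x hxt hx').2, (h2.2.2.2 y hyt hy').2, hxy]
    · subst hc
      obtain ⟨-, -, hbag, -⟩ := valid_of_node ht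
      rw [← hbag]
      intro x hx y hy hxy
      refine ih x hx y hy ?_
      rw [(h2.2 x hx).2, (h2.2 y hy).2, hxy]
    · subst hc
      obtain ⟨-, hv, hbag⟩ := valid_of_node ht
      have hlab : ∀ x ∈ D.bag t, ∀ y ∈ D.bag t, (E s).lab x = (E s).lab y → clus x = clus y := by
        intro x hx y hy hxy
        refine ih x hx y hy ?_
        rw [(h2.2 x hx).2, (h2.2 y hy).2, hxy]
      have hvx : ∀ x ∈ D.bag t, (E s).lab x = (E s).lab v → clus x = clus v := by
        intro x hx hxv
        have hnf : ¬ D.Founder E v := fun h => (founder_iff ht).1 h ⟨x, hx, hxv⟩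
        obtain ⟨u, hu, hlu, hcu⟩ := hf v hnf
        rw [forgetNode_eq ht] at hu
        rw [lastEntry_eq ht] at hlu
        rw [hcu]
        exact hlab x hx u hu (hxv.trans hlu.symm)
      intro x hx y hy hxy
      have hbag' : ∀ x ∈ D.bag s, x = v ∨ x ∈ D.bag t := by
        intro x hx
        by_cases h : x = v
        · exact Or.inl h
        · right
          rw [hbag]
          exact Finset.mem_erase.2 ⟨h, hx⟩
      rcases hbag' x hx with rfl | hx' <;> rcases hbag' y hy with rfl | hy'
      · rfl
      · exact (hvx y hy' hxy.symm).symm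
      · exact hvx x hx' hxy
      · exact hlab x hx' y hy' hxy
    · obtain ⟨-, -, hbag₁, hbag₂⟩ := valid_of_node ht
      obtain ⟨-, -, hl₁, hl₂, -⟩ := h2
      rcases hc with rfl | rfl
      · rw [hbag₁]
        intro x hx y hy hxy
        exact ih x hx y hy (hl₁ x hx y hy hxy)
      · rw [hbag₂]
        intro x hx y hy hxy
        exact ih x hx y hy (hl₂ x hx y hy hxy)

/-- The edges of `G` inside of the clusters. -/
def insideGraph (G : SimpleGraph (Fin n)) (clus : Fin n → ℕ) : SimpleGraph (Fin n) where
  Adj u v := clus u = clus v ∧ G.Adj u v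
  symm := ⟨fun _ _ h => ⟨h.1.symm, h.2.symm⟩⟩
  loopless := ⟨fun _ h => h.2.ne rfl⟩

/-- Vertices of a bag with equal labels have the same facility and are connected inside of
their cluster. -/
theorem Consistent.rel_of_lab_eq (hE : D.Consistent k g E) (hf : D.Follows E clus)
    (t : Fin D.N) : ∀ x ∈ D.bag t, ∀ y ∈ D.bag t, (E t).lab x = (E t).lab y →
      (E t).fac x = (E t).fac y ∧ (insideGraph G clus).Reachable x y := by
  induction t using up_induction with
  | h t ih =>
    have hclus := hE.clus_eq hf t
    obtain ⟨c, h1, h2, -⟩ := hE t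
    have hch : ∀ s, (D.node t).HasChild s → ∀ x ∈ D.bag s, ∀ y ∈ D.bag s,
        (E s).lab x = (E s).lab y →
          (E s).fac x = (E s).fac y ∧ (insideGraph G clus).Reachable x y :=
      fun s hs => ih s ((D.child_iff t s).2 hs)
    rcases ht : D.node t with _ | ⟨v, s⟩ | ⟨u, v, s⟩ | ⟨v, s⟩ | ⟨s₁, s₂⟩ <;>
      simp only [ht, NodeType.HasChild, NodeType.child₁, NodeType.child₂] at h1 h2 hch
    · have : D.bag t = ∅ := (valid_of_node ht).2
      simp [this]
    · obtain ⟨-, hv, hbag⟩ := valid_of_node ht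
      have hmem : ∀ u ∈ D.bag t, u ≠ v → u ∈ D.bag s := by
        intro u hu huv
        simpa [hbag, huv] using hu
      intro x hx y hy hxy
      obtain ⟨-, hfv, hlv, h2⟩ := h2
      by_cases hxv : x = v <;> by_cases hyv : y = v
      · rw [hxv, hyv]
        exact ⟨rfl, .rfl⟩
      · rw [hxv, hlv, (h2 y hy hyv).2] at hxy
        exact absurd hxy.symm (h1.2.2 y hy hyv)
      · rw [hyv, hlv, (h2 x hx hxv).2] at hxy
        exact absurd hxy (h1.2.2 x hx hxv)
      · rw [(h2 x hx hxv).2, (h2 y hy hyv).2] at hxy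
        rw [(h2 x hx hxv).1, (h2 y hy hyv).1]
        exact hch s rfl x (hmem x hx hxv) y (hmem y hy hyv) hxy
    · obtain ⟨-, huv, hbag, hu, hv⟩ := valid_of_node ht
      have hch := hch s rfl
      rw [← hbag] at hch
      intro x hx y hy hxy
      rw [(h2.2 x hx).1, (h2.2 y hy).1]
      rw [(h2.2 x hx).2, (h2.2 y hy).2] at hxy
      rcases h1 with h1 | ⟨h1, hfac⟩
      · simp only [h1, zero_ne_one, false_and, if_false] at hxy
        exact hch x hx y hy hxy
      · have hru : (insideGraph G clus).Reachable u v := by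
          refine SimpleGraph.Adj.reachable ⟨hclus u hu v hv ?_, huv⟩
          rw [(h2.2 u hu).2, (h2.2 v hv).2]
          simp [h1]
        simp only [h1, true_and] at hxy
        split_ifs at hxy with h3 h4 h4
        · obtain ⟨a1, a2⟩ := hch x hx u hu h3
          obtain ⟨b1, b2⟩ := hch u hu y hy h4.symm
          exact ⟨a1.trans b1, a2.trans b2⟩
        · obtain ⟨a1, a2⟩ := hch x hx u hu h3
          obtain ⟨b1, b2⟩ := hch v hv y hy hxy
          exact ⟨a1.trans (hfac.trans b1), a2.trans (hru.trans b2)⟩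
        · obtain ⟨a1, a2⟩ := hch x hx v hv hxy
          obtain ⟨b1, b2⟩ := hch u hu y hy h4.symm
          exact ⟨a1.trans (hfac.symm.trans b1), a2.trans (hru.symm.trans b2)⟩
        · exact hch x hx y hy hxy
    · obtain ⟨-, hv, hbag⟩ := valid_of_node ht
      have hsub : ∀ u ∈ D.bag t, u ∈ D.bag s := fun u hu => by
        rw [hbag] at hu
        exact Finset.mem_of_mem_erase hu
      intro x hx y hy hxy
      rw [(h2.2 x hx).2, (h2.2 y hy).2] at hxy
      rw [(h2.2 x hx).1, (h2.2 y hy).1]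
      exact hch s rfl x (hsub x hx) y (hsub y hy) hxy
    · obtain ⟨-, -, hbag₁, hbag₂⟩ := valid_of_node ht
      have hch₁ := hch s₁ (Or.inl rfl)
      have hch₂ := hch s₂ (Or.inr rfl)
      rw [hbag₁] at hch₁
      rw [hbag₂] at hch₂
      obtain ⟨-, hfac, -, -, hmin⟩ := h2
      intro x hx y hy hxy
      -- Minimality of the joined labels, applied to the relation of having the same facility and
      -- being connected inside the cluster.
      have := hmin (Setoid.ker (E t).fac ⊓ (insideGraph G clus).reachableSetoid) ?_ ?_ x hx y hy hxy
      · exact this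
      · intro u hu v hv huv
        refine ⟨?_, (hch₁ u hu v hv huv).2⟩
        change (E t).fac u = (E t).fac v
        rw [hfac u hu, hfac v hv]
        exact (hch₁ u hu v hv huv).1
      · intro u hu v hv huv
        refine ⟨?_, (hch₂ u hu v hv huv).2⟩
        change (E t).fac u = (E t).fac v
        rw [hfac u hu, hfac v hv, h1.1 u hu, h1.1 v hv]
        exact (hch₂ u hu v hv huv).1

/-- A facility is fixed when the vertex is introduced and then copied upwards; at a join,
feasibility forces both sides to agree. Hence it can be read off from the last entry containing the
vertex. -/
theorem Consistent.fac_eq (hE : D.Consistent k g E) (t : Fin D.N) :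
    ∀ u ∈ D.bag t, (E t).fac u = (D.lastEntry E u).fac u := by
  induction t using down_induction with
  | h0 => simp [D.bag_root]
  | h t s hts ih =>
    obtain ⟨c, h1, h2, -⟩ := hE t
    have hc := (D.child_iff t s).1 hts
    rcases ht : D.node t with _ | ⟨v, s'⟩ | ⟨u, v, s'⟩ | ⟨v, s'⟩ | ⟨s₁, s₂⟩ <;>
      simp only [ht, NodeType.HasChild, NodeType.child₁, NodeType.child₂] at h1 h2 hc
    · subst hc
      obtain ⟨-, hv, hbag⟩ := valid_of_node ht
      intro x hx
      have hx' : x ≠ v := fun h => hv (h ▸ hx)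
      have hxt : x ∈ D.bag t := by simp [hbag, hx]
      rw [← (h2.2.2.2 x hxt hx').1, ih x hxt]
    · subst hc
      obtain ⟨-, -, hbag, -⟩ := valid_of_node ht
      rw [← hbag]
      intro x hx
      rw [← (h2.2 x hx).1, ih x hx]
    · subst hc
      obtain ⟨-, hv, hbag⟩ := valid_of_node ht
      intro x hx
      by_cases hxv : x = v
      · rw [hxv, lastEntry_eq ht]
      · have hxt : x ∈ D.bag t := by
          rw [hbag]
          exact Finset.mem_erase.2 ⟨hxv, hx⟩
        rw [← (h2.2 x hxt).1, ih x hxt]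
    · obtain ⟨-, -, hbag₁, hbag₂⟩ := valid_of_node ht
      rcases hc with rfl | rfl
      · rw [hbag₁]
        intro x hx
        rw [← h2.2.1 x hx, ih x hx]
      · rw [hbag₂]
        intro x hx
        rw [← h1.1 x hx, ← h2.2.1 x hx, ih x hx]

/-- Pass repeatedly to a companion of the same label. Each step keeps cluster number, facility and
component, and the forget node comes closer to the root, so a founder is reached. -/
theorem Consistent.exists_founder (hE : D.Consistent k g E) (hf : D.Follows E clus) (v : Fin n) :
    ∃ f, D.Founder E f ∧ clus v = clus f ∧ (insideGraph G clus).Reachable v f ∧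
      (D.lastEntry E v).fac v = (D.lastEntry E f).fac f := by
  induction hm : D.T.dist D.root (D.forgetNode v) using Nat.strong_induction_on generalizing v with
  | _ m ih =>
    by_cases hv : D.Founder E v
    · exact ⟨v, hv, rfl, .rfl, rfl⟩
    · obtain ⟨u, hu, hlu, hcu⟩ := hf v hv
      obtain ⟨f, h1, h2, h3, h4⟩ := ih _ (hm ▸ dist_forgetNode_lt hu) u rfl
      obtain ⟨s, hs⟩ := exists_node_forgetNode (D := D) v
      obtain ⟨-, hvs, hbag⟩ := valid_of_node hs
      have hus : u ∈ D.bag s := by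
        rw [hbag] at hu
        exact Finset.mem_of_mem_erase hu
      rw [lastEntry_eq hs] at hlu ⊢
      obtain ⟨h5, h6⟩ := hE.rel_of_lab_eq hf s v hvs u hus hlu.symm
      refine ⟨f, h1, hcu.trans h2, h6.trans h3, ?_⟩
      rw [h5, hE.fac_eq s u hus, h4]

theorem Consistent.cost_root (hE : D.Consistent k g E) :
    (E D.root).cost = ∑ v, g v ((D.lastEntry E v).fac v) := by
  have := eq_sum_belowSet (D := D) (A := fun t => (E t).cost)
    (f := fun v => g v ((D.lastEntry E v).fac v)) ?_ ?_ ?_ ?_ ?_ D.root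
  · rw [this]
    congr 1
    ext v
    simp [belowSet, below_root]
  · intro t ht
    obtain ⟨c, -, -, h⟩ := hE t
    rw [h, ht]
    rfl
  · intro t v s ht
    obtain ⟨c, -, -, h⟩ := hE t
    rw [h, ht]
    rfl
  · intro t u v s ht
    obtain ⟨c, -, -, h⟩ := hE t
    rw [h, ht]
    rfl
  · intro t v s ht
    obtain ⟨c, -, -, h⟩ := hE t
    rw [h, ht, lastEntry_eq ht]
    rfl
  · intro t s₁ s₂ ht
    obtain ⟨c, -, -, h⟩ := hE t
    rw [h, ht]
    rfl

-- The count increases by one precisely at the nodes that forget a founder.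
open Classical in
theorem Consistent.cnt_root (hE : D.Consistent k g E) :
    (E D.root).cnt = (Finset.univ.filter (D.Founder E)).card := by
  rw [Finset.card_filter]
  have := eq_sum_belowSet (D := D) (A := fun t => (E t).cnt)
    (f := fun v => if D.Founder E v then 1 else 0) ?_ ?_ ?_ ?_ ?_ D.root
  · rw [this]
    congr 1
    ext v
    simp [belowSet, below_root]
  · intro t ht
    obtain ⟨c, h1, h2, h3⟩ := hE t
    rw [ht] at h2
    exact h2
  · intro t v s ht
    obtain ⟨c, h1, h2, h3⟩ := hE t
    rw [ht] at h2
    exact h2.1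
  · intro t u v s ht
    obtain ⟨c, h1, h2, h3⟩ := hE t
    rw [ht] at h2
    exact h2.1
  · intro t v s ht
    obtain ⟨c, h1, h2, h3⟩ := hE t
    rw [ht] at h2
    refine h2.1.trans ?_
    rw [NodeType.child₁, Entry.alone]
    congr 1
    by_cases h : ∃ u ∈ D.bag t, (E s).lab u = (E s).lab v
    · rw [if_pos h, if_neg (fun hv => (founder_iff ht).1 hv h)]
    · rw [if_neg h, if_pos ((founder_iff ht).2 h)]
  · intro t s₁ s₂ ht
    obtain ⟨c, h1, h2, h3⟩ := hE t
    rw [ht] at h2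
    exact h2.1

theorem reachable_insideGraph {u v : Fin n} (h : (insideGraph G clus).Reachable u v) {i : ℕ}
    (hu : clus u = i) :
    ∃ hv : clus v = i, (G.induce {v | clus v = i}).Reachable ⟨u, hu⟩ ⟨v, hv⟩ := by
  obtain ⟨p⟩ := h
  induction p with
  | nil => exact ⟨hu, .rfl⟩
  | cons h _ ih =>
    obtain ⟨hv, h'⟩ := ih (h.1 ▸ hu)
    refine ⟨hv, SimpleGraph.Reachable.trans (SimpleGraph.Adj.reachable ?_) h'⟩
    simpa using h.2

/-- Consistent entries describe a feasible clustering. -/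
theorem Consistent.clustering (hE : D.Consistent k g E) (hf : D.Follows E clus)
    (hroot : (E D.root).cnt = k) {m : ℕ} (hlt : ∀ v, D.Founder E v → clus v < m)
    (hinj : ∀ u v, D.Founder E u → D.Founder E v → clus u = clus v → u = v)
    (hsurj : ∀ i < m, ∃ v, D.Founder E v ∧ clus v = i) :
    m = k ∧ (∀ v, clus v < k) ∧ (∀ i < k, (G.induce {v | clus v = i}).Connected) ∧
      ∀ u v, clus u = clus v → (D.lastEntry E u).fac u = (D.lastEntry E v).fac v := by
  classical
  have hm : m = k := by
    -- Founders correspond bijectively to the numbers below `m`, and the count at the root is the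
    -- number of founders.
    rw [← hroot, hE.cnt_root]
    have : (Finset.univ.filter (D.Founder E)).image clus = Finset.range m := by
      ext i
      simp only [Finset.mem_image, Finset.mem_filter, Finset.mem_univ, true_and, Finset.mem_range]
      constructor
      · rintro ⟨v, hv, rfl⟩
        exact hlt v hv
      · exact hsurj i
    rw [← Finset.card_range m, ← this, Finset.card_image_of_injOn]
    intro u hu v hv huv
    simp only [Finset.coe_filter, Finset.mem_univ, true_and, Set.mem_ofPred_eq] at hu hv
    exact hinj u v hu hv huv
  -- Two vertices with the same number lead to founders with the same number, that is, to one common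
  -- founder.
  have hpair : ∀ u v, clus u = clus v → (insideGraph G clus).Reachable u v ∧
      (D.lastEntry E u).fac u = (D.lastEntry E v).fac v := by
    intro u v huv
    obtain ⟨f, h1, h2, h3, h4⟩ := hE.exists_founder hf u
    obtain ⟨f', h1', h2', h3', h4'⟩ := hE.exists_founder hf v
    obtain rfl := hinj f f' h1 h1' (by rw [← h2, ← h2', huv])
    exact ⟨h3.trans h3'.symm, h4.trans h4'.symm⟩
  refine ⟨hm, fun v => ?_, fun i hi => ?_, fun u v huv => (hpair u v huv).2⟩
  · obtain ⟨f, h1, h2, -⟩ := hE.exists_founder hf v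
    rw [h2, ← hm]
    exact hlt f h1
  · obtain ⟨v, -, hv⟩ := hsurj i (hm ▸ hi)
    have : Nonempty ↑{v | clus v = i} := ⟨⟨v, hv⟩⟩
    refine ⟨?_⟩
    rintro ⟨a, ha⟩ ⟨b, hb⟩
    have hab : clus a = clus b := by
      simp only [Set.mem_ofPred_eq] at ha hb
      rw [ha, hb]
    exact (reachable_insideGraph (hpair a b hab).1 ha).2

end soundness

end NiceTreeDecomposition

/-! ### The programs of the dynamic program -/

namespace RealRAM

infixr:60 " ;; " => Prog.seq

-- Names of arrays. `0` and `1` hold the output, `2` to `12` are tables, and the names `20` to `45`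
-- are scalar variables stored in cell `0`. All of them are below `50`, because the renamed
-- algorithm for unconnected `k`-median uses the arrays from `50` on; `aMed` is its output array.
-- The real array `0` holds the costs of the entries.
notation "oClus" => (0 : ℕ)
notation "oCen" => (1 : ℕ)
notation "aOrd" => (2 : ℕ)
notation "aFst" => (3 : ℕ)
notation "aLst" => (4 : ℕ)
notation "aBase" => (5 : ℕ)
notation "aFac" => (6 : ℕ)
notation "aLab" => (7 : ℕ)
notation "aCnt" => (8 : ℕ)
notation "aPtr₁" => (9 : ℕ)
notation "aPtr₂" => (10 : ℕ)
notation "aSel" => (11 : ℕ)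
notation "aCF" => (12 : ℕ)
notation "vI" => (20 : ℕ)
notation "vT" => (21 : ℕ)
notation "vTail" => (22 : ℕ)
notation "vTop" => (23 : ℕ)
notation "vE₁" => (24 : ℕ)
notation "vE₂" => (25 : ℕ)
notation "vJ" => (26 : ℕ)
notation "vL" => (27 : ℕ)
notation "vQ" => (28 : ℕ)
notation "vMis" => (29 : ℕ)
notation "vDup" => (30 : ℕ)
notation "vOld" => (31 : ℕ)
notation "vC" => (32 : ℕ)
notation "vU" => (33 : ℕ)
notation "vC₂" => (34 : ℕ)
notation "vU₂" => (35 : ℕ)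
notation "vA" => (36 : ℕ)
notation "vB" => (37 : ℕ)
notation "vX" => (38 : ℕ)
notation "vC₃" => (39 : ℕ)
notation "vFnd" => (40 : ℕ)
notation "vCtr" => (41 : ℕ)
notation "vS" => (42 : ℕ)
notation "vS₂" => (43 : ℕ)
notation "vV" => (44 : ℕ)
notation "vV₂" => (45 : ℕ)
notation "aMed" => (50 : ℕ)

abbrev CProg := Prog ConnectedQuery

abbrev CExp := NExp ConnectedQuery

/-- The number of points. -/
abbrev numExp : CExp := .input .numPoints (.const 0) (.const 0)

/-- The facility of the vertex `u` in the entry `e`. -/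
abbrev facExp (e u : CExp) : CExp := .read aFac (.plus (.read aBase e) u)

/-- The label of the vertex `u` in the entry `e`. -/
abbrev labExp (e u : CExp) : CExp := .read aLab (.plus (.read aBase e) u)

abbrev setFac (e u v : CExp) : CProg := .setNat aFac (.plus (.read aBase e) u) v

abbrev setLab (e u v : CExp) : CProg := .setNat aLab (.plus (.read aBase e) u) v

/-- The distance of two numbers. -/
abbrev diffExp (a b : CExp) : CExp := .plus (.minus a b) (.minus b a)

/-- A loop over the bag of the node `a`. -/
def forBag (c u a : ℕ) (P : CProg) : CProg :=
  Prog.for c (.const 0) (.input .bagSize (.var a) (.const 0))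
    (.assign u (.input .bagMember (.var a) (.var c)) ;; P)

/-- Copy the entry `vE₁`, restricted to the bag of the node `a`, to the entry `vTop`. -/
def copyProg (a : ℕ) : CProg :=
  forBag vC vU a
    (setFac (.var vTop) (.var vU) (facExp (.var vE₁) (.var vU)) ;;
      setLab (.var vTop) (.var vU) (labExp (.var vE₁) (.var vU))) ;;
  .setNat aCnt (.var vTop) (.read aCnt (.var vE₁)) ;;
  .setReal 0 (.var vTop) (.read 0 (.var vE₁)) ;;
  .setNat aPtr₁ (.var vTop) (.var vE₁)

/-- Replace the label `vA` by `vB` in the entry `vTop`. -/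
def mergeProg : CProg :=
  forBag vC₃ vX vT (.cond (.eq (labExp (.var vTop) (.var vX)) (.var vA))
    (setLab (.var vTop) (.var vX) (.var vB)) .skip)

/-- Merge the labels of the entry `vTop` that are equal in the entry `vE₂`. -/
def joinLabProg : CProg :=
  forBag vC vU vT (forBag vC₂ vU₂ vT
    (.cond (.eq (labExp (.var vE₂) (.var vU)) (labExp (.var vE₂) (.var vU₂)))
      (.assign vA (labExp (.var vTop) (.var vU)) ;;
        .assign vB (labExp (.var vTop) (.var vU₂)) ;; mergeProg)
      .skip))

/-- Compare the entries `vQ` and `vTop`. -/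
def compareProg : CProg :=
  .assign vMis (diffExp (.read aCnt (.var vQ)) (.read aCnt (.var vTop))) ;;
  forBag vC vU vT (.assign vMis (.plus (.var vMis) (.plus
    (diffExp (facExp (.var vQ) (.var vU)) (facExp (.var vTop) (.var vU)))
    (diffExp (labExp (.var vQ) (.var vU)) (labExp (.var vTop) (.var vU))))))

/-- Add the entry `vTop` to the entries of the node `vT`. -/
def insertProg : CProg :=
  .assign vDup (.const 0) ;;
  Prog.for vQ (.read aFst (.var vT)) (.var vTop)
    (compareProg ;;
      .cond (.natLe (.var vMis) (.const 0))
        (.assign vDup (.const 1) ;; .assign vOld (.var vQ)) .skip) ;;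
  .cond (.natLe (.const 1) (.var vDup))
    (.cond (.realLe (.read 0 (.var vTop)) (.read 0 (.var vOld)))
      (.setReal 0 (.var vOld) (.read 0 (.var vTop)) ;;
        .setNat aPtr₁ (.var vOld) (.read aPtr₁ (.var vTop)) ;;
        .setNat aPtr₂ (.var vOld) (.read aPtr₂ (.var vTop)))
      .skip)
    -- Integers cannot be multiplied on this machine, so the offset `e * n` of each entry is
    -- tabulated by adding `n` whenever an entry is appended.
    (.setNat aBase (.plus (.var vTop) (.const 1)) (.plus (.read aBase (.var vTop)) numExp) ;;
      .assign vTop (.plus (.var vTop) (.const 1)))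

/-- The entries of a leaf. -/
def leafProg : CProg :=
  .setNat aCnt (.var vTop) (.const 0) ;; .setReal 0 (.var vTop) (.ofNat (.const 0)) ;; insertProg

/-- The entries of a node that introduces the vertex `vV`. -/
def introVertexProg : CProg :=
  Prog.for vE₁ (.read aFst (.var vS)) (.read aLst (.var vS))
    (Prog.for vJ (.const 0) (.input .numClusters (.const 0) (.const 0))
      (Prog.for vL (.const 0) (.input .bagSize (.var vT) (.const 0))
        (.assign vFnd (.const 0) ;;
        forBag vC vU vS (.cond (.eq (labExp (.var vE₁) (.var vU)) (.var vL))
          (.assign vFnd (.const 1)) .skip) ;;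
        .cond (.natLe (.var vFnd) (.const 0))
          (copyProg vS ;;
            setFac (.var vTop) (.var vV) (.var vJ) ;;
            setLab (.var vTop) (.var vV) (.var vL) ;;
            insertProg)
          .skip)))

/-- The entries of a node that introduces the edge between `vV` and `vV₂`. -/
def introEdgeProg : CProg :=
  Prog.for vE₁ (.read aFst (.var vS)) (.read aLst (.var vS))
    (copyProg vT ;; insertProg ;;
      .cond (.eq (facExp (.var vE₁) (.var vV)) (facExp (.var vE₁) (.var vV₂)))
        (copyProg vT ;;
          .assign vA (labExp (.var vE₁) (.var vV)) ;;
          .assign vB (labExp (.var vE₁) (.var vV₂)) ;;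
          mergeProg ;; insertProg)
        .skip)

/-- The entries of a node that forgets the vertex `vV`. -/
def forgetProg : CProg :=
  Prog.for vE₁ (.read aFst (.var vS)) (.read aLst (.var vS))
    -- The variable starts at `1` and is reset when a companion is found, so it ends up as the
    -- increment `Entry.alone` of the count.
    (.assign vFnd (.const 1) ;;
      forBag vC vU vT (.cond (.eq (labExp (.var vE₁) (.var vU)) (labExp (.var vE₁) (.var vV)))
        (.assign vFnd (.const 0)) .skip) ;;
      .cond (.natLe (.plus (.read aCnt (.var vE₁)) (.var vFnd))
          (.input .numClusters (.const 0) (.const 0)))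
        (copyProg vT ;;
          .setNat aCnt (.var vTop) (.plus (.read aCnt (.var vE₁)) (.var vFnd)) ;;
          .setReal 0 (.var vTop) (.plus (.read 0 (.var vE₁))
            (.input (.var vV) (.read aMed (facExp (.var vE₁) (.var vV))))) ;;
          insertProg)
        .skip)

/-- The entries of a join node. -/
def joinProg : CProg :=
  Prog.for vE₁ (.read aFst (.var vS)) (.read aLst (.var vS))
    (Prog.for vE₂ (.read aFst (.var vS₂)) (.read aLst (.var vS₂))
      (.assign vMis (.const 0) ;;
        forBag vC vU vT (.assign vMis (.plus (.var vMis)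
          (diffExp (facExp (.var vE₁) (.var vU)) (facExp (.var vE₂) (.var vU))))) ;;
        .cond (.natLe (.var vMis) (.const 0))
          (.cond (.natLe (.plus (.read aCnt (.var vE₁)) (.read aCnt (.var vE₂)))
              (.input .numClusters (.const 0) (.const 0)))
            (copyProg vT ;; joinLabProg ;;
              .setNat aCnt (.var vTop) (.plus (.read aCnt (.var vE₁)) (.read aCnt (.var vE₂))) ;;
              .setReal 0 (.var vTop) (.plus (.read 0 (.var vE₁)) (.read 0 (.var vE₂))) ;;
              .setNat aPtr₂ (.var vTop) (.var vE₂) ;;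
              insertProg)
            .skip)
          .skip))

/-- The tag of the node `vT`. -/
abbrev tagExp : CExp := .input .nodeTag (.var vT) (.const 0)

/-- Read the data of the node `vT`. -/
def readNodeProg : CProg :=
  .assign vS (.input .child₁ (.var vT) (.const 0)) ;;
  .assign vS₂ (.input .child₂ (.var vT) (.const 0)) ;;
  .assign vV (.input .vertex₁ (.var vT) (.const 0)) ;;
  .assign vV₂ (.input .vertex₂ (.var vT) (.const 0))

/-- The entries of the node `vT`. -/
def nodeProg : CProg :=
  readNodeProg ;;
  .setNat aFst (.var vT) (.var vTop) ;;
  .cond (.eq tagExp (.const 0)) leafProg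
    (.cond (.eq tagExp (.const 1)) introVertexProg
      (.cond (.eq tagExp (.const 2)) introEdgeProg
        (.cond (.eq tagExp (.const 3)) forgetProg joinProg))) ;;
  .setNat aLst (.var vT) (.var vTop)

/-- Append the children of the node `vI` of the queue to the queue. -/
def orderBody : CProg :=
  .assign vT (.read aOrd (.var vI)) ;;
  .cond (.natLe (.const 1) tagExp)
    (.setNat aOrd (.var vTail) (.input .child₁ (.var vT) (.const 0)) ;;
      .assign vTail (.plus (.var vTail) (.const 1)) ;;
      .cond (.natLe (.const 4) tagExp)
        (.setNat aOrd (.var vTail) (.input .child₂ (.var vT) (.const 0)) ;;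
          .assign vTail (.plus (.var vTail) (.const 1)))
        .skip)
    .skip

/-- Sort the nodes such that parents precede their children. -/
def orderProg : CProg :=
  .setNat aOrd (.const 0) (.input .root (.const 0) (.const 0)) ;;
  .assign vTail (.const 1) ;;
  Prog.for vI (.const 0) (.input .numNodes (.const 0) (.const 0)) orderBody

/-- The entries of the node with the number `vI` from the end of the order. -/
def tableBody : CProg :=
  .assign vT (.read aOrd (.minus (.input .numNodes (.const 0) (.const 0))
    (.plus (.var vI) (.const 1)))) ;; nodeProg

/-- The entries of all nodes, from the leaves to the root. -/
def tableProg : CProg :=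
  Prog.for vI (.const 0) (.input .numNodes (.const 0) (.const 0)) tableBody

/-- Select an entry of the root with the desired number of clusters. -/
def selectProg : CProg :=
  .assign vFnd (.const 0) ;;
  .assign vT (.input .root (.const 0) (.const 0)) ;;
  Prog.for vE₁ (.read aFst (.var vT)) (.read aLst (.var vT))
    (.cond (.eq (.read aCnt (.var vE₁)) (.input .numClusters (.const 0) (.const 0)))
      (.assign vFnd (.const 1) ;; .setNat aSel (.var vT) (.var vE₁)) .skip)

/-- Determine the cluster of the vertex `vV` that is forgotten at `vT`. -/
def clusterProg : CProg :=
  .assign vFnd (.const 0) ;;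
  forBag vC vU vT (.cond (.eq (labExp (.var vE₂) (.var vU)) (labExp (.var vE₂) (.var vV)))
    (.assign vFnd (.const 1) ;; .setNat oClus (.var vV) (.read oClus (.var vU))) .skip) ;;
  .cond (.natLe (.var vFnd) (.const 0))
    (.setNat oClus (.var vV) (.var vCtr) ;;
      .setNat oCen (.var vCtr) (.var vV) ;;
      .setNat aCF (.var vCtr) (facExp (.var vE₂) (.var vV)) ;;
      .assign vCtr (.plus (.var vCtr) (.const 1)))
    .skip

/-- Determine the selected entries of the children of `vT`. -/
def descendNodeProg : CProg :=
  readNodeProg ;;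
  .assign vE₁ (.read aSel (.var vT)) ;;
  .assign vE₂ (.read aPtr₁ (.var vE₁)) ;;
  .cond (.natLe (.const 1) tagExp)
    (.setNat aSel (.var vS) (.var vE₂) ;;
      .cond (.natLe (.const 4) tagExp)
        (.setNat aSel (.var vS₂) (.read aPtr₂ (.var vE₁))) .skip ;;
      .cond (.eq tagExp (.const 3)) clusterProg .skip)
    .skip

/-- Treat the node with the number `vI` in the order. -/
def descendBody : CProg := .assign vT (.read aOrd (.var vI)) ;; descendNodeProg

/-- Determine the clusters, from the root to the leaves. -/
def descendProg : CProg :=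
  .assign vCtr (.const 0) ;;
  Prog.for vI (.const 0) (.input .numNodes (.const 0) (.const 0)) descendBody

/-- The distance of the vertex `u` to the facility of the cluster `i`. -/
abbrev medDist (u i : CExp) : RExp ConnectedQuery := .input u (.read aMed (.read aCF i))

/-- Move the center of the cluster of `vV` to `vV` if this is nearer to the facility. -/
def centerBody : CProg :=
  .assign vU (.read oClus (.var vV)) ;;
  .cond (.realLe (medDist (.var vV) (.var vU)) (medDist (.read oCen (.var vU)) (.var vU)))
    (.setNat oCen (.var vU) (.var vV)) .skip

/-- Move the centers to vertices nearest to the facilities. -/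
def centerProg : CProg := Prog.for vV (.const 0) numExp centerBody

/-- The algorithm, given the facilities. -/
def mainProg : CProg :=
  orderProg ;; tableProg ;; selectProg ;;
  .cond (.natLe (.const 1) (.var vFnd)) (descendProg ;; centerProg) .skip

end RealRAM

/-! ### Entries in the memory and the effect of single writes on them. -/

namespace RealRAM

/-- The entry `e` stored in the memory. -/
def State.entry (n : ℕ) (s : State) (e : ℕ) : Entry n where
  fac u := s.nat aFac (e * n + u)
  lab u := s.nat aLab (e * n + u)
  cnt := s.nat aCnt e
  cost := s.real 0 e
  p₁ := s.nat aPtr₁ e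
  p₂ := s.nat aPtr₂ e

/-- Since `u < n`, the entry is recovered from the address by division by `n`. Distinct pairs
therefore never share a cell. -/
theorem address_eq_iff {n e e' : ℕ} {u u' : Fin n} :
    e * n + u = e' * n + u' ↔ e = e' ∧ u = u' := by
  constructor
  · intro h
    have hn : 0 < n := u.pos
    have h1 : ∀ (e : ℕ) (u : Fin n), (e * n + u) / n = e := fun e u => by
      rw [mul_comm, Nat.mul_add_div hn, Nat.div_eq_of_lt u.2, add_zero]
    have : e = e' := by rw [← h1 e u, ← h1 e' u', h]
    subst this
    exact ⟨rfl, Fin.ext (by omega)⟩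
  · rintro ⟨rfl, rfl⟩
    rfl

theorem State.setNat_nat (s : State) (a i v b j : ℕ) :
    (s.setNat a i v).nat b j = if b = a ∧ j = i then v else s.nat b j := rfl

theorem State.setNat_nat_of_ne {s : State} {a i v b : ℕ} (h : b ≠ a) :
    (s.setNat a i v).nat b = s.nat b := by
  funext j
  simp [State.setNat, h]

theorem State.setNat_nat_self {s : State} {a i v : ℕ} : (s.setNat a i v).nat a i = v := by
  simp [State.setNat]

theorem State.setReal_nat (s : State) (a i : ℕ) (v : ℝ) : (s.setReal a i v).nat = s.nat := rfl

theorem State.setNat_real (s : State) (a i v : ℕ) : (s.setNat a i v).real = s.real := rfl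

theorem State.setReal_real (s : State) (a i : ℕ) (v : ℝ) (b j : ℕ) :
    (s.setReal a i v).real b j = if b = a ∧ j = i then v else s.real b j := rfl

section entry

variable {n : ℕ} {s s' : State} {e e' i v : ℕ} {u : Fin n}

theorem entry_congr (h : ∀ b, 6 ≤ b → b ≤ 10 → s'.nat b = s.nat b) (hr : s'.real 0 = s.real 0) :
    s'.entry n = s.entry n := by
  funext e
  simp only [State.entry, h 6 (by omega) (by omega), h 7 (by omega) (by omega),
    h 8 (by omega) (by omega), h 9 (by omega) (by omega), h 10 (by omega) (by omega), hr]

theorem entry_setNat_of_lt {a : ℕ} (h : 10 < a) : (s.setNat a i v).entry n = s.entry n :=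
  entry_congr (fun b _ _ => State.setNat_nat_of_ne (by omega)) rfl

theorem entry_setNat_of_gt {a : ℕ} (h : a < 6) : (s.setNat a i v).entry n = s.entry n :=
  entry_congr (fun b _ _ => State.setNat_nat_of_ne (by omega)) rfl

theorem entry_setFac : (s.setNat aFac (e * n + u) v).entry n = Function.update (s.entry n) e
    { s.entry n e with fac := Function.update (s.entry n e).fac u v } := by
  funext e'
  by_cases h : e' = e
  · subst h
    simp only [Function.update_self, State.entry, State.setNat_nat, address_eq_iff]
    simp only [State.setNat_real, true_and]
    simp [funext_iff, Function.update_apply]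
  · simp only [Function.update_of_ne h, State.entry, State.setNat_nat, address_eq_iff]
    simp [h, State.setNat_real]

theorem entry_setLab : (s.setNat aLab (e * n + u) v).entry n = Function.update (s.entry n) e
    { s.entry n e with lab := Function.update (s.entry n e).lab u v } := by
  funext e'
  by_cases h : e' = e
  · subst h
    simp only [Function.update_self, State.entry, State.setNat_nat, address_eq_iff]
    simp only [State.setNat_real, true_and]
    simp [funext_iff, Function.update_apply]
  · simp only [Function.update_of_ne h, State.entry, State.setNat_nat, address_eq_iff]
    simp [h, State.setNat_real]

theorem entry_setCnt : (s.setNat aCnt e v).entry n = Function.update (s.entry n) e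
    { s.entry n e with cnt := v } := by
  funext e'
  by_cases h : e' = e
  · subst h
    simp [State.entry, State.setNat_nat, State.setNat_real]
  · simp [h, State.entry, State.setNat_nat, State.setNat_real]

theorem entry_setPtr₁ : (s.setNat aPtr₁ e v).entry n = Function.update (s.entry n) e
    { s.entry n e with p₁ := v } := by
  funext e'
  by_cases h : e' = e
  · subst h
    simp [State.entry, State.setNat_nat, State.setNat_real]
  · simp [h, State.entry, State.setNat_nat, State.setNat_real]

theorem entry_setPtr₂ : (s.setNat aPtr₂ e v).entry n = Function.update (s.entry n) e
    { s.entry n e with p₂ := v } := by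
  funext e'
  by_cases h : e' = e
  · subst h
    simp [State.entry, State.setNat_nat, State.setNat_real]
  · simp [h, State.entry, State.setNat_nat, State.setNat_real]

theorem entry_setCost {r : ℝ} : (s.setReal 0 e r).entry n = Function.update (s.entry n) e
    { s.entry n e with cost := r } := by
  funext e'
  by_cases h : e' = e
  · subst h
    simp [State.entry, State.setReal_nat, State.setReal_real]
  · simp [h, State.entry, State.setReal_nat, State.setReal_real]

end entry

/-! ### Reading the input -/

section input

variable {I : KMedianInstance} {G : SimpleGraph (Fin I.n)} {D : NiceTreeDecomposition G}

theorem nodeTable_coe {N : ℕ} (f : Fin N → ℕ) (t : Fin N) : nodeTable f t = f t := by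
  simp [nodeTable]

theorem input_bagSize (t : Fin D.N) (j : ℕ) :
    (connectedInput I G D).nat .bagSize t j = (D.bag t).card := by
  simp [connectedInput, nodeTable_coe]

theorem input_child₁ (t : Fin D.N) (j : ℕ) :
    (connectedInput I G D).nat .child₁ t j = (D.node t).child₁ := by
  simp [connectedInput, nodeTable_coe]

theorem input_child₂ (t : Fin D.N) (j : ℕ) :
    (connectedInput I G D).nat .child₂ t j = (D.node t).child₂ := by
  simp [connectedInput, nodeTable_coe]

theorem input_vertex₁ (t : Fin D.N) (j : ℕ) :
    (connectedInput I G D).nat .vertex₁ t j = (D.node t).vertex₁ := by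
  simp [connectedInput, nodeTable_coe]

theorem input_vertex₂ (t : Fin D.N) (j : ℕ) :
    (connectedInput I G D).nat .vertex₂ t j = (D.node t).vertex₂ := by
  simp [connectedInput, nodeTable_coe]

theorem input_nodeTag (t : Fin D.N) (j : ℕ) :
    (connectedInput I G D).nat .nodeTag t j = (D.node t).tag := by
  simp [connectedInput, nodeTable_coe]

theorem input_bagMember (t : Fin D.N) (j : ℕ) (hj : j < ((D.bag t).sort (· ≤ ·)).length) :
    (connectedInput I G D).nat .bagMember t j = (((D.bag t).sort (· ≤ ·))[j] : Fin I.n) := by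
  simp only [connectedInput, nodeTable_coe]
  rw [List.getD_eq_getElem _ _ (by simpa using hj), List.getElem_map]

end input

/-! ### Loops over the vertices of a bag. -/

section forBag

variable {I : KMedianInstance} {G : SimpleGraph (Fin I.n)} {D : NiceTreeDecomposition G}
  {X : ℕ} {P : CProg} {s : State} {R : State → Prop}

/-- The invariant refers to the set of vertices visited so far, not to a position in the sorted list
of the bag; callers only need that every vertex is visited exactly once. -/
theorem Runs.forBag {c u a : ℕ} (t : Fin D.N) (J : Finset (Fin I.n) → State → Prop)
    (ha : s.nat a 0 = t) (hX : (D.bag t).card ≤ X)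
    (hJc : ∀ A s v, J A s → J A (s.setNat c 0 v)) (hJu : ∀ A s v, J A s → J A (s.setNat u 0 v))
    (hw : (forBag c u a P).wn a = false) (hP : P.wn c = false) (huc : Nat.beq c u = false)
    (h0 : J ∅ s)
    (hstep : ∀ A v s', v ∈ D.bag t → v ∉ A → A ⊆ D.bag t → Frame (forBag c u a P) s s' →
      J A s' → s'.nat u 0 = v → Runs (connectedInput I G D) X P s' (J (insert v A)))
    (hR : ∀ s', J (D.bag t) s' → Frame (forBag c u a P) s s' → R s') :
    Runs (connectedInput I G D) X (forBag c u a P) s R := by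
  have hlen : ((D.bag t).sort (· ≤ ·)).length = (D.bag t).card := Finset.length_sort _
  have huc' : c ≠ u := by
    intro h
    rw [h, Nat.beq_refl] at huc
    cases huc
  refine Runs.for 0 (D.bag t).card
    (fun j s' => J (((D.bag t).sort (· ≤ ·)).take j).toFinset s') (fun j s' v h => hJc _ _ _ h) ?_
    rfl (Nat.zero_le _) (by omega) ?_ (by simpa using h0) ?_ ?_
  · simp [Prog.wn, hP, huc]
  · intro j s' hF _
    have := hF.nat a hw
    simp only [NExp.eval, this, ha, input_bagSize]
  · intro j s' _ hj hF hJ hc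
    rw [← hlen] at hj
    have hav : s'.nat a 0 = t := by rw [hF.nat a hw, ha]
    refine Runs.setNat_seq ?_
    simp only [NExp.eval, hav, hc, input_bagMember t j hj]
    have htake : (((D.bag t).sort (· ≤ ·)).take (j + 1)).toFinset =
        insert ((D.bag t).sort (· ≤ ·))[j] (((D.bag t).sort (· ≤ ·)).take j).toFinset := by
      rw [List.take_succ_eq_append_getElem hj, List.toFinset_append]
      ext x
      simp [or_comm]
    rw [htake]
    refine hstep _ _ _ ?_ ?_ ?_ (hF.trans ?_) (hJu _ _ _ hJ) (by simp [State.setNat])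
    · exact (Finset.mem_sort _).1 (List.getElem_mem hj)
    · have hnd : ((D.bag t).sort (· ≤ ·)).Nodup := Finset.sort_nodup _ _
      rw [List.mem_toFinset, List.mem_take_iff_getElem]
      rintro ⟨i, hi, h⟩
      have := (hnd.getElem_inj_iff).1 h
      omega
    · intro x hx
      rw [List.mem_toFinset] at hx
      exact (Finset.mem_sort _).1 (List.mem_of_mem_take hx)
    · refine ⟨fun b hb => State.setNat_nat_of_ne ?_, fun b _ => rfl⟩
      rintro rfl
      simp [Prog.for, Prog.wn] at hb
  · intro s' hJ hF
    refine hR s' ?_ hF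
    rw [List.take_of_length_le (by omega)] at hJ
    simpa using hJ

end forBag

end RealRAM

/-! ### Building blocks: copying, merging and comparing entries. -/

namespace RealRAM

section blocks

variable {I : KMedianInstance} {G : SimpleGraph (Fin I.n)} {D : NiceTreeDecomposition G}
  {X : ℕ} {s : State} {R : State → Prop}

theorem eval_facExp {x : Input ConnectedQuery} {n : ℕ} {eE uE : CExp} {e : ℕ} {u : Fin n}
    (hE : eE.eval x s = e) (hu : uE.eval x s = u) (hb : s.nat aBase e = e * n) :
    (facExp eE uE).eval x s = (s.entry n e).fac u := by
  simp only [NExp.eval, hE, hu, hb, State.entry]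

theorem eval_labExp {x : Input ConnectedQuery} {n : ℕ} {eE uE : CExp} {e : ℕ} {u : Fin n}
    (hE : eE.eval x s = e) (hu : uE.eval x s = u) (hb : s.nat aBase e = e * n) :
    (labExp eE uE).eval x s = (s.entry n e).lab u := by
  simp only [NExp.eval, hE, hu, hb, State.entry]

theorem Runs.setFac {x : Input ConnectedQuery} {n : ℕ} {eE uE vE : CExp} {e v : ℕ} {u : Fin n}
    (hE : eE.eval x s = e) (hu : uE.eval x s = u) (hb : s.nat aBase e = e * n)
    (hv : vE.eval x s = v) (h : R (s.setNat aFac (e * n + u) v)) :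
    Runs x X (setFac eE uE vE) s R := by
  refine Runs.setNat ?_
  simpa only [NExp.eval, hE, hu, hb, hv] using h

theorem Runs.setLab {x : Input ConnectedQuery} {n : ℕ} {eE uE vE : CExp} {e v : ℕ} {u : Fin n}
    (hE : eE.eval x s = e) (hu : uE.eval x s = u) (hb : s.nat aBase e = e * n)
    (hv : vE.eval x s = v) (h : R (s.setNat aLab (e * n + u) v)) :
    Runs x X (setLab eE uE vE) s R := by
  refine Runs.setNat ?_
  simpa only [NExp.eval, hE, hu, hb, hv] using h

theorem Frame.entry {n : ℕ} {P : CProg} {s' : State} (hF : Frame P s s') (h6 : P.wn aFac = false)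
    (h7 : P.wn aLab = false) (h8 : P.wn aCnt = false) (h9 : P.wn aPtr₁ = false)
    (h10 : P.wn aPtr₂ = false) (h0 : P.wr 0 = false) : s'.entry n = s.entry n := by
  refine entry_congr (fun b h h' => hF.nat b ?_) (hF.real 0 h0)
  interval_cases b <;> assumption

/-- The source differs from the entry `top`, so it stays intact while being copied. Only the labels
and facilities of bag vertices are copied, so nothing is claimed about other vertices. -/
theorem copyProg_spec {a : ℕ} {t : Fin D.N} {e top : ℕ} (ha : s.nat a 0 = t)
    (hX : (D.bag t).card ≤ X) (hw : (copyProg a).wn a = false)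
    (htop : s.nat vTop 0 = top) (he : s.nat vE₁ 0 = e) (hbt : s.nat aBase top = top * I.n)
    (hbe : s.nat aBase e = e * I.n) (hne : e ≠ top) :
    Runs (connectedInput I G D) X (copyProg a) s fun s' =>
      (∀ e', e' ≠ top → s'.entry I.n e' = s.entry I.n e') ∧
      (∀ u ∈ D.bag t, (s'.entry I.n top).fac u = (s.entry I.n e).fac u ∧
        (s'.entry I.n top).lab u = (s.entry I.n e).lab u) ∧
      (s'.entry I.n top).cnt = (s.entry I.n e).cnt ∧
      (s'.entry I.n top).cost = (s.entry I.n e).cost ∧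
      (s'.entry I.n top).p₁ = e := by
  refine Runs.seq' (Runs.forBag t (R := fun s' =>
      (∀ e', e' ≠ top → s'.entry I.n e' = s.entry I.n e') ∧
      (∀ u ∈ D.bag t, (s'.entry I.n top).fac u = (s.entry I.n e).fac u ∧
        (s'.entry I.n top).lab u = (s.entry I.n e).lab u))
    (fun A s' => (∀ e', e' ≠ top → s'.entry I.n e' = s.entry I.n e') ∧
      (∀ u ∈ A, (s'.entry I.n top).fac u = (s.entry I.n e).fac u ∧
        (s'.entry I.n top).lab u = (s.entry I.n e).lab u)) ha hX
    (fun _ _ _ h => h) (fun _ _ _ h => h) ?_ rfl rfl (by simp) ?_ fun s' h _ => h) ?_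
  · simp only [copyProg, Prog.wn, Bool.or_eq_false_iff] at hw ⊢
    exact hw.1
  · rintro A v s' hv hvA hA hF ⟨h1, h2⟩ hu
    have htop' : s'.nat vTop 0 = top := by rw [hF.nat vTop rfl, htop]
    have he' : s'.nat vE₁ 0 = e := by rw [hF.nat vE₁ rfl, he]
    have hbt' : s'.nat aBase top = top * I.n := by rw [hF.nat aBase rfl, hbt]
    have hbe' : s'.nat aBase e = e * I.n := by rw [hF.nat aBase rfl, hbe]
    refine Runs.seq (Runs.setFac htop' hu hbt' (eval_facExp he' hu hbe') ?_)
    refine Runs.setLab htop' hu hbt' (eval_labExp he' hu hbe') ?_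
    rw [entry_setLab, entry_setFac]
    refine ⟨fun e' h => by simp [h, h1], fun u hu => ?_⟩
    rcases Finset.mem_insert.1 hu with rfl | hu
    · simp [hne, h1 e hne]
    · have : u ≠ v := fun h => hvA (h ▸ hu)
      simp [this, h2 u hu]
  · rintro s' ⟨h1, h2⟩ hF
    have htop' : s'.nat vTop 0 = top := by rw [hF.nat vTop rfl, htop]
    have he' : s'.nat vE₁ 0 = e := by rw [hF.nat vE₁ rfl, he]
    refine Runs.setNat_seq (Runs.setReal_seq (Runs.setNat ?_))
    simp only [NExp.eval, RExp.eval, State.setNat_nat, State.setReal_nat, State.setNat_real,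
      Nat.reduceEqDiff, false_and, if_false, htop', he']
    rw [entry_setPtr₁, entry_setCost, entry_setCnt]
    refine ⟨fun e' h => by simp [h, h1], fun u hu => by simp [h2 u hu], ?_, ?_, by simp⟩
    · simp only [Function.update_self]
      rw [← h1 e hne]
      rfl
    · simp only [Function.update_self]
      rw [← h1 e hne]
      rfl

/-- Relabeling in place is harmless: every vertex is visited once, and the invariant records that
unvisited vertices still have their original labels. The labels `a` and `b` are saved in variables
beforehand. -/
theorem mergeProg_spec {t : Fin D.N} {top a b : ℕ} (ht : s.nat vT 0 = t)
    (hX : (D.bag t).card ≤ X)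
    (htop : s.nat vTop 0 = top) (hbt : s.nat aBase top = top * I.n)
    (ha : s.nat vA 0 = a) (hb : s.nat vB 0 = b) :
    Runs (connectedInput I G D) X mergeProg s fun s' =>
      ∃ l, s'.entry I.n = Function.update (s.entry I.n) top { s.entry I.n top with lab := l } ∧
        ∀ x ∈ D.bag t, l x =
          if (s.entry I.n top).lab x = a then b else (s.entry I.n top).lab x := by
  refine Runs.forBag t
    (fun A s' => ∃ l, s'.entry I.n =
        Function.update (s.entry I.n) top { s.entry I.n top with lab := l } ∧
        (∀ x ∈ A, l x = if (s.entry I.n top).lab x = a then b else (s.entry I.n top).lab x) ∧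
        ∀ x, x ∉ A → l x = (s.entry I.n top).lab x) ht hX
    (fun _ _ _ h => h) (fun _ _ _ h => h) rfl rfl rfl
    ⟨(s.entry I.n top).lab, by simp, by simp, by simp⟩ ?_
    fun s' ⟨l, h1, h2, _⟩ _ => ⟨l, h1, h2⟩
  rintro A v s' hv hvA hA hF ⟨l, h1, h2, h3⟩ hu
  have htop' : s'.nat vTop 0 = top := by rw [hF.nat vTop rfl, htop]
  have hbt' : s'.nat aBase top = top * I.n := by rw [hF.nat aBase rfl, hbt]
  have ha' : s'.nat vA 0 = a := by rw [hF.nat vA rfl, ha]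
  have hb' : s'.nat vB 0 = b := by rw [hF.nat vB rfl, hb]
  have hlv : (labExp (.var vTop) (.var vX)).eval (connectedInput I G D) s' =
      (s.entry I.n top).lab v := by
    rw [eval_labExp (eE := .var vTop) (uE := .var vX) htop' hu hbt', h1]
    simp [h3 v hvA]
  refine Runs.cond (fun h => ?_) (fun h => ?_) <;>
    rw [BExp.holds_eq, hlv] at h <;> simp only [NExp.eval, ha'] at h
  · refine Runs.setLab htop' hu hbt' hb' ?_
    refine ⟨Function.update l v b, ?_, ?_, ?_⟩
    · rw [entry_setLab, h1]
      simp
    · intro x hx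
      rcases Finset.mem_insert.1 hx with rfl | hx
      · simp [h]
      · have : x ≠ v := fun h => hvA (h ▸ hx)
        simp [this, h2 x hx]
    · intro x hx
      rw [Finset.mem_insert, not_or] at hx
      simp [hx.1, h3 x hx.2]
  · refine Runs.skip ⟨l, h1, ?_, fun x hx => h3 x fun h => hx (Finset.mem_insert_of_mem h)⟩
    intro x hx
    rcases Finset.mem_insert.1 hx with rfl | hx
    · simp [h, h3 x hvA]
    · exact h2 x hx

/-- The labels `l` arise from `l₀` by merging some labels that are equal under `l₂`. -/
structure Merged {n : ℕ} (B : Finset (Fin n)) (l₀ l₂ l : Fin n → ℕ) : Prop where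
  coarse : ∀ x ∈ B, ∀ y ∈ B, l₀ x = l₀ y → l x = l y
  least : ∀ R : Setoid (Fin n), (∀ u ∈ B, ∀ v ∈ B, l₀ u = l₀ v → R u v) →
    (∀ u ∈ B, ∀ v ∈ B, l₂ u = l₂ v → R u v) → ∀ u ∈ B, ∀ v ∈ B, l u = l v → R u v
  range : ∀ x ∈ B, ∃ y ∈ B, l x = l₀ y

theorem Merged.refl {n : ℕ} {B : Finset (Fin n)} {l₀ l₂ : Fin n → ℕ} : Merged B l₀ l₂ l₀ :=
  ⟨fun _ _ _ _ h => h, fun _ h _ => h, fun x hx => ⟨x, hx, rfl⟩⟩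

/-- Renaming the class of `u` to that of `v` adds just one pair that is equal under `l₂`, so every
equivalence relation containing both partitions still contains the new one. No fresh label is
created, which keeps the labels bounded. -/
theorem Merged.step {n : ℕ} {B : Finset (Fin n)} {l₀ l₂ l l' : Fin n → ℕ} (h : Merged B l₀ l₂ l)
    {u v : Fin n} (hu : u ∈ B) (hv : v ∈ B) (huv : l₂ u = l₂ v)
    (hl : ∀ x ∈ B, l' x = if l x = l u then l v else l x) : Merged B l₀ l₂ l' := by
  refine ⟨fun x hx y hy hxy => ?_, fun R h0 h2 x hx y hy hxy => ?_, fun x hx => ?_⟩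
  · rw [hl x hx, hl y hy, h.coarse x hx y hy hxy]
  · have hR := h.least R h0 h2
    have hRuv := h2 u hu v hv huv
    rw [hl x hx, hl y hy] at hxy
    split_ifs at hxy with h3 h4 h4
    · exact R.trans (hR x hx u hu h3) (hR u hu y hy h4.symm)
    · exact R.trans (hR x hx u hu h3) (R.trans hRuv (hR v hv y hy hxy))
    · exact R.trans (hR x hx v hv hxy) (R.trans (R.symm hRuv) (hR u hu y hy h4.symm))
    · exact hR x hx y hy hxy
  · rw [hl x hx]
    split_ifs
    · exact h.range v hv
    · exact h.range x hx

/-- All pairs of bag vertices with equal labels in the second entry are merged one after the other.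
Later merges act on whole classes, so equalities obtained earlier persist. -/
theorem joinLabProg_spec {t : Fin D.N} {top e : ℕ} (ht : s.nat vT 0 = t)
    (hX : (D.bag t).card ≤ X)
    (htop : s.nat vTop 0 = top) (hbt : s.nat aBase top = top * I.n)
    (he : s.nat vE₂ 0 = e) (hbe : s.nat aBase e = e * I.n) (hne : e ≠ top) :
    Runs (connectedInput I G D) X joinLabProg s fun s' =>
      ∃ l, s'.entry I.n = Function.update (s.entry I.n) top { s.entry I.n top with lab := l } ∧
        Merged (D.bag t) (s.entry I.n top).lab (s.entry I.n e).lab l ∧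
        ∀ u ∈ D.bag t, ∀ v ∈ D.bag t, (s.entry I.n e).lab u = (s.entry I.n e).lab v →
          l u = l v := by
  refine Runs.forBag t
    (fun A s' => ∃ l, s'.entry I.n =
        Function.update (s.entry I.n) top { s.entry I.n top with lab := l } ∧
        Merged (D.bag t) (s.entry I.n top).lab (s.entry I.n e).lab l ∧
        ∀ u ∈ A, ∀ v ∈ D.bag t, (s.entry I.n e).lab u = (s.entry I.n e).lab v → l u = l v) ht hX
    (fun _ _ _ h => h) (fun _ _ _ h => h) rfl rfl rfl
    ⟨(s.entry I.n top).lab, by simp, Merged.refl, by simp⟩ ?_ fun s' h _ => h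
  rintro A u s₁ hu huA hA hF₁ ⟨l₁, h1, h2, h3⟩ hu₁
  refine Runs.forBag t
    (fun A' s' => ∃ l, s'.entry I.n =
        Function.update (s.entry I.n) top { s.entry I.n top with lab := l } ∧
        Merged (D.bag t) (s.entry I.n top).lab (s.entry I.n e).lab l ∧
        (∀ u ∈ A, ∀ v ∈ D.bag t, (s.entry I.n e).lab u = (s.entry I.n e).lab v → l u = l v) ∧
        ∀ v ∈ A', (s.entry I.n e).lab u = (s.entry I.n e).lab v → l u = l v)
    (by rw [hF₁.nat vT rfl, ht]) hX
    (fun _ _ _ h => h) (fun _ _ _ h => h) rfl rfl rfl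
    ⟨l₁, h1, h2, h3, by simp⟩ ?_ ?_
  · rintro A' v s' hv hvA hA' hF ⟨l, h4, h5, h6, h7⟩ hv'
    have hu' : s'.nat vU 0 = u := by rw [hF.nat vU rfl, hu₁]
    have htop' : s'.nat vTop 0 = top := by rw [hF.nat vTop rfl, hF₁.nat vTop rfl, htop]
    have hbt' : s'.nat aBase top = top * I.n := by
      rw [hF.nat aBase rfl, hF₁.nat aBase rfl, hbt]
    have he' : s'.nat vE₂ 0 = e := by rw [hF.nat vE₂ rfl, hF₁.nat vE₂ rfl, he]
    have hbe' : s'.nat aBase e = e * I.n := by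
      rw [hF.nat aBase rfl, hF₁.nat aBase rfl, hbe]
    have ht' : s'.nat vT 0 = t := by rw [hF.nat vT rfl, hF₁.nat vT rfl, ht]
    refine Runs.cond (fun h => ?_) (fun h => ?_) <;>
      rw [BExp.holds_eq, eval_labExp (eE := .var vE₂) (uE := .var vU) he' hu' hbe',
      eval_labExp (eE := .var vE₂) (uE := .var vU₂) he' hv' hbe', h4] at h <;>
      simp only [Function.update_of_ne hne] at h
    · refine Runs.setNat_seq (Runs.setNat_seq ?_)
      refine (mergeProg_spec (t := t) (top := top) (a := l u) (b := l v)
        ?_ hX ?_ ?_ ?_ ?_).mono ?_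
      · exact ht'
      · exact htop'
      · exact hbt'
      · refine (eval_labExp (eE := .var vTop) (uE := .var vU) htop' hu' hbt').trans ?_
        rw [h4]
        simp
      · refine (eval_labExp (x := connectedInput I G D) (eE := .var vTop) (uE := .var vU₂)
          htop' hv' hbt').trans ?_
        rw [h4]
        simp
      · rintro s₂ ⟨l', h8, h9⟩
        change s₂.entry I.n = Function.update (s'.entry I.n) top
          { s'.entry I.n top with lab := l' } at h8
        change ∀ x ∈ D.bag t, l' x = if (s'.entry I.n top).lab x = _ then _ else
          (s'.entry I.n top).lab x at h9
        simp only [h4, Function.update_self] at h8 h9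
        have hcoarse : ∀ x ∈ D.bag t, ∀ y ∈ D.bag t, l x = l y → l' x = l' y := by
          intro x hx y hy hxy
          rw [h9 x hx, h9 y hy, hxy]
        refine ⟨l', by rw [h8]; simp, h5.step hu hv h h9, fun a ha b hb hab => ?_,
          fun b hb hab => ?_⟩
        · exact hcoarse a (hA ha) b hb (h6 a ha b hb hab)
        · rcases Finset.mem_insert.1 hb with rfl | hb
          · rw [h9 u hu, h9 b hv]
            simp
          · exact hcoarse u hu b (hA' hb) (h7 b hb hab)
    · refine Runs.skip ⟨l, h4, h5, h6, fun b hb hab => ?_⟩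
      rcases Finset.mem_insert.1 hb with rfl | hb
      · exact absurd hab h
      · exact h7 b hb hab
  · rintro s' ⟨l, h4, h5, h6, h7⟩ -
    refine ⟨l, h4, h5, fun a ha b hb hab => ?_⟩
    rcases Finset.mem_insert.1 ha with rfl | ha
    · exact h7 b hb hab
    · exact h6 a ha b hb hab

/-- The variable sums up nonnegative differences of counts, facilities and labels, and such a sum
vanishes only if every difference does. -/
theorem compareProg_spec {t : Fin D.N} {top e : ℕ} (ht : s.nat vT 0 = t)
    (hX : (D.bag t).card ≤ X)
    (htop : s.nat vTop 0 = top) (hbt : s.nat aBase top = top * I.n)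
    (he : s.nat vQ 0 = e) (hbe : s.nat aBase e = e * I.n) :
    Runs (connectedInput I G D) X compareProg s fun s' =>
      s'.nat vMis 0 = 0 ↔ (s.entry I.n e).Same (D.bag t) (s.entry I.n top) := by
  refine Runs.setNat_seq ?_
  refine Runs.forBag t
    (fun A s' => s'.nat vMis 0 = 0 ↔ (s.entry I.n e).Same A (s.entry I.n top)) ht hX
    (fun _ _ _ h => h) (fun _ _ _ h => h) rfl rfl rfl ?_ ?_ fun s' h _ => h
  · simp only [State.setNat_nat_self, NExp.eval, htop, he, Entry.Same, State.entry]
    simp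
    omega
  · rintro A v s' hv hvA hA hF h hu
    have htop' : s'.nat vTop 0 = top := by rw [hF.nat vTop rfl]; exact htop
    have he' : s'.nat vQ 0 = e := by rw [hF.nat vQ rfl]; exact he
    have hbt' : s'.nat aBase top = top * I.n := by rw [hF.nat aBase rfl]; exact hbt
    have hbe' : s'.nat aBase e = e * I.n := by rw [hF.nat aBase rfl]; exact hbe
    have hent : s'.entry I.n = s.entry I.n :=
      (hF.entry rfl rfl rfl rfl rfl rfl).trans (entry_setNat_of_lt (by omega))
    have e1 := eval_facExp (x := connectedInput I G D) (eE := .var vQ) (uE := .var vU) he' hu hbe'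
    have e2 := eval_facExp (x := connectedInput I G D) (eE := .var vTop) (uE := .var vU)
      htop' hu hbt'
    have e3 := eval_labExp (x := connectedInput I G D) (eE := .var vQ) (uE := .var vU) he' hu hbe'
    have e4 := eval_labExp (x := connectedInput I G D) (eE := .var vTop) (uE := .var vU)
      htop' hu hbt'
    rw [hent] at e1 e2 e3 e4
    refine Runs.setNat ?_
    simp only [NExp.eval] at e1 e2 e3 e4 ⊢
    rw [e1, e2, e3, e4]
    simp only [State.setNat_nat_self]
    have : (s.entry I.n e).Same (insert v A) (s.entry I.n top) ↔
        (s.entry I.n e).Same A (s.entry I.n top) ∧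
          (s.entry I.n e).fac v = (s.entry I.n top).fac v ∧
          (s.entry I.n e).lab v = (s.entry I.n top).lab v := by
      simp only [Entry.Same, Finset.forall_mem_insert]
      tauto
    rw [this, ← h]
    omega

end blocks

end RealRAM

/-! ### The table of entries -/

theorem Entry.Same.refl {n : ℕ} {B : Finset (Fin n)} (E : Entry n) : E.Same B E :=
  ⟨rfl, fun _ _ => ⟨rfl, rfl⟩⟩

theorem Entry.Same.symm {n : ℕ} {B : Finset (Fin n)} {E E' : Entry n} (h : E.Same B E') :
    E'.Same B E :=
  ⟨h.1.symm, fun u hu => ⟨(h.2 u hu).1.symm, (h.2 u hu).2.symm⟩⟩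

theorem Entry.Same.trans {n : ℕ} {B : Finset (Fin n)} {E E' E'' : Entry n} (h : E.Same B E')
    (h' : E'.Same B E'') : E.Same B E'' :=
  ⟨h.1.trans h'.1, fun u hu => ⟨(h.2 u hu).1.trans (h'.2 u hu).1,
    (h.2 u hu).2.trans (h'.2 u hu).2⟩⟩

/-- The entries that can occur. -/
def Entry.Bounded {n : ℕ} (B : Finset (Fin n)) (k W : ℕ) (E : Entry n) : Prop :=
  E.cnt ≤ k ∧ ∀ u ∈ B, E.fac u < k ∧ E.lab u < W

theorem Entry.Bounded.of_same {n : ℕ} {B : Finset (Fin n)} {k W : ℕ} {E E' : Entry n}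
    (h : E.Bounded B k W) (h' : E.Same B E') : E'.Bounded B k W :=
  ⟨h'.1 ▸ h.1, fun u hu => (h'.2 u hu).1 ▸ (h'.2 u hu).2 ▸ h.2 u hu⟩

/-- There are only few entries that can occur. -/
theorem card_entries_le {n : ℕ} {B : Finset (Fin n)} {k W m : ℕ} (hB : B.card ≤ W) (hk : 0 < k)
    {ent : ℕ → Entry n} {f : ℕ} (hb : ∀ e, f ≤ e → e < f + m → (ent e).Bounded B k W)
    (hd : ∀ e e', f ≤ e → e < f + m → f ≤ e' → e' < f + m → (ent e).Same B (ent e') → e = e') :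
    m ≤ (k * W) ^ W * (k + 1) := by
  have key : m ≤ (k * W) ^ B.card * (k + 1) := by
    -- An entry is determined up to `Same` by the pair of facility and label at each bag vertex and
    -- by the count.
    let φ : Fin m → (B → Fin k × Fin W) × Fin (k + 1) := fun i =>
      (fun u => (⟨(ent (f + i)).fac u, ((hb (f + i) (by omega) (by omega)).2 u u.2).1⟩,
        ⟨(ent (f + i)).lab u, ((hb (f + i) (by omega) (by omega)).2 u u.2).2⟩),
        ⟨(ent (f + i)).cnt, Nat.lt_succ_of_le (hb (f + i) (by omega) (by omega)).1⟩)
    have hφ : Function.Injective φ := by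
      intro i j hij
      simp only [φ, Prod.mk.injEq, funext_iff, Fin.mk.injEq] at hij
      have := hd (f + i) (f + j) (by omega) (by omega) (by omega) (by omega)
        ⟨hij.2, fun u hu => hij.1 ⟨u, hu⟩⟩
      exact Fin.ext (by omega)
    have := Fintype.card_le_of_injective φ hφ
    simpa using this
  refine key.trans (Nat.mul_le_mul_right _ ?_)
  rcases Nat.eq_zero_or_pos W with rfl | hW
  · simp [Nat.le_zero.1 hB]
  · exact Nat.pow_le_pow_right (by positivity) hB

namespace NodeType

variable {n N : ℕ}

/-- The resulting entry enters only through its count and its values on the bag. For an introduced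
vertex this requires that the vertex belongs to the bag. -/
theorem Leads.congr {B : Finset (Fin n)} {c : ℕ × ℕ} {E₁ E₂ E E' : Entry n} {a : NodeType n N}
    (h : a.Leads B c E₁ E₂ E) (h' : E.Same B E')
    (hv : ∀ v s, a = .introVertex v s → v ∈ B) : a.Leads B c E₁ E₂ E' := by
  obtain ⟨h0, h'⟩ := h'
  cases a with
  | leaf => exact h0.symm.trans h
  | introVertex v s =>
    obtain ⟨h1, h2, h3, h4⟩ := h
    have hv := h' v (hv v s rfl)
    refine ⟨h0 ▸ h1, hv.1 ▸ h2, hv.2 ▸ h3, fun u hu huv => ?_⟩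
    rw [← (h' u hu).1, ← (h' u hu).2]
    exact h4 u hu huv
  | introEdge u v s =>
    refine ⟨h0 ▸ h.1, fun u hu => ?_⟩
    rw [← (h' u hu).1, ← (h' u hu).2]
    exact h.2 u hu
  | forget v s =>
    refine ⟨h0 ▸ h.1, fun u hu => ?_⟩
    rw [← (h' u hu).1, ← (h' u hu).2]
    exact h.2 u hu
  | join s₁ s₂ =>
    obtain ⟨h1, h2, h3, h4, h5⟩ := h
    refine ⟨h0 ▸ h1, fun u hu => ?_, fun u hu v hv huv => ?_, fun u hu v hv huv => ?_,
      fun R hR₁ hR₂ u hu v hv huv => ?_⟩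
    · rw [← (h' u hu).1]
      exact h2 u hu
    · rw [← (h' u hu).2, ← (h' v hv).2]
      exact h3 u hu v hv huv
    · rw [← (h' u hu).2, ← (h' v hv).2]
      exact h4 u hu v hv huv
    · rw [← (h' u hu).2, ← (h' v hv).2] at huv
      exact h5 R hR₁ hR₂ u hu v hv huv

end NodeType

namespace NiceTreeDecomposition

variable {n : ℕ} {G : SimpleGraph (Fin n)} (D : NiceTreeDecomposition G)

theorem leads_congr {D : NiceTreeDecomposition G} {t : Fin D.N} {c : ℕ × ℕ}
    {E₁ E₂ E E' : Entry n} (h : (D.node t).Leads (D.bag t) c E₁ E₂ E)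
    (h' : E.Same (D.bag t) E') : (D.node t).Leads (D.bag t) c E₁ E₂ E' := by
  refine h.congr h' fun v s ht => ?_
  obtain ⟨-, -, hbag⟩ := valid_of_node ht
  simp [hbag]

/-- `e₁` and `e₂` are entries of the children of `t`. -/
def InRange (F L : ℕ → ℕ) (t : Fin D.N) (e₁ e₂ : ℕ) : Prop :=
  (1 ≤ (D.node t).tag → F (D.node t).child₁ ≤ e₁ ∧ e₁ < L (D.node t).child₁) ∧
  (4 ≤ (D.node t).tag → F (D.node t).child₂ ≤ e₂ ∧ e₂ < L (D.node t).child₂)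

/-- The entry `E` of `t` results from its predecessors. -/
def Sound (k : ℕ) (g : Fin n → ℕ → ℝ) (ent : ℕ → Entry n) (F L : ℕ → ℕ) (t : Fin D.N)
    (E : Entry n) : Prop :=
  D.InRange F L t E.p₁ E.p₂ ∧ (∃ c, (D.node t).Feas (D.bag t) k c (ent E.p₁) (ent E.p₂) ∧
    (D.node t).Leads (D.bag t) c (ent E.p₁) (ent E.p₂) E) ∧
    E.cost = (D.node t).newCost g (ent E.p₁) (ent E.p₂)

/-- Some entry `f ≤ e < m` is at least as good as what results from the choice `c`. -/
def Covered (g : Fin n → ℕ → ℝ) (t : Fin D.N) (E₁ E₂ : Entry n) (c : ℕ × ℕ) (ent : ℕ → Entry n)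
    (f m : ℕ) : Prop :=
  ∃ e, f ≤ e ∧ e < m ∧ (D.node t).Leads (D.bag t) c E₁ E₂ (ent e) ∧
    (ent e).cost ≤ (D.node t).newCost g E₁ E₂

/-- The entries `F t ≤ e < L t` are those of the node `t`. -/
structure IsTable (k W : ℕ) (g : Fin n → ℕ → ℝ) (ent : ℕ → Entry n) (F L : ℕ → ℕ)
    (t : Fin D.N) : Prop where
  le : F t ≤ L t
  sound : ∀ e, F t ≤ e → e < L t → D.Sound k g ent F L t (ent e)
  bounded : ∀ e, F t ≤ e → e < L t → (ent e).Bounded (D.bag t) k W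
  inj : ∀ e e', F t ≤ e → e < L t → F t ≤ e' → e' < L t →
    (ent e).Same (D.bag t) (ent e') → e = e'
  complete : D.Complete k g ent F L t

/-- The entries `f ≤ e < top` of the node `t` have been found so far. -/
structure Building (k W : ℕ) (g : Fin n → ℕ → ℝ) (ent₀ : ℕ → Entry n) (F L : ℕ → ℕ) (t : Fin D.N)
    (f : ℕ) (base : ℕ → ℕ) (ent : ℕ → Entry n) (top : ℕ) : Prop where
  base : ∀ e ≤ top, base e = e * n
  le : f ≤ top
  old : ∀ e < f, ent e = ent₀ e
  sound : ∀ e, f ≤ e → e < top → D.Sound k g ent₀ F L t (ent e)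
  bounded : ∀ e, f ≤ e → e < top → (ent e).Bounded (D.bag t) k W
  inj : ∀ e e', f ≤ e → e < top → f ≤ e' → e' < top →
    (ent e).Same (D.bag t) (ent e') → e = e'

variable {D}

theorem Building.card_le {k W : ℕ} {g : Fin n → ℕ → ℝ} {ent₀ : ℕ → Entry n} {F L : ℕ → ℕ}
    {t : Fin D.N} {f : ℕ} {base : ℕ → ℕ} {ent : ℕ → Entry n} {top : ℕ}
    (h : D.Building k W g ent₀ F L t f base ent top) (hB : (D.bag t).card ≤ W) (hk : 0 < k) :
    top - f ≤ (k * W) ^ W * (k + 1) := by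
  have := h.le
  refine card_entries_le hB hk (ent := ent) (f := f) (fun e h1 h2 => h.bounded e h1 (by omega)) ?_
  exact fun e e' h1 h2 h3 h4 => h.inj e e' h1 (by omega) h3 (by omega)

theorem IsTable.card_le {k W : ℕ} {g : Fin n → ℕ → ℝ} {F L : ℕ → ℕ}
    {t : Fin D.N} {ent : ℕ → Entry n} (h : D.IsTable k W g ent F L t)
    (hB : (D.bag t).card ≤ W) (hk : 0 < k) : L t - F t ≤ (k * W) ^ W * (k + 1) := by
  have := h.le
  refine card_entries_le hB hk (ent := ent) (f := F t)
    (fun e h1 h2 => h.bounded e h1 (by omega)) ?_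
  exact fun e e' h1 h2 h3 h4 => h.inj e e' h1 (by omega) h3 (by omega)

end NiceTreeDecomposition

/-! ### Inserting an entry into the table of a node. -/

namespace RealRAM

section insert

variable {I : KMedianInstance} {G : SimpleGraph (Fin I.n)} {D : NiceTreeDecomposition G}
  {X : ℕ} {s : State} {R : State → Prop}

/-- The two outcomes: either no earlier entry of the node agrees with the new one and `vTop`
advances past it, or an agreeing entry `o` survives with the cheaper of both costs and the matching
pointers, and the cell `top` is free for reuse. -/
theorem insertProg_aux {t : Fin D.N} {top f : ℕ} (ht : s.nat vT 0 = t)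
    (hX : (D.bag t).card ≤ X) (hX' : top - f ≤ X) (htop : s.nat vTop 0 = top)
    (hfst : s.nat aFst t = f) (hf : f ≤ top) (hbase : ∀ e ≤ top, s.nat aBase e = e * I.n) :
    Runs (connectedInput I G D) X insertProg s fun s' =>
      (s'.nat vTop 0 = top + 1 ∧ (∀ e ≤ top + 1, s'.nat aBase e = e * I.n) ∧
        s'.entry I.n = s.entry I.n ∧
        ∀ e, f ≤ e → e < top → ¬ (s.entry I.n e).Same (D.bag t) (s.entry I.n top)) ∨
      (s'.nat vTop 0 = top ∧ (∀ e ≤ top, s'.nat aBase e = e * I.n) ∧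
        ∃ o, f ≤ o ∧ o < top ∧ (s.entry I.n o).Same (D.bag t) (s.entry I.n top) ∧
        (((s.entry I.n top).cost ≤ (s.entry I.n o).cost ∧ s'.entry I.n =
            Function.update (s.entry I.n) o { s.entry I.n o with
              cost := (s.entry I.n top).cost, p₁ := (s.entry I.n top).p₁,
              p₂ := (s.entry I.n top).p₂ }) ∨
          ((s.entry I.n o).cost ≤ (s.entry I.n top).cost ∧ s'.entry I.n = s.entry I.n))) := by
  refine Runs.setNat_seq ?_
  refine Runs.seq' (R₁ := fun s' =>
    (s'.nat vDup 0 = 0 ∧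
      ∀ e, f ≤ e → e < top → ¬ (s.entry I.n e).Same (D.bag t) (s.entry I.n top)) ∨
    (s'.nat vDup 0 = 1 ∧ f ≤ s'.nat vOld 0 ∧ s'.nat vOld 0 < top ∧
      (s.entry I.n (s'.nat vOld 0)).Same (D.bag t) (s.entry I.n top))) ?_ ?_
  · refine Runs.for f top (fun j s' =>
      (s'.nat vDup 0 = 0 ∧
        ∀ e, f ≤ e → e < j → ¬ (s.entry I.n e).Same (D.bag t) (s.entry I.n top)) ∨
      (s'.nat vDup 0 = 1 ∧ f ≤ s'.nat vOld 0 ∧ s'.nat vOld 0 < top ∧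
        (s.entry I.n (s'.nat vOld 0)).Same (D.bag t) (s.entry I.n top)))
      (fun _ _ _ h => h) rfl ?_ hf hX' ?_ ?_ ?_ (fun s' h _ => h)
    · simp only [NExp.eval, State.setNat_nat, Nat.reduceEqDiff, false_and, if_false, ht, hfst]
    · intro j s' hF _
      simp only [NExp.eval]
      rw [hF.nat vTop rfl]
      exact htop
    · exact Or.inl ⟨by simp [NExp.eval, State.setNat_nat], fun e h1 h2 => by omega⟩
    · intro j s' hj hj' hF hJ hc
      have ht' : s'.nat vT 0 = t := by rw [hF.nat vT rfl]; exact ht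
      have htop' : s'.nat vTop 0 = top := by rw [hF.nat vTop rfl]; exact htop
      have hbase' : ∀ e ≤ top, s'.nat aBase e = e * I.n := by
        rw [hF.nat aBase rfl]
        exact hbase
      have hent : s'.entry I.n = s.entry I.n :=
        (hF.entry rfl rfl rfl rfl rfl rfl).trans (entry_setNat_of_lt (by omega))
      refine Runs.seq' (compareProg_spec ht' hX htop' (hbase' _ le_rfl) hc
        (hbase' _ (by omega))) ?_
      intro s'' h hF'
      rw [hent] at h
      refine Runs.cond (fun hb => ?_) (fun hb => ?_) <;>
        simp only [BExp.Holds, NExp.eval, Nat.le_zero, h] at hb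
      · refine Runs.setNat_seq (Runs.setNat (Or.inr ⟨?_, ?_⟩))
        · simp [NExp.eval, State.setNat_nat]
        · have : s''.nat vQ 0 = j := by rw [hF'.nat vQ rfl, hc]
          simp only [NExp.eval, State.setNat_nat, Nat.reduceEqDiff, false_and, if_false, and_self,
            if_true, this]
          exact ⟨hj, hj', hb⟩
      · refine Runs.skip ?_
        rw [hF'.nat vDup rfl, hF'.nat vOld rfl]
        rcases hJ with ⟨h1, h2⟩ | h1
        · refine Or.inl ⟨h1, fun e he he' => ?_⟩
          rcases Nat.lt_succ_iff_lt_or_eq.1 he' with h3 | rfl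
          · exact h2 e he h3
          · exact hb
        · exact Or.inr h1
  · intro s' hJ hF
    have htop' : s'.nat vTop 0 = top := by rw [hF.nat vTop rfl]; exact htop
    have hbase' : ∀ e ≤ top, s'.nat aBase e = e * I.n := by
      rw [hF.nat aBase rfl]
      exact hbase
    have hent : s'.entry I.n = s.entry I.n :=
      (hF.entry rfl rfl rfl rfl rfl rfl).trans (entry_setNat_of_lt (by omega))
    refine Runs.cond (fun hb => ?_) (fun hb => ?_) <;> simp only [BExp.Holds, NExp.eval] at hb
    · rcases hJ with ⟨h1, h2⟩ | ⟨h1, h2, h3, h4⟩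
      · omega
      · have hcost : ∀ e, s'.real 0 e = (s.entry I.n e).cost := by
          intro e
          rw [← hent]
          rfl
        have hp₁ : ∀ e, s'.nat aPtr₁ e = (s.entry I.n e).p₁ := by
          intro e
          rw [← hent]
          rfl
        have hp₂ : ∀ e, s'.nat aPtr₂ e = (s.entry I.n e).p₂ := by
          intro e
          rw [← hent]
          rfl
        refine Runs.cond (fun hb => ?_) (fun hb => ?_) <;>
          simp only [BExp.Holds, NExp.eval, RExp.eval, htop', hcost] at hb
        · refine Runs.setReal_seq (Runs.setNat_seq (Runs.setNat
            (Or.inr ⟨htop', hbase', _, h2, h3, h4, Or.inl ⟨hb, ?_⟩⟩)))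
          simp only [NExp.eval, RExp.eval, State.setNat_nat, State.setReal_nat, Nat.reduceEqDiff,
            false_and, if_false, htop', hcost, hp₁, hp₂]
          rw [entry_setPtr₂, entry_setPtr₁, entry_setCost, hent]
          simp
        · exact Runs.skip (Or.inr ⟨htop', hbase', _, h2, h3, h4, Or.inr ⟨(not_le.1 hb).le, hent⟩⟩)
    · rcases hJ with ⟨h1, h2⟩ | ⟨h1, h2, h3, h4⟩
      · refine Runs.setNat_seq (Runs.setNat (Or.inl ⟨?_, ?_, ?_, h2⟩))
        · simp [NExp.eval, State.setNat_nat, htop']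
        · intro e he
          simp only [NExp.eval, State.setNat_nat, htop', Nat.reduceEqDiff, false_and, if_false,
            true_and, connectedInput]
          split_ifs with h
          · rw [h, hbase' top le_rfl]
            ring
          · exact hbase' e (by omega)
        · rw [entry_setNat_of_lt (by omega), entry_setNat_of_gt (by omega), hent]
      · omega

variable {k W : ℕ} {g : Fin I.n → ℕ → ℝ} {ent₀ : ℕ → Entry I.n} {F L : ℕ → ℕ} {t : Fin D.N}
  {f : ℕ}

/-- Inserting the entry `vTop`. -/
theorem insertProg_spec (ht : s.nat vT 0 = t) (hX : (D.bag t).card ≤ X)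
    (hX' : (k * W) ^ W * (k + 1) ≤ X) (hW : (D.bag t).card ≤ W) (hk : 0 < k)
    (hfst : s.nat aFst t = f)
    (hB : D.Building k W g ent₀ F L t f (s.nat aBase) (s.entry I.n) (s.nat vTop 0))
    (hs : D.Sound k g ent₀ F L t (s.entry I.n (s.nat vTop 0)))
    (hb : (s.entry I.n (s.nat vTop 0)).Bounded (D.bag t) k W) :
    Runs (connectedInput I G D) X insertProg s fun s' =>
      D.Building k W g ent₀ F L t f (s'.nat aBase) (s'.entry I.n) (s'.nat vTop 0) ∧
      (∀ c E₁ E₂, D.Covered g t E₁ E₂ c (s.entry I.n) f (s.nat vTop 0) ∨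
        ((D.node t).Leads (D.bag t) c E₁ E₂ (s.entry I.n (s.nat vTop 0)) ∧
          (s.entry I.n (s.nat vTop 0)).cost ≤ (D.node t).newCost g E₁ E₂) →
        D.Covered g t E₁ E₂ c (s'.entry I.n) f (s'.nat vTop 0)) := by
  generalize htop : s.nat vTop 0 = top at hB hs hb ⊢
  refine (insertProg_aux ht hX ((hB.card_le hW hk).trans hX') htop hfst hB.le hB.base).mono ?_
  intro s' h
  rcases h with ⟨h1, h2, h3, h4⟩ | ⟨h1, h2, o, h3, h4, h5, h6⟩
  · rw [h1, h3]
    have hle := hB.le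
    refine ⟨⟨h2, by omega, hB.old, fun e he he' => ?_, fun e he he' => ?_, ?_⟩, ?_⟩
    · rcases Nat.lt_succ_iff_lt_or_eq.1 he' with h | rfl
      · exact hB.sound e he h
      · exact hs
    · rcases Nat.lt_succ_iff_lt_or_eq.1 he' with h | rfl
      · exact hB.bounded e he h
      · exact hb
    · intro e e' he1 he2 he1' he2' hsame
      rcases Nat.lt_succ_iff_lt_or_eq.1 he2 with h | rfl <;>
        rcases Nat.lt_succ_iff_lt_or_eq.1 he2' with h' | rfl
      · exact hB.inj e e' he1 h he1' h' hsame
      · exact absurd hsame (h4 e he1 h)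
      · exact absurd hsame.symm (h4 e' he1' h')
      · rfl
    · rintro c E₁ E₂ (⟨e, a1, a2, a3⟩ | h)
      · exact ⟨e, a1, by omega, a3⟩
      · exact ⟨top, by omega, by omega, h⟩
  · rw [h1]
    have hent : s'.entry I.n = s.entry I.n ∨ s'.entry I.n = Function.update (s.entry I.n) o
        { s.entry I.n o with cost := (s.entry I.n top).cost, p₁ := (s.entry I.n top).p₁,
                             p₂ := (s.entry I.n top).p₂ } := by tauto
    -- A replacement changes only cost and pointers, so equality of entries up to `Same` is
    -- unaffected and costs can only go down. Hence everything covered before remains covered.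
    have hsame : ∀ e, (s'.entry I.n e).Same (D.bag t) (s.entry I.n e) := by
      intro e
      rcases hent with h | h
      · rw [h]
        exact Entry.Same.refl _
      · rw [h]
        by_cases he : e = o
        · subst he
          rw [Function.update_self]
          exact ⟨rfl, fun _ _ => ⟨rfl, rfl⟩⟩
        · rw [Function.update_of_ne he]
          exact Entry.Same.refl _
    have hcost : ∀ e, (s'.entry I.n e).cost ≤ (s.entry I.n e).cost := by
      intro e
      rcases h6 with ⟨h, h'⟩ | ⟨-, h⟩
      · rw [h']
        by_cases he : e = o
        · subst he
          simpa using h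
        · rw [Function.update_of_ne he]
      · rw [h]
    have hcost' : (s'.entry I.n o).cost ≤ (s.entry I.n top).cost := by
      rcases h6 with ⟨h, h'⟩ | ⟨h', h⟩
      · rw [h']
        simp
      · rw [h]
        exact h'
    refine ⟨⟨h2, hB.le, fun e he => ?_, fun e he he' => ?_, fun e he he' => ?_, ?_⟩, ?_⟩
    · rw [← hB.old e he]
      rcases hent with h | h
      · rw [h]
      · rw [h, Function.update_of_ne (by omega)]
    · rcases hent with h | h
      · rw [h]
        exact hB.sound e he he'
      · rw [h]
        by_cases heo : e = o
        · subst heo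
          obtain ⟨a1, ⟨c, a2, a3⟩, a4⟩ := hs
          rw [Function.update_self]
          -- The surviving entry takes over the origin of the new one; this is legitimate because
          -- both have the same count, facilities and labels on the bag.
          refine ⟨a1, ⟨c, a2, NiceTreeDecomposition.leads_congr a3 ?_⟩, a4⟩
          exact ⟨h5.symm.1, h5.symm.2⟩
        · rw [Function.update_of_ne heo]
          exact hB.sound e he he'
    · exact (hB.bounded e he he').of_same (hsame e).symm
    · intro e e' he1 he2 he1' he2' hee
      exact hB.inj e e' he1 he2 he1' he2' (((hsame e).symm.trans hee).trans (hsame e'))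
    · rintro c E₁ E₂ (⟨e, a1, a2, a3, a4⟩ | ⟨a3, a4⟩)
      · exact ⟨e, a1, a2, NiceTreeDecomposition.leads_congr a3 (hsame e).symm,
          (hcost e).trans a4⟩
      · exact ⟨o, h3, h4, NiceTreeDecomposition.leads_congr a3
          (h5.symm.trans (hsame o).symm), hcost'.trans a4⟩

end insert

end RealRAM

/-! ### Common framework for processing one node. -/

namespace RealRAM

/-- `P` changes neither the data of the current node nor the tables of entry ranges. -/
def Prog.keeps (P : CProg) : Bool :=
  !(P.wn vT || P.wn vS || P.wn vS₂ || P.wn vV || P.wn vV₂ || P.wn aFst || P.wn aLst || P.wn aMed)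

section nodes

variable {I : KMedianInstance} {G : SimpleGraph (Fin I.n)}

/-- The distance of a vertex to a facility. -/
noncomputable def medCost (I : KMedianInstance) (med : ℕ → ℕ) (v : Fin I.n) (j : ℕ) : ℝ :=
  I.distTable v (med j)

/-- The memory holds the data of the current node `t` and the tables of entry ranges. -/
structure Ready (D : NiceTreeDecomposition G) (t : Fin D.N) (F L med : ℕ → ℕ) (s : State) :
    Prop where
  node : s.nat vT 0 = t
  child₁ : s.nat vS 0 = (D.node t).child₁
  child₂ : s.nat vS₂ 0 = (D.node t).child₂
  vertex₁ : s.nat vV 0 = (D.node t).vertex₁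
  vertex₂ : s.nat vV₂ 0 = (D.node t).vertex₂
  fst : s.nat aFst = F
  lst : s.nat aLst = L
  med : s.nat aMed = med

/-- What is known about the entries of the children of `t` before `t` is processed. -/
structure Setting (D : NiceTreeDecomposition G) (t : Fin D.N) (W X : ℕ) (F L : ℕ → ℕ)
    (ent₀ : ℕ → Entry I.n) : Prop where
  card : ∀ q, (D.bag q).card ≤ W
  W_le : W ≤ X
  entries_le : (I.k * W) ^ W * (I.k + 1) ≤ X
  k_le : I.k ≤ X
  le : ∀ q, D.Child t q → F q ≤ L q
  le_first : ∀ q, D.Child t q → L q ≤ F t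
  few : ∀ q, D.Child t q → L q - F q ≤ X
  bounded : ∀ q, D.Child t q → ∀ e, F q ≤ e → e < L q → (ent₀ e).Bounded (D.bag q) I.k W

/-- The entries found so far for the node `t` cover the choices in `K`. -/
def Covers (D : NiceTreeDecomposition G) (t : Fin D.N) (W : ℕ) (F L med : ℕ → ℕ)
    (ent₀ : ℕ → Entry I.n) (K : ℕ × ℕ → ℕ → ℕ → Prop) (base : ℕ → ℕ) (ent : ℕ → Entry I.n)
    (top : ℕ) : Prop :=
  D.Building I.k W (medCost I med) ent₀ F L t (F t) base ent top ∧
    ∀ c e₁ e₂, K c e₁ e₂ → (D.node t).Feas (D.bag t) I.k c (ent₀ e₁) (ent₀ e₂) →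
      D.Covered (medCost I med) t (ent₀ e₁) (ent₀ e₂) c ent (F t) top

variable {D : NiceTreeDecomposition G} {t : Fin D.N} {W X : ℕ} {F L med : ℕ → ℕ}
  {ent₀ : ℕ → Entry I.n} {K K' : ℕ × ℕ → ℕ → ℕ → Prop} {s s' : State}

theorem Ready.frame {P : CProg} (h : Ready D t F L med s) (hF : Frame P s s')
    (hP : P.keeps = true) : Ready D t F L med s' := by
  simp only [Prog.keeps, Bool.not_eq_true', Bool.or_eq_false_iff] at hP
  obtain ⟨⟨⟨⟨⟨⟨⟨h1, h2⟩, h3⟩, h4⟩, h5⟩, h6⟩, h7⟩, h8⟩ := hP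
  exact ⟨by rw [hF.nat _ h1, h.node], by rw [hF.nat _ h2, h.child₁], by rw [hF.nat _ h3, h.child₂],
    by rw [hF.nat _ h4, h.vertex₁], by rw [hF.nat _ h5, h.vertex₂], by rw [hF.nat _ h6, h.fst],
    by rw [hF.nat _ h7, h.lst], by rw [hF.nat _ h8, h.med]⟩

theorem Covers.mono {base : ℕ → ℕ} {ent : ℕ → Entry I.n} {top : ℕ}
    (h : Covers D t W F L med ent₀ K base ent top)
    (hK : ∀ c e₁ e₂, K' c e₁ e₂ → (D.node t).Feas (D.bag t) I.k c (ent₀ e₁) (ent₀ e₂) →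
      K c e₁ e₂) : Covers D t W F L med ent₀ K' base ent top :=
  ⟨h.1, fun c e₁ e₂ h1 h2 => h.2 c e₁ e₂ (hK c e₁ e₂ h1 h2) h2⟩

/-- Inserting an entry that results from the choice `c`. -/
theorem insert_step (hS : Setting D t W X F L ent₀) (hR : Ready D t F L med s')
    (hc : Covers D t W F L med ent₀ K (s.nat aBase) (s.entry I.n) (s.nat vTop 0))
    (hbase : s'.nat aBase = s.nat aBase) (htop : s'.nat vTop 0 = s.nat vTop 0)
    (hent : ∀ e, e ≠ s.nat vTop 0 → s'.entry I.n e = s.entry I.n e)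
    {E : Entry I.n} (hE : s'.entry I.n (s.nat vTop 0) = E)
    (hin : D.InRange F L t E.p₁ E.p₂) (c : ℕ × ℕ)
    (hfeas : (D.node t).Feas (D.bag t) I.k c (ent₀ E.p₁) (ent₀ E.p₂))
    (hl : (D.node t).Leads (D.bag t) c (ent₀ E.p₁) (ent₀ E.p₂) E)
    (hcost : E.cost = (D.node t).newCost (medCost I med) (ent₀ E.p₁) (ent₀ E.p₂))
    (hb : E.Bounded (D.bag t) I.k W)
    (hK : ∀ c' e₁ e₂, K' c' e₁ e₂ → (D.node t).Feas (D.bag t) I.k c' (ent₀ e₁) (ent₀ e₂) →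
      K c' e₁ e₂ ∨ (((D.node t).Leads (D.bag t) c (ent₀ E.p₁) (ent₀ E.p₂) E →
        (D.node t).Leads (D.bag t) c' (ent₀ e₁) (ent₀ e₂) E) ∧
        (D.node t).newCost (medCost I med) (ent₀ E.p₁) (ent₀ E.p₂) =
          (D.node t).newCost (medCost I med) (ent₀ e₁) (ent₀ e₂))) :
    Runs (connectedInput I G D) X insertProg s' fun s'' =>
      Covers D t W F L med ent₀ K' (s''.nat aBase) (s''.entry I.n) (s''.nat vTop 0) := by
  generalize htop₀ : s.nat vTop 0 = top at *
  have hk : 0 < I.k := by have := I.two_le_k; omega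
  have hle := hc.1.le
  have hB : D.Building I.k W (medCost I med) ent₀ F L t (F t) (s'.nat aBase) (s'.entry I.n)
      (s'.nat vTop 0) := by
    rw [hbase, htop]
    obtain ⟨h1, h2, h3, h4, h5, h6⟩ := hc.1
    refine ⟨h1, h2, fun e he => ?_, fun e he he' => ?_, fun e he he' => ?_,
      fun e e' he1 he2 he1' he2' => ?_⟩
    · rw [hent e (by omega)]
      exact h3 e he
    · rw [hent e (by omega)]
      exact h4 e he he'
    · rw [hent e (by omega)]
      exact h5 e he he'
    · rw [hent e (by omega), hent e' (by omega)]
      exact h6 e e' he1 he2 he1' he2'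
  refine (insertProg_spec hR.node ((hS.card t).trans hS.W_le) hS.entries_le (hS.card t) hk
    (by rw [hR.fst]) hB ?_ ?_).mono ?_
  · rw [htop, hE]
    exact ⟨hin, ⟨c, hfeas, hl⟩, hcost⟩
  · rw [htop, hE]
    exact hb
  · rintro s'' ⟨h1, h2⟩
    refine ⟨h1, fun c' e₁ e₂ hc' hf => h2 _ _ _ ?_⟩
    rw [htop, hE]
    rcases hK c' e₁ e₂ hc' hf with h | ⟨h, h'⟩
    · obtain ⟨e, a1, a2, a3⟩ := hc.2 c' e₁ e₂ h hf
      refine Or.inl ⟨e, a1, a2, ?_⟩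
      rw [hent e (by omega)]
      exact a3
    · exact Or.inr ⟨h hl, by rw [hcost, h']⟩

/-- A loop over the entries of the first child. -/
theorem for_child₁ {P : CProg} {q : Fin D.N} {J : ℕ → State → Prop}
    (hS : Setting D t W X F L ent₀) (hR : Ready D t F L med s) (hq : D.Child t q)
    (hq' : (D.node t).child₁ = q) (hw : P.wn vE₁ = false)
    (hkeep : (Prog.for vE₁ (.read aFst (.var vS)) (.read aLst (.var vS)) P).keeps = true)
    (hJ : ∀ j s v, J j s → J j (s.setNat vE₁ 0 v)) (h0 : J (F q) s)
    (hstep : ∀ j s', F q ≤ j → j < L q → Ready D t F L med s' → J j s' → s'.nat vE₁ 0 = j →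
      Runs (connectedInput I G D) X P s' (J (j + 1))) :
    Runs (connectedInput I G D) X
      (Prog.for vE₁ (.read aFst (.var vS)) (.read aLst (.var vS)) P) s (J (L q)) := by
  refine Runs.for (F q) (L q) J hJ hw ?_ (hS.le q hq) (hS.few q hq) ?_ h0
    (fun j s' h1 h2 hF hJ hc => hstep j s' h1 h2 (hR.frame hF hkeep) hJ hc) (fun s' h _ => h)
  · simp only [NExp.eval, hR.fst, hR.child₁, hq']
  · intro j s' hF _
    have := hR.frame hF hkeep
    simp only [NExp.eval, this.lst, this.child₁, hq']

/-- The test whether a label occurs in an entry. -/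
theorem testBag_spec {a e : ℕ} {q : Fin D.N} {rhs : CExp} {b b₀ r : ℕ}
    (ha : s.nat a 0 = q) (hX : (D.bag q).card ≤ X) (he : s.nat vE₁ 0 = e)
    (hbe : s.nat aBase e = e * I.n)
    (hw : (forBag vC vU a (.cond (.eq (labExp (.var vE₁) (.var vU)) rhs)
      (.assign vFnd (.const b)) .skip)).wn a = false)
    (hr : ∀ s', Frame (forBag vC vU a (.cond (.eq (labExp (.var vE₁) (.var vU)) rhs)
      (.assign vFnd (.const b)) .skip)) s s' → rhs.eval (connectedInput I G D) s' = r)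
    (hb₀ : s.nat vFnd 0 = b₀) :
    Runs (connectedInput I G D) X (forBag vC vU a
      (.cond (.eq (labExp (.var vE₁) (.var vU)) rhs) (.assign vFnd (.const b)) .skip)) s
      fun s' => ((∃ u ∈ D.bag q, (s.entry I.n e).lab u = r) ∧ s'.nat vFnd 0 = b) ∨
        ((∀ u ∈ D.bag q, (s.entry I.n e).lab u ≠ r) ∧ s'.nat vFnd 0 = b₀) := by
  refine Runs.forBag q (fun A s' => ((∃ u ∈ A, (s.entry I.n e).lab u = r) ∧ s'.nat vFnd 0 = b) ∨
        ((∀ u ∈ A, (s.entry I.n e).lab u ≠ r) ∧ s'.nat vFnd 0 = b₀)) ha hX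
    (fun _ _ _ h => h) (fun _ _ _ h => h) hw rfl rfl (Or.inr ⟨by simp, hb₀⟩) ?_ fun s' h _ => h
  intro A v s' hv hvA hA hF hJ hu
  have hent : s'.entry I.n = s.entry I.n := hF.entry rfl rfl rfl rfl rfl rfl
  have he' : s'.nat vE₁ 0 = e := by rw [hF.nat vE₁ rfl, he]
  have hbe' : s'.nat aBase e = e * I.n := by rw [hF.nat aBase rfl, hbe]
  refine Runs.cond (fun h => ?_) (fun h => ?_) <;>
    rw [BExp.holds_eq, eval_labExp (eE := .var vE₁) (uE := .var vU) he' hu hbe', hent,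
      hr s' hF] at h
  · exact Runs.setNat (Or.inl ⟨⟨v, by simp, h⟩, by simp [State.setNat, NExp.eval]⟩)
  · refine Runs.skip ?_
    rcases hJ with ⟨⟨u, hu, hur⟩, h'⟩ | ⟨h1, h2⟩
    · exact Or.inl ⟨⟨u, Finset.mem_insert_of_mem hu, hur⟩, h'⟩
    · refine Or.inr ⟨fun u hu => ?_, h2⟩
      rcases Finset.mem_insert.1 hu with rfl | hu
      · exact h
      · exact h1 u hu

end nodes

end RealRAM

/-! ### The programs for the five types of nodes. -/

namespace RealRAM

section nodeTypes

variable {I : KMedianInstance} {G : SimpleGraph (Fin I.n)} {D : NiceTreeDecomposition G}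
  {t : Fin D.N} {W X : ℕ} {F L med : ℕ → ℕ} {ent₀ : ℕ → Entry I.n}
  {K : ℕ × ℕ → ℕ → ℕ → Prop} {s : State}

theorem Ready.setNat {a i v : ℕ} (h : Ready D t F L med s)
    (ha : (Prog.setNat a (.const 0) (.const 0) : CProg).keeps = true) :
    Ready D t F L med (s.setNat a i v) := by
  refine h.frame (P := .setNat a (.const i) (.const v)) ?_ ha
  exact (Exec.setNat (x := connectedInput I G D) a (.const i) (.const v) s).frame

theorem Ready.setReal {a i : ℕ} {v : ℝ} (h : Ready D t F L med s) :
    Ready D t F L med (s.setReal a i v) := h.frame (P := .setReal a (.const 0) (.ofNat (.const 0)))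
  ⟨fun _ _ => rfl, fun b hb => by
    have : b ≠ a := by
      rintro rfl
      simp [Prog.wr] at hb
    funext j
    simp [State.setReal, this]⟩ rfl

/-- `Covers` for the table stored in the memory. -/
abbrev CoversIn (D : NiceTreeDecomposition G) (t : Fin D.N) (W : ℕ) (F L med : ℕ → ℕ)
    (ent₀ : ℕ → Entry I.n) (K : ℕ × ℕ → ℕ → ℕ → Prop) (s : State) : Prop :=
  Covers D t W F L med ent₀ K (s.nat aBase) (s.entry I.n) (s.nat vTop 0)

/-- Every choice at a leaf leads to the same entry with count and cost `0`, so one insertion covers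
all of them. -/
theorem leafProg_spec (hS : Setting D t W X F L ent₀) (hR : Ready D t F L med s)
    (ht : D.node t = .leaf) (h : CoversIn D t W F L med ent₀ (fun _ _ _ => False) s) :
    Runs (connectedInput I G D) X leafProg s
      (CoversIn D t W F L med ent₀ fun _ => D.InRange F L t) := by
  refine Runs.setNat_seq (Runs.setReal_seq ?_)
  simp only [NExp.eval, RExp.eval, State.setNat_nat, Nat.reduceEqDiff, false_and, if_false]
  refine insert_step hS ((hR.setNat rfl).setReal) h rfl rfl ?_ rfl ?_ (0, 0) ?_ ?_ ?_ ?_ ?_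
  · intro e he
    rw [entry_setCost, entry_setCnt]
    simp [he]
  · simp [NiceTreeDecomposition.InRange, ht, NodeType.tag]
  · simp [ht, NodeType.Feas]
  · rw [ht, entry_setCost, entry_setCnt]
    simp [NodeType.Leads]
  · rw [entry_setCost, entry_setCnt]
    simp [ht, NodeType.newCost]
  · have hbag : D.bag t = ∅ := (NiceTreeDecomposition.valid_of_node ht).2
    rw [entry_setCost, entry_setCnt]
    simp [Entry.Bounded, hbag]
  · intro c' e₁ e₂ _ _
    right
    rw [ht]
    exact ⟨fun h => h, rfl⟩

/-- The three nested loops enumerate child entry, facility and label. The choices covered so far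
form an initial segment of the lexicographic order on these triples, which is the relation passed to
`CoversIn` at each level. -/
theorem introVertexProg_spec (hS : Setting D t W X F L ent₀) (hR : Ready D t F L med s)
    {v : Fin I.n} {q : Fin D.N}
    (ht : D.node t = .introVertex v q) (h : CoversIn D t W F L med ent₀ (fun _ _ _ => False) s) :
    Runs (connectedInput I G D) X introVertexProg s
      (CoversIn D t W F L med ent₀ fun _ => D.InRange F L t) := by
  obtain ⟨-, hvq, hbag⟩ := NiceTreeDecomposition.valid_of_node ht
  have hch : D.Child t q := NiceTreeDecomposition.child_of_node ht rfl
  have hq' : (D.node t).child₁ = q := by rw [ht]; rfl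
  have hv₁ : (D.node t).vertex₁ = v := by rw [ht]; rfl
  have hmem : ∀ u ∈ D.bag t, u ≠ v → u ∈ D.bag q := by
    intro u hu huv
    simpa [hbag, huv] using hu
  have hfeas : ∀ c E₁ E₂, (D.node t).Feas (D.bag t) I.k c E₁ E₂ ↔
      c.1 < I.k ∧ c.2 < (D.bag t).card ∧ ∀ u ∈ D.bag t, u ≠ v → E₁.lab u ≠ c.2 := by
    intro c E₁ E₂
    rw [ht]
    rfl
  refine (for_child₁ (J := fun j s' => CoversIn D t W F L med ent₀
    (fun _ e₁ _ => F q ≤ e₁ ∧ e₁ < j) s') hS hR hch hq' rfl rfl (fun _ _ _ h => h)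
    (h.mono fun c e₁ e₂ h _ => by omega) ?_).mono ?_
  swap
  · intro s' h'
    refine h'.mono fun c e₁ e₂ h1 _ => ?_
    have := h1.1 (by simp [ht, NodeType.tag])
    rwa [hq'] at this
  intro j₁ s₁ hj₁ hj₁' hR₁ hC₁ hc₁
  refine Runs.for 0 I.k (fun j s' => CoversIn D t W F L med ent₀
    (fun c e₁ _ => F q ≤ e₁ ∧ (e₁ < j₁ ∨ e₁ = j₁ ∧ c.1 < j)) s') (fun _ _ _ h => h) rfl rfl
    (Nat.zero_le _) hS.k_le (fun _ _ _ _ => rfl) (hC₁.mono fun c e₁ e₂ h _ => by omega) ?_ ?_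
  swap
  · intro s' h' _
    refine h'.mono fun c e₁ e₂ h1 h2 => ?_
    have := ((hfeas _ _ _).1 h2).1
    omega
  intro j₂ s₂ _ hj₂ hF₂ hC₂ hc₂
  have hR₂ := hR₁.frame hF₂ rfl
  have hc₁' : s₂.nat vE₁ 0 = j₁ := by rw [hF₂.nat vE₁ rfl, hc₁]
  refine Runs.for 0 (D.bag t).card (fun j s' => CoversIn D t W F L med ent₀
    (fun c e₁ _ => F q ≤ e₁ ∧ (e₁ < j₁ ∨ e₁ = j₁ ∧ (c.1 < j₂ ∨ c.1 = j₂ ∧ c.2 < j))) s')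
    (fun _ _ _ h => h) rfl rfl
    (Nat.zero_le _) ((hS.card t).trans hS.W_le) ?_ (hC₂.mono fun c e₁ e₂ h _ => by omega) ?_ ?_
  · intro j s' hF _
    simp only [NExp.eval, (hR₂.frame hF rfl).node, input_bagSize]
  swap
  · intro s' h' _
    refine h'.mono fun c e₁ e₂ h1 h2 => ?_
    have := ((hfeas _ _ _).1 h2).2.1
    omega
  intro j₃ s₃ _ hj₃ hF₃ hC₃ hc₃
  have hR₃ := hR₂.frame hF₃ rfl
  have he₃ : s₃.nat vE₁ 0 = j₁ := by rw [hF₃.nat vE₁ rfl, hc₁']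
  have hJ₃ : s₃.nat vJ 0 = j₂ := by rw [hF₃.nat vJ rfl, hc₂]
  have hjt : j₁ < F t := hj₁'.trans_le (hS.le_first q hch)
  have hle : F t ≤ s₃.nat vTop 0 := hC₃.1.le
  have hbase : ∀ e ≤ s₃.nat vTop 0, s₃.nat aBase e = e * I.n := hC₃.1.base
  have hold : s₃.entry I.n j₁ = ent₀ j₁ := hC₃.1.old j₁ hjt
  refine Runs.setNat_seq ?_
  refine Runs.seq' (testBag_spec (q := q) (e := j₁) (r := j₃) (b₀ := 0)
    (hR₃.child₁.trans hq') ((hS.card q).trans hS.W_le) he₃ (hbase j₁ (by omega)) rfl ?_ rfl) ?_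
  · intro s' hF
    exact (congrFun (hF.nat vL rfl) 0).trans hc₃
  intro s₄ h₄ hF₄
  have hR₄ : Ready D t F L med s₄ := (hR₃.setNat rfl).frame hF₄ rfl
  have hent₄ : s₄.entry I.n = s₃.entry I.n := hF₄.entry rfl rfl rfl rfl rfl rfl
  have hbase₄ : s₄.nat aBase = s₃.nat aBase := hF₄.nat aBase rfl
  have htop₄ : s₄.nat vTop 0 = s₃.nat vTop 0 := congrFun (hF₄.nat vTop rfl) 0
  have hlab : ((∃ u ∈ D.bag q, (ent₀ j₁).lab u = j₃) ∧ s₄.nat vFnd 0 = 1) ∨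
      ((∀ u ∈ D.bag q, (ent₀ j₁).lab u ≠ j₃) ∧ s₄.nat vFnd 0 = 0) := by
    rw [← hold]
    exact h₄
  refine Runs.cond (fun hb => ?_) (fun hb => ?_) <;> simp only [BExp.Holds, NExp.eval] at hb
  · replace hlab := (hlab.resolve_left fun h => by omega).1
    refine Runs.seq' (copyProg_spec (t := q) (e := j₁) (top := s₃.nat vTop 0)
      (hR₄.child₁.trans hq') ((hS.card q).trans hS.W_le) rfl htop₄ ?_ ?_ ?_ (by omega)) ?_
    · rw [hF₄.nat vE₁ rfl]
      exact he₃
    · rw [hbase₄, hbase _ le_rfl]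
    · rw [hbase₄, hbase _ (by omega)]
    rintro s₅ ⟨h1, h2, h3, h4, h5⟩ hF₅
    have hR₅ := hR₄.frame hF₅ rfl
    have hbase₅ : s₅.nat aBase = s₃.nat aBase := (hF₅.nat aBase rfl).trans hbase₄
    have htop₅ : s₅.nat vTop 0 = s₃.nat vTop 0 := (congrFun (hF₅.nat vTop rfl) 0).trans htop₄
    have hv₅ : s₅.nat vV 0 = v := hR₅.vertex₁.trans hv₁
    have hJ₅ : s₅.nat vJ 0 = j₂ := by
      rw [hF₅.nat vJ rfl, hF₄.nat vJ rfl]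
      exact hJ₃
    have hL₅ : s₅.nat vL 0 = j₃ := by
      rw [hF₅.nat vL rfl, hF₄.nat vL rfl]
      exact hc₃
    have hb₅ : s₅.nat aBase (s₃.nat vTop 0) = s₃.nat vTop 0 * I.n := by
      rw [hbase₅, hbase _ le_rfl]
    rw [hent₄, hold] at h2 h3 h4
    rw [hent₄] at h1
    refine Runs.seq (Runs.setFac (u := v) htop₅ hv₅ hb₅ hJ₅ ?_)
    refine Runs.seq (Runs.setLab (u := v) htop₅ hv₅ hb₅ hL₅ ?_)
    have hent : ∀ E, s₅.entry I.n (s₃.nat vTop 0) = E →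
        ((s₅.setNat aFac (s₃.nat vTop 0 * I.n + v) j₂).setNat aLab
          (s₃.nat vTop 0 * I.n + v) j₃).entry I.n = Function.update (s₅.entry I.n) (s₃.nat vTop 0)
          { E with fac := Function.update E.fac v j₂, lab := Function.update E.lab v j₃ } := by
      rintro E rfl
      rw [entry_setLab, entry_setFac]
      simp
    generalize s₅.entry I.n (s₃.nat vTop 0) = E at h2 h3 h4 h5 hent
    specialize hent E rfl
    refine insert_step (K := fun c e₁ _ => F q ≤ e₁ ∧
        (e₁ < j₁ ∨ e₁ = j₁ ∧ (c.1 < j₂ ∨ c.1 = j₂ ∧ c.2 < j₃)))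
      (E := { E with fac := Function.update E.fac v j₂, lab := Function.update E.lab v j₃ })
      hS ((hR₅.setNat rfl).setNat rfl) hC₃ hbase₅ htop₅ ?_ ?_ ?_ (j₂, j₃) ?_ ?_ ?_ ?_ ?_
    · intro e he
      rw [hent, Function.update_of_ne he, h1 e he]
    · rw [hent, Function.update_self]
    · refine ⟨fun _ => ?_, fun h => ?_⟩
      · rw [hq']
        simp only [h5]
        exact ⟨hj₁, hj₁'⟩
      · simp [ht, NodeType.tag] at h
    · rw [hfeas]
      simp only [h5]
      exact ⟨hj₂, hj₃, fun u hu huv => hlab u (hmem u hu huv)⟩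
    · rw [ht]
      simp only [NodeType.Leads, h5, h3]
      refine ⟨trivial, by simp, by simp, fun u hu huv => ?_⟩
      simp [huv, h2 u (hmem u hu huv)]
    · rw [ht]
      simp only [NodeType.newCost, h5, h4]
    · have hb' := hS.bounded q hch j₁ hj₁ hj₁'
      refine ⟨h3 ▸ hb'.1, fun u hu => ?_⟩
      by_cases huv : u = v
      · subst huv
        simp only [Function.update_self]
        exact ⟨hj₂, hj₃.trans_le (hS.card t)⟩
      · simp only [Function.update_of_ne huv, h2 u (hmem u hu huv)]
        exact hb'.2 u (hmem u hu huv)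
    · rintro ⟨c₁, c₂⟩ e₁ e₂ ⟨a1, a2⟩ -
      by_cases hcur : e₁ = j₁ ∧ c₁ = j₂ ∧ c₂ = j₃
      · obtain ⟨rfl, rfl, rfl⟩ := hcur
        right
        rw [ht]
        simp only [h5]
        exact ⟨fun h => h, rfl⟩
      · left
        dsimp only at a2 ⊢
        omega
  -- A label used by another bag vertex is not feasible, so skipping it loses no choice.
  · replace hlab := (hlab.resolve_right fun h => by omega).1
    refine Runs.skip ?_
    change Covers D t W F L med ent₀ _ (s₄.nat aBase) (s₄.entry I.n) (s₄.nat vTop 0)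
    rw [hbase₄, hent₄, htop₄]
    refine hC₃.mono fun c e₁ e₂ h1 h2 => ?_
    obtain ⟨u, hu, hur⟩ := hlab
    by_cases hcur : e₁ = j₁ ∧ c.1 = j₂ ∧ c.2 = j₃
    · exfalso
      have huv : u ≠ v := fun h => hvq (h ▸ hu)
      refine ((hfeas _ _ _).1 h2).2.2 u (by simp [hbag, hu]) huv ?_
      rw [hcur.1, hur, hcur.2.2]
    · omega

/-- Each child entry is inserted unchanged, and once more with merged labels if the facilities of
both ends agree. The intermediate relation covers for the current entry all choices with first
component different from `1`. -/
theorem introEdgeProg_spec (hS : Setting D t W X F L ent₀) (hR : Ready D t F L med s)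
    {u v : Fin I.n} {q : Fin D.N}
    (ht : D.node t = .introEdge u v q) (h : CoversIn D t W F L med ent₀ (fun _ _ _ => False) s) :
    Runs (connectedInput I G D) X introEdgeProg s
      (CoversIn D t W F L med ent₀ fun _ => D.InRange F L t) := by
  obtain ⟨-, -, hbag, hu, hv⟩ := NiceTreeDecomposition.valid_of_node ht
  have hch : D.Child t q := NiceTreeDecomposition.child_of_node ht rfl
  have hq' : (D.node t).child₁ = q := by rw [ht]; rfl
  have hv₁ : (D.node t).vertex₁ = u := by rw [ht]; rfl
  have hv₂ : (D.node t).vertex₂ = v := by rw [ht]; rfl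
  have hX := (hS.card t).trans hS.W_le
  have hfeas : ∀ c E₁ E₂, (D.node t).Feas (D.bag t) I.k c E₁ E₂ ↔
      (c.1 = 0 ∨ c.1 = 1 ∧ E₁.fac u = E₁.fac v) := by
    intro c E₁ E₂
    rw [ht]
    rfl
  refine (for_child₁ (J := fun j s' => CoversIn D t W F L med ent₀
    (fun _ e₁ _ => F q ≤ e₁ ∧ e₁ < j) s') hS hR hch hq' rfl rfl (fun _ _ _ h => h)
    (h.mono fun c e₁ e₂ h _ => by omega) ?_).mono ?_
  swap
  · intro s' h'
    refine h'.mono fun c e₁ e₂ h1 _ => ?_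
    have := h1.1 (by simp [ht, NodeType.tag])
    rwa [hq'] at this
  intro j s₁ hj hj' hR₁ hC₁ hc₁
  have hjt : j < F t := hj'.trans_le (hS.le_first q hch)
  have hb' := hS.bounded q hch j hj hj'
  rw [← hbag] at hb'
  have hin : ∀ p₂, D.InRange F L t j p₂ := by
    refine fun p₂ => ⟨fun _ => ?_, fun h => ?_⟩
    · rw [hq']
      exact ⟨hj, hj'⟩
    · simp [ht, NodeType.tag] at h
  have hle₁ : F t ≤ s₁.nat vTop 0 := hC₁.1.le
  have hbase₁ : ∀ e ≤ s₁.nat vTop 0, s₁.nat aBase e = e * I.n := hC₁.1.base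
  have hold₁ : s₁.entry I.n j = ent₀ j := hC₁.1.old j hjt
  refine Runs.seq' (copyProg_spec (t := t) (e := j) (top := s₁.nat vTop 0)
    hR₁.node hX rfl rfl hc₁ (hbase₁ _ le_rfl) (hbase₁ _ (by omega)) (by omega)) ?_
  rintro s₂ ⟨h1, h2, h3, h4, h5⟩ hF₂
  rw [hold₁] at h2 h3 h4
  refine Runs.seq' (R₁ := CoversIn D t W F L med ent₀
    (fun c e₁ _ => F q ≤ e₁ ∧ (e₁ < j ∨ e₁ = j ∧ c.1 ≠ 1)))
    (insert_step hS (hR₁.frame hF₂ rfl) hC₁ (hF₂.nat aBase rfl)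
      (congrFun (hF₂.nat vTop rfl) 0) h1 rfl ?_ (0, 0) ?_ ?_ ?_ ?_ ?_) ?_
  · rw [h5]
    exact hin _
  · rw [hfeas]
    exact Or.inl rfl
  · rw [ht]
    simp only [NodeType.Leads, h5, h3]
    refine ⟨trivial, fun x hx => ?_⟩
    simp [h2 x hx]
  · rw [ht]
    simp only [NodeType.newCost, h5, h4]
  · refine ⟨h3 ▸ hb'.1, fun x hx => ?_⟩
    rw [(h2 x hx).1, (h2 x hx).2]
    exact hb'.2 x hx
  · rintro ⟨c₁, c₂⟩ e₁ e₂ ⟨a1, a2 | ⟨rfl, a2⟩⟩ -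
    · exact Or.inl ⟨a1, a2⟩
    · right
      rw [ht]
      simp only [h5, NodeType.Leads, a2, false_and, if_false]
      simp [NodeType.newCost]
  intro s₃ hC₃ hF₃
  have hR₃ := (hR₁.frame hF₂ rfl).frame hF₃ rfl
  have he₃ : s₃.nat vE₁ 0 = j := by rw [hF₃.nat vE₁ rfl, hF₂.nat vE₁ rfl, hc₁]
  have hu₃ : s₃.nat vV 0 = u := hR₃.vertex₁.trans hv₁
  have hv₃ : s₃.nat vV₂ 0 = v := hR₃.vertex₂.trans hv₂
  have hle₃ : F t ≤ s₃.nat vTop 0 := hC₃.1.le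
  have hbase₃ : ∀ e ≤ s₃.nat vTop 0, s₃.nat aBase e = e * I.n := hC₃.1.base
  have hold₃ : s₃.entry I.n j = ent₀ j := hC₃.1.old j hjt
  have hbj : s₃.nat aBase j = j * I.n := hbase₃ j (by omega)
  refine Runs.cond (fun hb => ?_) (fun hb => ?_) <;>
    rw [BExp.holds_eq, eval_facExp (eE := .var vE₁) (uE := .var vV) he₃ hu₃ hbj,
      eval_facExp (eE := .var vE₁) (uE := .var vV₂) he₃ hv₃ hbj, hold₃] at hb
  · refine Runs.seq' (copyProg_spec (t := t) (e := j) (top := s₃.nat vTop 0)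
      hR₃.node hX rfl rfl he₃ (hbase₃ _ le_rfl) hbj (by omega)) ?_
    rintro s₄ ⟨g1, g2, g3, g4, g5⟩ hF₄
    rw [hold₃] at g2 g3 g4
    have hR₄ := hR₃.frame hF₄ rfl
    have htop₄ : s₄.nat vTop 0 = s₃.nat vTop 0 := congrFun (hF₄.nat vTop rfl) 0
    have hbase₄ : s₄.nat aBase = s₃.nat aBase := hF₄.nat aBase rfl
    have he₄ : s₄.nat vE₁ 0 = j := by rw [hF₄.nat vE₁ rfl, he₃]
    have hu₄ : s₄.nat vV 0 = u := hR₄.vertex₁.trans hv₁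
    have hv₄ : s₄.nat vV₂ 0 = v := hR₄.vertex₂.trans hv₂
    have hbj₄ : s₄.nat aBase j = j * I.n := by rw [hbase₄, hbj]
    have hold₄ : s₄.entry I.n j = ent₀ j := by rw [g1 j (by omega), hold₃]
    refine Runs.setNat_seq (Runs.setNat_seq ?_)
    rw [eval_labExp (eE := .var vE₁) (uE := .var vV) he₄ hu₄ hbj₄, hold₄]
    have e2 : (labExp (.var vE₁) (.var vV₂)).eval (connectedInput I G D)
        (s₄.setNat vA ((NExp.const 0).eval (connectedInput I G D) s₄) ((ent₀ j).lab u)) =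
        (ent₀ j).lab v := by
      have := eval_labExp (x := connectedInput I G D) (eE := .var vE₁) (uE := .var vV₂)
        he₄ hv₄ hbj₄
      rw [hold₄] at this
      exact this
    rw [e2]
    have hR₄' := (hR₄.setNat (a := vA) (i := 0) (v := (ent₀ j).lab u) rfl).setNat (a := vB) (i := 0)
      (v := (ent₀ j).lab v) rfl
    refine Runs.seq' (mergeProg_spec (t := t) (top := s₃.nat vTop 0) (a := (ent₀ j).lab u)
      (b := (ent₀ j).lab v) hR₄'.node hX htop₄ ?_ rfl rfl) ?_
    · exact (congrFun hbase₄ _).trans (hbase₃ _ le_rfl)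
    rintro s₅ ⟨l, hl1, hl2⟩ hF₅
    change s₅.entry I.n = Function.update (s₄.entry I.n) (s₃.nat vTop 0)
      { s₄.entry I.n (s₃.nat vTop 0) with lab := l } at hl1
    change ∀ x ∈ D.bag t, l x = if (s₄.entry I.n (s₃.nat vTop 0)).lab x = (ent₀ j).lab u then
      (ent₀ j).lab v else (s₄.entry I.n (s₃.nat vTop 0)).lab x at hl2
    have hl3 : ∀ x ∈ D.bag t, l x = if (ent₀ j).lab x = (ent₀ j).lab u then
        (ent₀ j).lab v else (ent₀ j).lab x := by
      intro x hx
      rw [hl2 x hx, (g2 x hx).2]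
    have hbase₅ : s₅.nat aBase = s₃.nat aBase := (hF₅.nat aBase rfl).trans hbase₄
    have htop₅ : s₅.nat vTop 0 = s₃.nat vTop 0 := (congrFun (hF₅.nat vTop rfl) 0).trans htop₄
    generalize s₄.entry I.n (s₃.nat vTop 0) = E at g2 g3 g4 g5 hl1
    refine insert_step (E := { E with lab := l }) hS (hR₄'.frame hF₅ rfl) hC₃ hbase₅ htop₅
      ?_ ?_ ?_ (1, 0) ?_ ?_ ?_ ?_ ?_
    · intro e he
      rw [hl1, Function.update_of_ne he, g1 e he]
    · rw [hl1, Function.update_self]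
    · simp only [g5]
      exact hin _
    · rw [hfeas]
      simp only [g5]
      exact Or.inr ⟨trivial, hb⟩
    · rw [ht]
      simp only [NodeType.Leads, g5, g3, true_and]
      exact fun x hx => ⟨(g2 x hx).1, hl3 x hx⟩
    · rw [ht]
      simp only [NodeType.newCost, g5, g4]
    · refine ⟨g3 ▸ hb'.1, fun x hx => ?_⟩
      simp only [(g2 x hx).1, hl3 x hx]
      refine ⟨(hb'.2 x hx).1, ?_⟩
      split_ifs
      · exact (hb'.2 v hv).2
      · exact (hb'.2 x hx).2
    · rintro ⟨c₁, c₂⟩ e₁ e₂ ⟨a1, a2⟩ -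
      by_cases hcur : e₁ = j ∧ c₁ = 1
      · obtain ⟨rfl, rfl⟩ := hcur
        right
        rw [ht]
        simp only [g5]
        exact ⟨fun h => h, rfl⟩
      · left
        dsimp only
        omega
  · refine Runs.skip (hC₃.mono fun c e₁ e₂ a1 a2 => ⟨a1.1, ?_⟩)
    by_cases hcur : e₁ = j
    · refine Or.inr ⟨hcur, fun hc => ?_⟩
      rw [hcur] at a2
      rcases (hfeas _ _ _).1 a2 with h3 | h3
      · omega
      · exact hb h3.2
    · omega

/-- Only the cost and the count change. The forgotten vertex pays its distance to its facility, and
the test over the remaining bag yields `Entry.alone`. Entries whose count would exceed `k` are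
dropped as infeasible. -/
theorem forgetProg_spec (hS : Setting D t W X F L ent₀) (hR : Ready D t F L med s)
    {v : Fin I.n} {q : Fin D.N}
    (ht : D.node t = .forget v q) (h : CoversIn D t W F L med ent₀ (fun _ _ _ => False) s) :
    Runs (connectedInput I G D) X forgetProg s
      (CoversIn D t W F L med ent₀ fun _ => D.InRange F L t) := by
  obtain ⟨-, hvq, hbag⟩ := NiceTreeDecomposition.valid_of_node ht
  have hch : D.Child t q := NiceTreeDecomposition.child_of_node ht rfl
  have hq' : (D.node t).child₁ = q := by rw [ht]; rfl
  have hv₁ : (D.node t).vertex₁ = v := by rw [ht]; rfl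
  have hX := (hS.card t).trans hS.W_le
  have hsub : ∀ u ∈ D.bag t, u ∈ D.bag q := fun u hu => by
    rw [hbag] at hu
    exact Finset.mem_of_mem_erase hu
  have hfeas : ∀ c E₁ E₂, (D.node t).Feas (D.bag t) I.k c E₁ E₂ ↔
      E₁.cnt + E₁.alone (D.bag t) v ≤ I.k := by
    intro c E₁ E₂
    rw [ht]
    rfl
  refine (for_child₁ (J := fun j s' => CoversIn D t W F L med ent₀
    (fun _ e₁ _ => F q ≤ e₁ ∧ e₁ < j) s') hS hR hch hq' rfl rfl (fun _ _ _ h => h)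
    (h.mono fun c e₁ e₂ h _ => by omega) ?_).mono ?_
  swap
  · intro s' h'
    refine h'.mono fun c e₁ e₂ h1 _ => ?_
    have := h1.1 (by simp [ht, NodeType.tag])
    rwa [hq'] at this
  intro j s₁ hj hj' hR₁ hC₁ hc₁
  have hjt : j < F t := hj'.trans_le (hS.le_first q hch)
  have hb' := hS.bounded q hch j hj hj'
  have hle : F t ≤ s₁.nat vTop 0 := hC₁.1.le
  have hbase : ∀ e ≤ s₁.nat vTop 0, s₁.nat aBase e = e * I.n := hC₁.1.base
  have hold : s₁.entry I.n j = ent₀ j := hC₁.1.old j hjt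
  have hbj : s₁.nat aBase j = j * I.n := hbase j (by omega)
  refine Runs.setNat_seq ?_
  refine Runs.seq' (testBag_spec (q := t) (e := j) (r := (ent₀ j).lab v) (b₀ := 1)
    hR₁.node hX hc₁ hbj rfl ?_ rfl) ?_
  · intro s' hF
    have hR' : Ready D t F L med s' := (hR₁.setNat rfl).frame hF rfl
    rw [eval_labExp (eE := .var vE₁) (uE := .var vV) (e := j) (u := v) (n := I.n)]
    · rw [← hold]
      exact congrArg (fun E : ℕ → Entry I.n => (E j).lab v)
        (hF.entry (n := I.n) rfl rfl rfl rfl rfl rfl)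
    · exact (congrFun (hF.nat vE₁ rfl) 0).trans hc₁
    · exact hR'.vertex₁.trans hv₁
    · exact (congrFun (hF.nat aBase rfl) j).trans hbj
  intro s₂ h₂ hF₂
  have hR₂ : Ready D t F L med s₂ := (hR₁.setNat rfl).frame hF₂ rfl
  have hent₂ : s₂.entry I.n = s₁.entry I.n := hF₂.entry rfl rfl rfl rfl rfl rfl
  have hbase₂ : s₂.nat aBase = s₁.nat aBase := hF₂.nat aBase rfl
  have htop₂ : s₂.nat vTop 0 = s₁.nat vTop 0 := congrFun (hF₂.nat vTop rfl) 0
  have he₂ : s₂.nat vE₁ 0 = j := (congrFun (hF₂.nat vE₁ rfl) 0).trans hc₁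
  have halone : s₂.nat vFnd 0 = (ent₀ j).alone (D.bag t) v := by
    have h₂' : ((∃ u ∈ D.bag t, (ent₀ j).lab u = (ent₀ j).lab v) ∧ s₂.nat vFnd 0 = 0) ∨
        ((∀ u ∈ D.bag t, (ent₀ j).lab u ≠ (ent₀ j).lab v) ∧ s₂.nat vFnd 0 = 1) := by
      rw [← hold]
      rw [← hold] at h₂
      exact h₂
    rw [Entry.alone]
    rcases h₂' with ⟨h, h'⟩ | ⟨h, h'⟩
    · rw [if_pos h, h']
    · rw [if_neg (by simpa using h), h']
  have hcnt₂ : s₂.nat aCnt j = (ent₀ j).cnt := by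
    rw [← hold, ← hent₂]
    rfl
  refine Runs.cond (fun hb => ?_) (fun hb => ?_) <;>
    simp only [BExp.Holds, NExp.eval, he₂, hcnt₂, halone] at hb
  · refine Runs.seq' (copyProg_spec (t := t) (e := j) (top := s₁.nat vTop 0)
      hR₂.node hX rfl htop₂ he₂ ?_ ?_ (by omega)) ?_
    · rw [hbase₂, hbase _ le_rfl]
    · rw [hbase₂, hbj]
    rintro s₃ ⟨h1, h2, h3, h4, h5⟩ hF₃
    rw [hent₂, hold] at h2 h3 h4
    rw [hent₂] at h1
    have hR₃ := hR₂.frame hF₃ rfl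
    have hbase₃ : s₃.nat aBase = s₁.nat aBase := (hF₃.nat aBase rfl).trans hbase₂
    have htop₃ : s₃.nat vTop 0 = s₁.nat vTop 0 := (congrFun (hF₃.nat vTop rfl) 0).trans htop₂
    have he₃ : s₃.nat vE₁ 0 = j := by rw [hF₃.nat vE₁ rfl, he₂]
    have hold₃ : s₃.entry I.n j = ent₀ j := by rw [h1 j (by omega), hold]
    have hv₃ : s₃.nat vV 0 = v := hR₃.vertex₁.trans hv₁
    have hcnt₃ : s₃.nat aCnt j + s₃.nat vFnd 0 = (ent₀ j).cnt + (ent₀ j).alone (D.bag t) v := by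
      rw [hF₃.nat vFnd rfl, halone, ← hold₃]
      rfl
    have hcost₃ : s₃.real 0 j = (ent₀ j).cost := by
      rw [← hold₃]
      rfl
    have hmed₃ : (connectedInput I G D).real v
        (s₃.nat aMed ((facExp (.var vE₁) (.var vV)).eval (connectedInput I G D) s₃)) =
        medCost I med v ((ent₀ j).fac v) := by
      rw [hR₃.med, eval_facExp (eE := .var vE₁) (uE := .var vV) he₃ hv₃
        ((congrFun hbase₃ j).trans hbj), hold₃]
      rfl
    refine Runs.setNat_seq (Runs.setReal_seq ?_)
    have e1 : (NExp.plus (.read aCnt (.var vE₁)) (.var vFnd)).eval (connectedInput I G D) s₃ =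
        (ent₀ j).cnt + (ent₀ j).alone (D.bag t) v := by
      simp only [NExp.eval, he₃]
      exact hcnt₃
    have e2 : ∀ i, (RExp.plus (.read 0 (.var vE₁))
        (.input (.var vV) (.read aMed (facExp (.var vE₁) (.var vV))))).eval
          (connectedInput I G D) (s₃.setNat aCnt i
            ((ent₀ j).cnt + (ent₀ j).alone (D.bag t) v)) =
        (ent₀ j).cost + medCost I med v ((ent₀ j).fac v) := by
      intro i
      rw [← hmed₃, ← hcost₃, ← hv₃, ← he₃]
      rfl
    have e3 : (NExp.var vTop : CExp).eval (connectedInput I G D) s₃ = s₁.nat vTop 0 := htop₃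
    have e4 : ∀ i m, (NExp.var vTop : CExp).eval (connectedInput I G D) (s₃.setNat aCnt i m) =
        s₁.nat vTop 0 := fun _ _ => htop₃
    rw [e1, e2, e3, e4]
    have hent : ∀ E, s₃.entry I.n (s₁.nat vTop 0) = E →
        ((s₃.setNat aCnt (s₁.nat vTop 0) ((ent₀ j).cnt + (ent₀ j).alone (D.bag t) v)).setReal 0
          (s₁.nat vTop 0) ((ent₀ j).cost + medCost I med v ((ent₀ j).fac v))).entry I.n =
        Function.update (s₃.entry I.n) (s₁.nat vTop 0)
          { E with cnt := (ent₀ j).cnt + (ent₀ j).alone (D.bag t) v,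
                   cost := (ent₀ j).cost + medCost I med v ((ent₀ j).fac v) } := by
      rintro E rfl
      rw [entry_setCost, entry_setCnt]
      simp
    generalize s₃.entry I.n (s₁.nat vTop 0) = E at h2 h3 h4 h5 hent
    specialize hent E rfl
    refine insert_step hS ((hR₃.setNat rfl).setReal) hC₁ hbase₃ htop₃
      (E := { E with cnt := (ent₀ j).cnt + (ent₀ j).alone (D.bag t) v,
                     cost := (ent₀ j).cost + medCost I med v ((ent₀ j).fac v) })
      ?_ ?_ ?_ (0, 0) ?_ ?_ ?_ ?_ ?_
    · intro e he
      rw [hent, Function.update_of_ne he, h1 e he]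
    · rw [hent, Function.update_self]
    · simp only [h5]
      refine ⟨fun _ => ?_, fun h => ?_⟩
      · rw [hq']
        exact ⟨hj, hj'⟩
      · simp [ht, NodeType.tag] at h
    · rw [hfeas]
      simp only [h5]
      exact hb
    · rw [ht]
      simp only [NodeType.Leads, h5, true_and]
      exact h2
    · rw [ht]
      simp only [NodeType.newCost, h5]
    · refine ⟨hb, fun x hx => ?_⟩
      simp only [h2 x hx]
      exact hb'.2 x (hsub x hx)
    · rintro c' e₁ e₂ ⟨a1, a2⟩ -
      rcases Nat.lt_succ_iff_lt_or_eq.1 a2 with a2 | rfl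
      · exact Or.inl ⟨a1, a2⟩
      · right
        rw [ht]
        simp only [h5]
        exact ⟨fun h => h, rfl⟩
  · refine Runs.skip ?_
    change Covers D t W F L med ent₀ _ (s₂.nat aBase) (s₂.entry I.n) (s₂.nat vTop 0)
    rw [hbase₂, hent₂, htop₂]
    refine hC₁.mono fun c e₁ e₂ h1 h2 => ⟨h1.1, ?_⟩
    rcases Nat.lt_succ_iff_lt_or_eq.1 h1.2 with h3 | rfl
    · exact h3
    · exact absurd ((hfeas _ _ _).1 h2) hb

/-- Pairs of child entries are enumerated lexicographically. A pair with different facilities or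
with too large a total count is infeasible; otherwise the labels of the second entry are merged into
a copy of the first. -/
theorem joinProg_spec (hS : Setting D t W X F L ent₀) (hR : Ready D t F L med s)
    {q q₂ : Fin D.N}
    (ht : D.node t = .join q q₂) (h : CoversIn D t W F L med ent₀ (fun _ _ _ => False) s) :
    Runs (connectedInput I G D) X joinProg s
      (CoversIn D t W F L med ent₀ fun _ => D.InRange F L t) := by
  obtain ⟨-, -, hbag₁, hbag₂⟩ := NiceTreeDecomposition.valid_of_node ht
  have hch : D.Child t q := NiceTreeDecomposition.child_of_node ht (Or.inl rfl)
  have hch₂ : D.Child t q₂ := NiceTreeDecomposition.child_of_node ht (Or.inr rfl)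
  have hq' : (D.node t).child₁ = q := by rw [ht]; rfl
  have hq₂' : (D.node t).child₂ = q₂ := by rw [ht]; rfl
  have hX := (hS.card t).trans hS.W_le
  have hfeas : ∀ c E₁ E₂, (D.node t).Feas (D.bag t) I.k c E₁ E₂ ↔
      (∀ u ∈ D.bag t, E₁.fac u = E₂.fac u) ∧ E₁.cnt + E₂.cnt ≤ I.k := by
    intro c E₁ E₂
    rw [ht]
    rfl
  refine (for_child₁ (J := fun j s' => CoversIn D t W F L med ent₀
    (fun _ e₁ e₂ => F q ≤ e₁ ∧ e₁ < j ∧ F q₂ ≤ e₂ ∧ e₂ < L q₂) s') hS hR hch hq' rfl rfl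
    (fun _ _ _ h => h) (h.mono fun c e₁ e₂ h _ => by omega) ?_).mono ?_
  swap
  · intro s' h'
    refine h'.mono fun c e₁ e₂ h1 _ => ?_
    have h2 := h1.1 (by simp [ht, NodeType.tag])
    have h3 := h1.2 (by simp [ht, NodeType.tag])
    rw [hq'] at h2
    rw [hq₂'] at h3
    exact ⟨h2.1, h2.2, h3.1, h3.2⟩
  intro j s₀ hj hj' hR₀ hC₀ hc₀
  have hjt : j < F t := hj'.trans_le (hS.le_first q hch)
  have hb₁ := hS.bounded q hch j hj hj'
  rw [hbag₁] at hb₁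
  refine Runs.for (F q₂) (L q₂) (fun j' s' => CoversIn D t W F L med ent₀
    (fun _ e₁ e₂ => F q ≤ e₁ ∧ F q₂ ≤ e₂ ∧ (e₁ < j ∧ e₂ < L q₂ ∨ e₁ = j ∧ e₂ < j')) s')
    (fun _ _ _ h => h) rfl ?_ (hS.le q₂ hch₂) (hS.few q₂ hch₂) ?_
    (hC₀.mono fun c e₁ e₂ h _ => by omega) ?_ ?_
  · simp only [NExp.eval, hR₀.fst, hR₀.child₂, hq₂']
  · intro j s' hF _
    have := hR₀.frame hF rfl
    simp only [NExp.eval, this.lst, this.child₂, hq₂']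
  swap
  · intro s' h' _
    exact h'.mono fun c e₁ e₂ h1 _ => by omega
  intro j₂ s₁ hj₂ hj₂' hF₁ hC₁ hc₂
  have hR₁ := hR₀.frame hF₁ rfl
  have hc₁ : s₁.nat vE₁ 0 = j := by rw [hF₁.nat vE₁ rfl, hc₀]
  have hjt₂ : j₂ < F t := hj₂'.trans_le (hS.le_first q₂ hch₂)
  have hle : F t ≤ s₁.nat vTop 0 := hC₁.1.le
  have hbase : ∀ e ≤ s₁.nat vTop 0, s₁.nat aBase e = e * I.n := hC₁.1.base
  have hold : s₁.entry I.n j = ent₀ j := hC₁.1.old j hjt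
  have hold₂ : s₁.entry I.n j₂ = ent₀ j₂ := hC₁.1.old j₂ hjt₂
  have hbj : s₁.nat aBase j = j * I.n := hbase j (by omega)
  have hbj₂ : s₁.nat aBase j₂ = j₂ * I.n := hbase j₂ (by omega)
  refine Runs.setNat_seq ?_
  refine Runs.seq' (R₁ := fun s' => s'.nat vMis 0 = 0 ↔
    ∀ u ∈ D.bag t, (ent₀ j).fac u = (ent₀ j₂).fac u) ?_ ?_
  · refine Runs.forBag t (fun A s' => s'.nat vMis 0 = 0 ↔
      ∀ u ∈ A, (ent₀ j).fac u = (ent₀ j₂).fac u) hR₁.node hX (fun _ _ _ h => h)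
      (fun _ _ _ h => h) rfl rfl rfl (by simp [State.setNat_nat, NExp.eval]) ?_ fun s' h _ => h
    intro A v s' hv hvA hA hF h hu
    have he₁ : s'.nat vE₁ 0 = j := (congrFun (hF.nat vE₁ rfl) 0).trans hc₁
    have he₂ : s'.nat vE₂ 0 = j₂ := (congrFun (hF.nat vE₂ rfl) 0).trans hc₂
    have hbj' : s'.nat aBase j = j * I.n := (congrFun (hF.nat aBase rfl) j).trans hbj
    have hbj₂' : s'.nat aBase j₂ = j₂ * I.n := (congrFun (hF.nat aBase rfl) j₂).trans hbj₂
    have hent : s'.entry I.n = s₁.entry I.n := hF.entry rfl rfl rfl rfl rfl rfl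
    have e1 := eval_facExp (x := connectedInput I G D) (eE := .var vE₁) (uE := .var vU)
      he₁ hu hbj'
    have e2 := eval_facExp (x := connectedInput I G D) (eE := .var vE₂) (uE := .var vU)
      he₂ hu hbj₂'
    rw [hent, hold] at e1
    rw [hent, hold₂] at e2
    refine Runs.setNat ?_
    simp only [NExp.eval] at e1 e2 ⊢
    rw [e1, e2, State.setNat_nat_self, Finset.forall_mem_insert, ← h]
    omega
  intro s₂ h₂ hF₂
  have hR₂ : Ready D t F L med s₂ := (hR₁.setNat rfl).frame hF₂ rfl
  have hent₂ : s₂.entry I.n = s₁.entry I.n := hF₂.entry rfl rfl rfl rfl rfl rfl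
  have hbase₂ : s₂.nat aBase = s₁.nat aBase := hF₂.nat aBase rfl
  have htop₂ : s₂.nat vTop 0 = s₁.nat vTop 0 := congrFun (hF₂.nat vTop rfl) 0
  have he₂ : s₂.nat vE₁ 0 = j := (congrFun (hF₂.nat vE₁ rfl) 0).trans hc₁
  have he₂' : s₂.nat vE₂ 0 = j₂ := (congrFun (hF₂.nat vE₂ rfl) 0).trans hc₂
  have hskip : ¬ ((∀ u ∈ D.bag t, (ent₀ j).fac u = (ent₀ j₂).fac u) ∧
      (ent₀ j).cnt + (ent₀ j₂).cnt ≤ I.k) → CoversIn D t W F L med ent₀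
      (fun _ e₁ e₂ => F q ≤ e₁ ∧ F q₂ ≤ e₂ ∧ (e₁ < j ∧ e₂ < L q₂ ∨ e₁ = j ∧ e₂ < j₂ + 1)) s₂ := by
    intro hn
    change Covers D t W F L med ent₀ _ (s₂.nat aBase) (s₂.entry I.n) (s₂.nat vTop 0)
    rw [hbase₂, hent₂, htop₂]
    refine hC₁.mono fun c e₁ e₂ h1 h2 => ?_
    by_cases hcur : e₁ = j ∧ e₂ = j₂
    · rw [hcur.1, hcur.2, hfeas] at h2
      exact absurd h2 hn
    · omega
  refine Runs.cond (fun hb => ?_) (fun hb => ?_) <;>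
    simp only [BExp.Holds, NExp.eval, Nat.le_zero, h₂] at hb
  swap
  · exact Runs.skip (hskip fun h => hb h.1)
  have hcnt₂ : ∀ e, s₂.nat aCnt e = (s₁.entry I.n e).cnt := by
    intro e
    rw [← hent₂]
    rfl
  refine Runs.cond (fun hb' => ?_) (fun hb' => ?_) <;>
    simp only [BExp.Holds, NExp.eval, he₂, he₂', hcnt₂, hold, hold₂] at hb'
  swap
  · exact Runs.skip (hskip fun h => hb' h.2)
  refine Runs.seq' (copyProg_spec (t := t) (e := j) (top := s₁.nat vTop 0)
    hR₂.node hX rfl htop₂ he₂ ?_ ?_ (by omega)) ?_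
  · rw [hbase₂, hbase _ le_rfl]
  · rw [hbase₂, hbj]
  rintro s₃ ⟨h1, h2, h3, h4, h5⟩ hF₃
  rw [hent₂, hold] at h2
  rw [hent₂] at h1
  have hR₃ := hR₂.frame hF₃ rfl
  have hbase₃ : s₃.nat aBase = s₁.nat aBase := (hF₃.nat aBase rfl).trans hbase₂
  have htop₃ : s₃.nat vTop 0 = s₁.nat vTop 0 := (congrFun (hF₃.nat vTop rfl) 0).trans htop₂
  have he₃ : s₃.nat vE₂ 0 = j₂ := by rw [hF₃.nat vE₂ rfl, he₂']
  refine Runs.seq' (joinLabProg_spec (t := t) (e := j₂) (top := s₁.nat vTop 0)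
    hR₃.node hX htop₃ ?_ he₃ ?_ (by omega)) ?_
  · rw [hbase₃, hbase _ le_rfl]
  · rw [hbase₃, hbj₂]
  rintro s₄ ⟨l, hl1, hl2, hl3⟩ hF₄
  have hold₃ : s₃.entry I.n j₂ = ent₀ j₂ := by rw [h1 j₂ (by omega), hold₂]
  rw [hold₃] at hl2 hl3
  have hR₄ := hR₃.frame hF₄ rfl
  have hbase₄ : s₄.nat aBase = s₁.nat aBase := (hF₄.nat aBase rfl).trans hbase₃
  have htop₄ : s₄.nat vTop 0 = s₁.nat vTop 0 := (congrFun (hF₄.nat vTop rfl) 0).trans htop₃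
  have he₄ : s₄.nat vE₁ 0 = j := by rw [hF₄.nat vE₁ rfl, hF₃.nat vE₁ rfl, he₂]
  have he₄' : s₄.nat vE₂ 0 = j₂ := by rw [hF₄.nat vE₂ rfl, he₃]
  have hold₄ : s₄.entry I.n j = ent₀ j := by
    rw [hl1, Function.update_of_ne (by omega), h1 j (by omega), hold]
  have hold₄' : s₄.entry I.n j₂ = ent₀ j₂ := by
    rw [hl1, Function.update_of_ne (by omega), hold₃]
  have e1 : (NExp.plus (.read aCnt (.var vE₁)) (.read aCnt (.var vE₂))).eval
      (connectedInput I G D) s₄ = (ent₀ j).cnt + (ent₀ j₂).cnt := by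
    simp only [NExp.eval, he₄, he₄']
    rw [← hold₄, ← hold₄']
    rfl
  have e2 : ∀ i m, (RExp.plus (.read 0 (.var vE₁)) (.read 0 (.var vE₂))).eval
      (connectedInput I G D) (s₄.setNat aCnt i m) = (ent₀ j).cost + (ent₀ j₂).cost := by
    intro i m
    rw [← hold₄, ← hold₄', ← he₄, ← he₄']
    rfl
  have e3 : (NExp.var vTop : CExp).eval (connectedInput I G D) s₄ = s₁.nat vTop 0 := htop₄
  have e4 : ∀ i m, (NExp.var vTop : CExp).eval (connectedInput I G D) (s₄.setNat aCnt i m) =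
      s₁.nat vTop 0 := fun _ _ => htop₄
  have e5 : ∀ i m i' m', (NExp.var vTop : CExp).eval (connectedInput I G D)
      ((s₄.setNat aCnt i m).setReal 0 i' m') = s₁.nat vTop 0 := fun _ _ _ _ => htop₄
  have e6 : ∀ i m i' m', (NExp.var vE₂ : CExp).eval (connectedInput I G D)
      ((s₄.setNat aCnt i m).setReal 0 i' m') = j₂ := fun _ _ _ _ => he₄'
  refine Runs.setNat_seq (Runs.setReal_seq (Runs.setNat_seq ?_))
  rw [e1, e2, e3, e4, e5, e6]
  have hent : ∀ E, s₃.entry I.n (s₁.nat vTop 0) = E →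
      (((s₄.setNat aCnt (s₁.nat vTop 0) ((ent₀ j).cnt + (ent₀ j₂).cnt)).setReal 0
        (s₁.nat vTop 0) ((ent₀ j).cost + (ent₀ j₂).cost)).setNat aPtr₂
        (s₁.nat vTop 0) j₂).entry I.n = Function.update (s₃.entry I.n) (s₁.nat vTop 0)
        { E with lab := l, cnt := (ent₀ j).cnt + (ent₀ j₂).cnt,
                 cost := (ent₀ j).cost + (ent₀ j₂).cost, p₂ := j₂ } := by
    rintro E rfl
    rw [entry_setPtr₂, entry_setCost, entry_setCnt, hl1]
    simp
  generalize s₃.entry I.n (s₁.nat vTop 0) = E at h2 h5 hent hl2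
  specialize hent E rfl
  refine insert_step hS (((hR₄.setNat rfl).setReal).setNat rfl) hC₁ hbase₄ htop₄
    (E := { E with lab := l, cnt := (ent₀ j).cnt + (ent₀ j₂).cnt,
                   cost := (ent₀ j).cost + (ent₀ j₂).cost, p₂ := j₂ })
    ?_ ?_ ?_ (0, 0) ?_ ?_ ?_ ?_ ?_
  · intro e he
    rw [hent, Function.update_of_ne he, h1 e he]
  · rw [hent, Function.update_self]
  · simp only [h5]
    refine ⟨fun _ => ?_, fun _ => ?_⟩
    · rw [hq']
      exact ⟨hj, hj'⟩
    · rw [hq₂']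
      exact ⟨hj₂, hj₂'⟩
  · rw [hfeas]
    simp only [h5]
    exact ⟨hb, hb'⟩
  · rw [ht]
    simp only [NodeType.Leads, h5, true_and]
    refine ⟨fun u hu => (h2 u hu).1, fun u hu v hv huv => ?_, fun u hu v hv huv => ?_,
      fun R hR₁ hR₂ u hu v hv huv => ?_⟩
    · refine hl2.coarse u hu v hv ?_
      rw [(h2 u hu).2, (h2 v hv).2, huv]
    · exact hl3 u hu v hv huv
    · refine hl2.least R (fun u hu v hv huv => ?_) hR₂ u hu v hv huv
      rw [(h2 u hu).2, (h2 v hv).2] at huv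
      exact hR₁ u hu v hv huv
  · rw [ht]
    simp only [NodeType.newCost, h5]
  · refine ⟨hb', fun x hx => ?_⟩
    obtain ⟨y, hy, hxy⟩ := hl2.range x hx
    simp only [(h2 x hx).1, hxy, (h2 y hy).2]
    exact ⟨(hb₁.2 x hx).1, (hb₁.2 y hy).2⟩
  · rintro c' e₁ e₂ ⟨a1, a2, a3⟩ -
    by_cases hcur : e₁ = j ∧ e₂ = j₂
    · obtain ⟨rfl, rfl⟩ := hcur
      right
      rw [ht]
      simp only [h5]
      exact ⟨fun h => h, trivial⟩
    · left
      omega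

end nodeTypes

end RealRAM

/-! ### Tables do not depend on entries of unrelated nodes. -/

namespace NodeType

variable {n N : ℕ} {B : Finset (Fin n)} {k : ℕ} {c : ℕ × ℕ} {E₁ E₂ E₁' E₂' E : Entry n}
  {g : Fin n → ℕ → ℝ} {a : NodeType n N}

/-- The first child entry matters only from tag `1` on and the second only for joins, which have tag
`4`. Pointers to nonexistent children may thus hold arbitrary values. -/
theorem feas_congr (h₁ : 1 ≤ a.tag → E₁' = E₁) (h₂ : 4 ≤ a.tag → E₂' = E₂) :
    a.Feas B k c E₁' E₂' ↔ a.Feas B k c E₁ E₂ := by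
  cases a <;> simp_all [Feas, tag]

theorem leads_congr (h₁ : 1 ≤ a.tag → E₁' = E₁) (h₂ : 4 ≤ a.tag → E₂' = E₂) :
    a.Leads B c E₁' E₂' E ↔ a.Leads B c E₁ E₂ E := by
  cases a <;> simp_all [Leads, tag]

theorem newCost_congr (h₁ : 1 ≤ a.tag → E₁' = E₁) (h₂ : 4 ≤ a.tag → E₂' = E₂) :
    a.newCost g E₁' E₂' = a.newCost g E₁ E₂ := by
  cases a <;> simp_all [newCost, tag]

end NodeType

namespace NiceTreeDecomposition

variable {n : ℕ} {G : SimpleGraph (Fin n)} {D : NiceTreeDecomposition G} {t : Fin D.N}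
  {F L F' L' : ℕ → ℕ} {e₁ e₂ : ℕ} {ent ent' : ℕ → Entry n} {k W : ℕ} {g : Fin n → ℕ → ℝ}

theorem exists_child₁ (h : 1 ≤ (D.node t).tag) : ∃ q, D.Child t q ∧ (D.node t).child₁ = q := by
  simp only [child_iff]
  revert h
  cases D.node t <;> simp [NodeType.tag, NodeType.HasChild, NodeType.child₁]

theorem exists_child₂ (h : 4 ≤ (D.node t).tag) : ∃ q, D.Child t q ∧ (D.node t).child₂ = q := by
  simp only [child_iff]
  revert h
  cases D.node t <;> simp [NodeType.tag, NodeType.HasChild, NodeType.child₂]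

theorem InRange.congr (h : D.InRange F L t e₁ e₂)
    (hF : ∀ q, D.Child t q → F' q = F q ∧ L' q = L q) : D.InRange F' L' t e₁ e₂ := by
  refine ⟨fun ht => ?_, fun ht => ?_⟩
  · obtain ⟨q, hq, hq'⟩ := exists_child₁ ht
    rw [hq', (hF q hq).1, (hF q hq).2, ← hq']
    exact h.1 ht
  · obtain ⟨q, hq, hq'⟩ := exists_child₂ ht
    rw [hq', (hF q hq).1, (hF q hq).2, ← hq']
    exact h.2 ht

theorem InRange.ent_eq (h : D.InRange F L t e₁ e₂)
    (hent : ∀ q, D.Child t q → ∀ e < L q, ent' e = ent e) :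
    (1 ≤ (D.node t).tag → ent' e₁ = ent e₁) ∧ (4 ≤ (D.node t).tag → ent' e₂ = ent e₂) := by
  refine ⟨fun ht => ?_, fun ht => ?_⟩
  · obtain ⟨q, hq, hq'⟩ := exists_child₁ ht
    exact hent q hq e₁ (hq' ▸ (h.1 ht).2)
  · obtain ⟨q, hq, hq'⟩ := exists_child₂ ht
    exact hent q hq e₂ (hq' ▸ (h.2 ht).2)

theorem Sound.congr {E : Entry n} (h : D.Sound k g ent F L t E)
    (hF : ∀ q, D.Child t q → F' q = F q ∧ L' q = L q)
    (hent : ∀ q, D.Child t q → ∀ e < L q, ent' e = ent e) : D.Sound k g ent' F' L' t E := by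
  obtain ⟨h1, ⟨c, h2, h3⟩, h4⟩ := h
  obtain ⟨a1, a2⟩ := h1.ent_eq hent
  refine ⟨h1.congr hF, ⟨c, (NodeType.feas_congr a1 a2).2 h2, (NodeType.leads_congr a1 a2).2 h3⟩, ?_⟩
  rw [h4, NodeType.newCost_congr a1 a2]

/-- Coverage is proved relative to the child entries before the node was processed. As these entries
and their ranges are unchanged, it holds for the final memory as well. -/
theorem complete_congr {f m : ℕ} (h : ∀ c e₁ e₂, D.InRange F L t e₁ e₂ →
      (D.node t).Feas (D.bag t) k c (ent e₁) (ent e₂) →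
      D.Covered g t (ent e₁) (ent e₂) c ent' f m)
    (hF : ∀ q, D.Child t q → F' q = F q ∧ L' q = L q)
    (hent : ∀ q, D.Child t q → ∀ e < L q, ent' e = ent e) (hf : F' t = f) (hm : L' t = m) :
    D.Complete k g ent' F' L' t := by
  intro c e₁ e₂ h₁ h₂ hfeas
  have hr : D.InRange F L t e₁ e₂ :=
    InRange.congr (F := F') (L := L') ⟨h₁, h₂⟩ fun q hq => ⟨(hF q hq).1.symm, (hF q hq).2.symm⟩
  obtain ⟨a1, a2⟩ := hr.ent_eq hent
  obtain ⟨e, b1, b2, b3, b4⟩ := h c e₁ e₂ hr ((NodeType.feas_congr a1 a2).1 hfeas)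
  refine ⟨e, hf ▸ b1, hm ▸ b2, (NodeType.leads_congr a1 a2).2 b3, ?_⟩
  rw [NodeType.newCost_congr a1 a2]
  exact b4

theorem IsTable.congr (h : D.IsTable k W g ent F L t)
    (hF : ∀ q, D.Child t q → F' q = F q ∧ L' q = L q) (hFt : F' t = F t) (hLt : L' t = L t)
    (hent : ∀ q, D.Child t q → ∀ e < L q, ent' e = ent e) (hent' : ∀ e < L t, ent' e = ent e) :
    D.IsTable k W g ent' F' L' t := by
  refine ⟨by rw [hFt, hLt]; exact h.le, ?_, ?_, ?_, ?_⟩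
  · intro e h1 h2
    rw [hLt] at h2
    rw [hent' e h2]
    exact (h.sound e (hFt ▸ h1) h2).congr hF hent
  · intro e h1 h2
    rw [hLt] at h2
    rw [hent' e h2]
    exact h.bounded e (hFt ▸ h1) h2
  · intro e e' h1 h2 h1' h2'
    rw [hLt] at h2 h2'
    rw [hent' e h2, hent' e' h2']
    exact h.inj e e' (hFt ▸ h1) h2 (hFt ▸ h1') h2'
  · refine complete_congr (F := F) (L := L) (ent := ent) (fun c e₁ e₂ hr hf => ?_) hF hent hFt hLt
    obtain ⟨e, b1, b2, b3, b4⟩ := h.complete c e₁ e₂ hr.1 hr.2 hf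
    refine ⟨e, b1, b2, ?_⟩
    rw [hent' e b2]
    exact ⟨b3, b4⟩

end NiceTreeDecomposition

/-! ### Processing a node of arbitrary type. -/

namespace RealRAM

section nodeProg

variable {I : KMedianInstance} {G : SimpleGraph (Fin I.n)} {D : NiceTreeDecomposition G}
  {t : Fin D.N} {W X : ℕ} {med : ℕ → ℕ} {s : State}

/-- The number `X` bounds the numbers of iterations needed for a node. -/
structure Room (D : NiceTreeDecomposition G) (W X : ℕ) : Prop where
  card : ∀ q, (D.bag q).card ≤ W
  W_le : W ≤ X
  entries_le : (I.k * W) ^ W * (I.k + 1) ≤ X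
  k_le : I.k ≤ X

theorem readNodeProg_spec (ht : s.nat vT 0 = t) :
    Runs (connectedInput I G D) X readNodeProg s fun s' =>
      s'.nat vS 0 = (D.node t).child₁ ∧ s'.nat vS₂ 0 = (D.node t).child₂ ∧
      s'.nat vV 0 = (D.node t).vertex₁ ∧ s'.nat vV₂ 0 = (D.node t).vertex₂ := by
  refine Runs.setNat_seq (Runs.setNat_seq (Runs.setNat_seq (Runs.setNat ?_)))
  simp [NExp.eval, State.setNat_nat, ht, input_child₁, input_child₂, input_vertex₁, input_vertex₂]

theorem eval_tagExp (ht : s.nat vT 0 = t) :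
    tagExp.eval (connectedInput I G D) s = (D.node t).tag := by
  simp only [NExp.eval, ht, input_nodeTag]

/-- New entries are written from the old value of `vTop` on, above all entries of the children, and
only the range of `t` is recorded. Tables built earlier therefore survive. -/
theorem nodeProg_spec (hX : Room D W X) (ht : s.nat vT 0 = t) (hmed : s.nat aMed = med)
    (hbase : ∀ e ≤ s.nat vTop 0, s.nat aBase e = e * I.n)
    (hch : ∀ q, D.Child t q → D.IsTable I.k W (medCost I med) (s.entry I.n) (s.nat aFst)
      (s.nat aLst) q ∧ s.nat aLst q ≤ s.nat vTop 0) :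
    Runs (connectedInput I G D) X nodeProg s fun s' =>
      D.IsTable I.k W (medCost I med) (s'.entry I.n) (s'.nat aFst) (s'.nat aLst) t ∧
      (∀ e ≤ s'.nat vTop 0, s'.nat aBase e = e * I.n) ∧
      s.nat vTop 0 ≤ s'.nat vTop 0 ∧ s'.nat aLst t ≤ s'.nat vTop 0 ∧
      (∀ q : Fin D.N, q ≠ t → s'.nat aFst q = s.nat aFst q ∧ s'.nat aLst q = s.nat aLst q) ∧
      ∀ e < s.nat vTop 0, s'.entry I.n e = s.entry I.n e := by
  have hk : 0 < I.k := by have := I.two_le_k; omega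
  have hne : ∀ q, D.Child t q → q ≠ t := by
    rintro q hq rfl
    have := hq.dist
    omega
  refine Runs.seq' (readNodeProg_spec ht) ?_
  rintro s₁ ⟨h1, h2, h3, h4⟩ hF₁
  have hent₁ : s₁.entry I.n = s.entry I.n := hF₁.entry rfl rfl rfl rfl rfl rfl
  have htop₁ : s₁.nat vTop 0 = s.nat vTop 0 := congrFun (hF₁.nat vTop rfl) 0
  have ht₁ : s₁.nat vT 0 = t := (congrFun (hF₁.nat vT rfl) 0).trans ht
  refine Runs.setNat_seq ?_
  have e1 : (NExp.var vT : CExp).eval (connectedInput I G D) s₁ = t := ht₁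
  have e2 : (NExp.var vTop : CExp).eval (connectedInput I G D) s₁ = s.nat vTop 0 := htop₁
  rw [e1, e2]
  set F := Function.update (s.nat aFst) (t : ℕ) (s.nat vTop 0) with hF
  set s₂ := s₁.setNat aFst t (s.nat vTop 0) with hs₂
  have hFt : F t = s.nat vTop 0 := by rw [hF, Function.update_self]
  have hFne : ∀ q : Fin D.N, q ≠ t → F q = s.nat aFst q := by
    intro q hq
    rw [hF, Function.update_of_ne (fun h => hq (Fin.ext h))]
  have hfst₂ : s₂.nat aFst = F := by
    funext i
    rw [hs₂, hF, State.setNat_nat, Function.update_apply, hF₁.nat aFst rfl]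
    simp
  have hR : Ready D t F (s.nat aLst) med s₂ :=
    ⟨ht₁, h1, h2, h3, h4, hfst₂, hF₁.nat aLst rfl, (hF₁.nat aMed rfl).trans hmed⟩
  have hS : Setting D t W X F (s.nat aLst) (s.entry I.n) := by
    refine ⟨hX.card, hX.W_le, hX.entries_le, hX.k_le, ?_, ?_, ?_, ?_⟩ <;> intro q hq
    · rw [hFne q (hne q hq)]
      exact (hch q hq).1.le
    · rw [hFt]
      exact (hch q hq).2
    · rw [hFne q (hne q hq)]
      exact ((hch q hq).1.card_le (hX.card q) hk).trans hX.entries_le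
    · rw [hFne q (hne q hq)]
      exact (hch q hq).1.bounded
  have hent₂ : s₂.entry I.n = s.entry I.n := (entry_setNat_of_gt (by omega)).trans hent₁
  have hC : CoversIn D t W F (s.nat aLst) med (s.entry I.n) (fun _ _ _ => False) s₂ := by
    refine ⟨⟨?_, ?_, ?_, ?_, ?_, ?_⟩, fun _ _ _ h => h.elim⟩
    · intro e he
      change s₁.nat aBase e = _
      rw [hF₁.nat aBase rfl]
      exact hbase e (he.trans_eq htop₁)
    · rw [hFt]
      exact htop₁.ge
    · intro e _
      rw [hent₂]
    all_goals
      intro e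
      intros
      change s₂.nat vTop 0 = _ at htop₁
      omega
  refine Runs.seq' (R₁ := CoversIn D t W F (s.nat aLst) med (s.entry I.n)
    (fun _ => D.InRange F (s.nat aLst) t)) ?_ ?_
  · generalize ha : D.node t = a
    have htag : ∀ j, (BExp.eq tagExp (.const j)).Holds (connectedInput I G D) s₂ ↔ a.tag = j := by
      intro j
      rw [BExp.holds_eq, eval_tagExp hR.node, ha]
      rfl
    have hno : ∀ {j P P'} {R : State → Prop}, a.tag ≠ j → Runs (connectedInput I G D) X P' s₂ R →
        Runs (connectedInput I G D) X (.cond (.eq tagExp (.const j)) P P') s₂ R :=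
      fun hj h => Runs.cond (fun hb => absurd ((htag _).1 hb) hj) fun _ => h
    have hyes : ∀ {j P P'} {R : State → Prop}, a.tag = j → Runs (connectedInput I G D) X P s₂ R →
        Runs (connectedInput I G D) X (.cond (.eq tagExp (.const j)) P P') s₂ R :=
      fun hj h => Runs.cond (fun _ => h) fun hb => absurd ((htag _).2 hj) hb
    cases a with
    | leaf => exact hyes rfl (leafProg_spec hS hR ha hC)
    | introVertex v q =>
      refine hno ?_ (hyes rfl (introVertexProg_spec hS hR ha hC))
      simp [NodeType.tag]
    | introEdge u v q =>
      refine hno ?_ (hno ?_ (hyes rfl (introEdgeProg_spec hS hR ha hC))) <;> simp [NodeType.tag]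
    | forget v q =>
      refine hno ?_ (hno ?_ (hno ?_ (hyes rfl (forgetProg_spec hS hR ha hC)))) <;>
        simp [NodeType.tag]
    | join q q' =>
      refine hno ?_ (hno ?_ (hno ?_ (hno ?_ (joinProg_spec hS hR ha hC)))) <;> simp [NodeType.tag]
  rintro s₃ ⟨hB, hcov⟩ hF₃
  have hR₃ : Ready D t F (s.nat aLst) med s₃ := hR.frame hF₃ rfl
  refine Runs.setNat ?_
  have e3 : (NExp.var vT : CExp).eval (connectedInput I G D) s₃ = t := hR₃.node
  have e4 : (NExp.var vTop : CExp).eval (connectedInput I G D) s₃ = s₃.nat vTop 0 := rfl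
  rw [e3, e4]
  have hle : F t ≤ s₃.nat vTop 0 := hB.le
  have hL : ∀ i, (s₃.setNat aLst t (s₃.nat vTop 0)).nat aLst i =
      if i = t then s₃.nat vTop 0 else s.nat aLst i := by
    intro i
    rw [State.setNat_nat, hR₃.lst]
    simp
  have hL' : ∀ q : Fin D.N, q ≠ t →
      (s₃.setNat aLst t (s₃.nat vTop 0)).nat aLst q = s.nat aLst q := by
    intro q hq
    rw [hL, if_neg fun h => hq (Fin.ext h)]
  have hLt : (s₃.setNat aLst t (s₃.nat vTop 0)).nat aLst t = s₃.nat vTop 0 := by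
    rw [hL, if_pos rfl]
  have hfst₃ : (s₃.setNat aLst t (s₃.nat vTop 0)).nat aFst = F := hR₃.fst
  have htop₃ : (s₃.setNat aLst t (s₃.nat vTop 0)).nat vTop 0 = s₃.nat vTop 0 := rfl
  rw [entry_setNat_of_gt (by omega), hfst₃, htop₃, hLt]
  have hchild : ∀ q, D.Child t q → F q = F q ∧
      (s₃.setNat aLst t (s₃.nat vTop 0)).nat aLst q = s.nat aLst q :=
    fun q hq => ⟨rfl, hL' q (hne q hq)⟩
  have hold : ∀ q, D.Child t q → ∀ e < s.nat aLst q, s₃.entry I.n e = s.entry I.n e :=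
    fun q hq e he => hB.old e (by have := (hch q hq).2; omega)
  refine ⟨⟨?_, ?_, ?_, ?_, ?_⟩, hB.base, hFt ▸ hle, le_rfl, fun q hq => ⟨hFne q hq, hL' q hq⟩,
    fun e he => hB.old e (hFt ▸ he)⟩
  · rw [hLt]
    exact hle
  · intro e h1 h2
    rw [hLt] at h2
    exact (hB.sound e h1 h2).congr hchild hold
  · rw [hLt]
    exact hB.bounded
  · rw [hLt]
    exact hB.inj
  · exact NiceTreeDecomposition.complete_congr hcov hchild hold rfl hLt

end nodeProg

end RealRAM

/-! ### Ordering the nodes by breadth-first search. -/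

namespace NiceTreeDecomposition

variable {n : ℕ} {G : SimpleGraph (Fin n)}

/-- The array `o` lists all nodes, and parents precede their children. -/
structure IsOrder (D : NiceTreeDecomposition G) (o : ℕ → ℕ) (pos : Fin D.N → ℕ) : Prop where
  lt : ∀ t, pos t < D.N
  eq : ∀ t, o (pos t) = t
  surj : ∀ j < D.N, ∃ t, pos t = j
  child : ∀ t s, D.Child t s → pos t < pos s

/-- The state of a breadth-first search: the cells `j < m` of `o` hold distinct nodes, and
`K j q` says that the child `q` of the node in cell `j` has been found. -/
structure IsQueue (D : NiceTreeDecomposition G) (o : ℕ → ℕ) (m : ℕ) (K : ℕ → Fin D.N → Prop) :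
    Prop where
  pos : 0 < m
  root : o 0 = D.root
  valid : ∀ j < m, ∃ t : Fin D.N, o j = t
  inj : ∀ j < m, ∀ j' < m, o j = o j' → j = j'
  parent : ∀ j, 0 < j → j < m → ∃ j' < j, ∃ t q : Fin D.N, o j' = t ∧ o j = q ∧ D.Child t q ∧ K j' q
  lt : ∀ j q, K j q → j < m
  found : ∀ j < m, ∀ t q : Fin D.N, o j = t → D.Child t q → K j q → ∃ j' < m, o j' = q

variable {D : NiceTreeDecomposition G} {o o' : ℕ → ℕ} {m i : ℕ} {K K' : ℕ → Fin D.N → Prop}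
  {t q : Fin D.N}

theorem IsQueue.congr (h : D.IsQueue o m K) (hK' : ∀ j q, K' j q → j < m)
    (hK : ∀ j < m, ∀ t q : Fin D.N, o j = t → D.Child t q → (K j q ↔ K' j q)) :
    D.IsQueue o m K' := by
  refine ⟨h.pos, h.root, h.valid, h.inj, fun j hj hjm => ?_, hK',
    fun j hj t q ht htq hk => ?_⟩
  · obtain ⟨j', h1, t, q, h2, h3, h4, h5⟩ := h.parent j hj hjm
    exact ⟨j', h1, t, q, h2, h3, h4, (hK j' (by omega) t q h2 h4).1 h5⟩
  · exact h.found j hj t q ht htq ((hK j hj t q ht htq).2 hk)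

/-- The appended child `q` is new: it is not the root, and if it were already listed, uniqueness of
parents would mean that it had been found from cell `i`, contradicting `hK`. -/
theorem IsQueue.push (h : D.IsQueue o m K) (hi : i < m) (ht : o i = t) (hq : D.Child t q)
    (hK : ¬ K i q) (ho' : ∀ j, o' j = if j = m then (q : ℕ) else o j) :
    D.IsQueue o' (m + 1) fun j q' => K j q' ∨ j = i ∧ q' = q := by
  have hlt : ∀ j < m, o' j = o j := fun j hj => by rw [ho', if_neg (by omega)]
  have hm : o' m = q := by rw [ho', if_pos rfl]
  have hnew : ∀ j < m, o j ≠ q := by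
    intro j hj hjq
    rcases Nat.eq_zero_or_pos j with rfl | hj0
    · rw [h.root] at hjq
      exact hq.ne_root (Fin.ext hjq).symm
    · obtain ⟨j', h1, t', q', h2, h3, h4, h5⟩ := h.parent j hj0 hj
      obtain rfl : q' = q := Fin.ext (h3.symm.trans hjq)
      obtain rfl := h4.unique hq
      exact hK (h.inj j' (by omega) i hi (h2.trans ht.symm) ▸ h5)
  refine ⟨by omega, by rw [hlt 0 h.pos, h.root], fun j hj => ?_, fun j hj j' hj' hjj => ?_,
    fun j hj hjm => ?_, fun j q' hk => ?_, fun j hj t' q' ht' htq hk => ?_⟩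
  · rcases Nat.lt_succ_iff_lt_or_eq.1 hj with hj | rfl
    · rw [hlt j hj]
      exact h.valid j hj
    · exact ⟨q, hm⟩
  · rcases Nat.lt_succ_iff_lt_or_eq.1 hj with hj | rfl <;>
      rcases Nat.lt_succ_iff_lt_or_eq.1 hj' with hj' | rfl
    · rw [hlt j hj, hlt j' hj'] at hjj
      exact h.inj j hj j' hj' hjj
    · rw [hlt j hj, hm] at hjj
      exact absurd hjj (hnew j hj)
    · rw [hlt j' hj', hm] at hjj
      exact absurd hjj.symm (hnew j' hj')
    · rfl
  · rcases Nat.lt_succ_iff_lt_or_eq.1 hjm with hjm | rfl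
    · obtain ⟨j', h1, t', q', h2, h3, h4, h5⟩ := h.parent j hj hjm
      exact ⟨j', h1, t', q', by rw [hlt j' (by omega), h2], by rw [hlt j hjm, h3], h4, Or.inl h5⟩
    · exact ⟨i, hi, t, q, by rw [hlt i hi, ht], hm, hq, Or.inr ⟨rfl, rfl⟩⟩
  · rcases hk with hk | ⟨rfl, -⟩
    · exact (h.lt j q' hk).trans (Nat.lt_succ_self m)
    · omega
  · rcases hk with hk | ⟨rfl, rfl⟩
    · have hj := h.lt j q' hk
      obtain ⟨j', h1, h2⟩ := h.found j hj t' q' (by rw [← hlt j hj, ht']) htq hk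
      exact ⟨j', by omega, by rw [hlt j' h1, h2]⟩
    · exact ⟨m, by omega, hm⟩

theorem IsQueue.card_le (h : D.IsQueue o m K) : m ≤ D.N := by
  choose t ht using h.valid
  have hinj : Function.Injective fun j : Fin m => t j j.2 := by
    intro j j' hjj
    refine Fin.ext (h.inj j j.2 j' j'.2 ?_)
    rw [ht j j.2, ht j' j'.2]
    exact congrArg Fin.val hjj
  simpa using Fintype.card_le_of_injective _ hinj

/-- A breadth-first search that stops has found all nodes. -/
theorem IsQueue.exists_eq (h : D.IsQueue o m fun j _ => j < m) (t : Fin D.N) :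
    ∃ j < m, o j = t := by
  refine down_induction (P := fun t => ∃ j < m, o j = t) ⟨0, h.pos, h.root⟩ ?_ t
  rintro t q hq ⟨j, hj, hjt⟩
  exact h.found j hj t q hjt hq hj

/-- With all `N` cells filled and all children found, every node occurs, and only once. Each cell
but the first was filled from an earlier cell, which must hold the unique parent. -/
theorem IsQueue.exists_isOrder (h : D.IsQueue o D.N fun j _ => j < D.N) :
    ∃ pos, D.IsOrder o pos := by
  choose pos hlt hpos using h.exists_eq
  refine ⟨pos, hlt, hpos, fun j hj => ?_, fun t q hq => ?_⟩
  · obtain ⟨t, ht⟩ := h.valid j hj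
    exact ⟨t, h.inj _ (hlt t) _ hj (by rw [hpos, ht])⟩
  · have h0 : 0 < pos q := by
      rcases Nat.eq_zero_or_pos (pos q) with h0 | h0
      · have := hpos q
        rw [h0, h.root] at this
        exact absurd (Fin.ext this).symm hq.ne_root
      · exact h0
    obtain ⟨j', h1, t', q', h2, h3, h4, -⟩ := h.parent (pos q) h0 (hlt q)
    obtain rfl : q = q' := Fin.ext ((hpos q).symm.trans h3)
    obtain rfl := h4.unique hq
    have := h.inj j' (h1.trans (hlt q)) (pos t') (hlt t') (by rw [h2, hpos])
    omega

end NiceTreeDecomposition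

namespace RealRAM

section rules

variable {Q : Type} {x : Input Q} {X T : ℕ} {P : Prog Q} {s : State} {R : State → Prop}

/-- A loop over `P`, with the number of steps rounded up. -/
theorem RunsIn.for' {c : ℕ} {lo hi : NExp Q} (a b : ℕ) (I : ℕ → State → Prop)
    (hI : ∀ j s v, I j s → I j (s.setNat c 0 v))
    (hP : P.wn c = false)
    (hlo : lo.eval x s = a)
    (hab : a ≤ b)
    (hhi : ∀ j s', Frame (Prog.for c lo hi P) s s' → I j s' → hi.eval x s' = b)
    (h0 : I a s)
    (hstep : ∀ j s', a ≤ j → j < b → Frame (Prog.for c lo hi P) s s' → I j s' → s'.nat c 0 = j →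
      Runs x X P s' (I (j + 1)))
    (hR : ∀ s', I b s' → Frame (Prog.for c lo hi P) s s' → R s') :
    RunsIn x ((b - a + 1) * (P.bound X + lo.cost + hi.cost + 12)) (Prog.for c lo hi P) s R := by
  refine (RunsIn.for a b I hI hP hlo hab hhi h0 hstep hR).mono ?_ fun _ h => h
  have : (b - a) * (1 + (hi.cost + 5) + (P.bound X + 6)) ≤
      (b - a) * (P.bound X + lo.cost + hi.cost + 12) := Nat.mul_le_mul_left _ (by omega)
  rw [add_mul]
  omega

theorem RunsIn.setNat_seq {a : ℕ} {i e : NExp Q}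
    (h : RunsIn x T P (s.setNat a (i.eval x s) (e.eval x s)) R) :
    RunsIn x (1 + i.cost + e.cost + T) (.seq (.setNat a i e) P) s R :=
  RunsIn.seq ⟨_, _, .setNat a i e s, le_rfl, h⟩

theorem RunsIn.seq' {T' : ℕ} {P' : Prog Q} {R₁ : State → Prop} (h : RunsIn x T P s R₁)
    (h' : ∀ s', R₁ s' → Frame P s s' → RunsIn x T' P' s' R) :
    RunsIn x (T + T') (.seq P P') s R :=
  RunsIn.seq (h.frame.mono le_rfl fun s' hs' => h' s' hs'.1 hs'.2)

end rules

section order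

variable {I : KMedianInstance} {G : SimpleGraph (Fin I.n)} {D : NiceTreeDecomposition G}
  {W X : ℕ} {s : State}

/-- The loop runs exactly `N` times, without a test for an empty queue, since the queue cannot run
empty before all nodes have been treated. -/
theorem orderProg_spec (X : ℕ) :
    RunsIn (connectedInput I G D) (8 + (D.N + 1) * (orderBody.bound X + 16)) orderProg s
      fun s' => ∃ pos, D.IsOrder (s'.nat aOrd) pos := by
  refine (RunsIn.setNat_seq (RunsIn.setNat_seq (RunsIn.for' (X := X) (c := vI) 0 D.N
    (fun i s' => i ≤ s'.nat vTail 0 ∧ D.IsQueue (s'.nat aOrd) (s'.nat vTail 0) fun j _ => j < i)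
    (fun _ _ _ h => h) rfl rfl (Nat.zero_le _) (fun _ _ _ _ => rfl) ?_ ?_
    (R := fun s' => ∃ pos, D.IsOrder (s'.nat aOrd) pos) ?_))).mono ?_ fun _ h => h
  · have e1 : ∀ j, ((s.setNat aOrd 0 D.root).setNat vTail 0 1).nat aOrd j =
        if j = 0 then (D.root : ℕ) else s.nat aOrd j := by
      intro j
      simp [State.setNat_nat]
    change 0 ≤ 1 ∧ D.IsQueue (((s.setNat aOrd 0 D.root).setNat vTail 0 1).nat aOrd) 1 _
    refine ⟨by omega, ⟨by omega, by rw [e1, if_pos rfl], fun j hj => ⟨D.root, ?_⟩,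
      fun j hj j' hj' _ => by omega, fun j hj hj' => by omega, fun j q h => by omega,
      fun j hj t q _ _ h => by omega⟩⟩
    rw [e1, if_pos (by omega)]
  · rintro i s' - hi - ⟨hle, hq⟩ hc
    -- If the queue were exhausted after `i < N` nodes, those `i` cells would already contain all
    -- `N` nodes.
    have him : i < s'.nat vTail 0 := by
      rcases hle.lt_or_eq with h | h
      · exact h
      · exfalso
        rw [← h] at hq
        choose f hf hf' using hq.exists_eq
        have hinj : Function.Injective fun t => (⟨f t, hf t⟩ : Fin i) := by
          intro t t' htt
          have : f t = f t' := congrArg Fin.val htt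
          exact Fin.ext (by rw [← hf' t, ← hf' t', this])
        have := Fintype.card_le_of_injective _ hinj
        simp at this
        omega
    obtain ⟨t, ht⟩ := hq.valid i him
    refine Runs.setNat_seq ?_
    have e0 : (NExp.read aOrd (.var vI) : CExp).eval (connectedInput I G D) s' = t := by
      simp only [NExp.eval, hc, ht]
    rw [e0]
    set s₁ := s'.setNat vT ((NExp.const 0 : CExp).eval (connectedInput I G D) s') t with hs₁
    have ht₁ : s₁.nat vT 0 = t := by simp [hs₁, State.setNat_nat, NExp.eval]
    have hi₁ : s₁.nat vI 0 = i := hc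
    have hall : ∀ {o : ℕ → ℕ} {m : ℕ} {K : ℕ → Fin D.N → Prop}, D.IsQueue o m K → i < m →
        o i = t → (∀ j q, K j q → j ≤ i) → (∀ j q, j < i → K j q) →
        (∀ q, D.Child t q → K i q) → i + 1 ≤ m ∧ D.IsQueue o m fun j _ => j < i + 1 := by
      intro o m K h him ht hK hK' hq
      refine ⟨him, h.congr (fun j q hj => by omega) fun j hj t' q ht' htq => ?_⟩
      refine ⟨fun h => Nat.lt_succ_of_le (hK j q h), fun h => ?_⟩
      rcases Nat.lt_succ_iff_lt_or_eq.1 h with h | rfl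
      · exact hK' j q h
      · obtain rfl : t = t' := Fin.ext (ht.symm.trans ht')
        exact hq q htq
    generalize hm : s'.nat vTail 0 = m at *
    have hm₁ : s₁.nat vTail 0 = m := hm
    refine Runs.cond (fun hb => ?_) fun hb => ?_ <;>
      rw [BExp.Holds, eval_tagExp ht₁, NExp.eval] at hb
    swap
    · refine Runs.skip ?_
      rw [hm₁]
      refine hall hq him ht (fun j _ h => h.le) (fun j _ h => h) fun q htq => ?_
      rw [NiceTreeDecomposition.child_iff] at htq
      generalize D.node t = a at *
      cases a <;> simp_all [NodeType.tag, NodeType.HasChild]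
    obtain ⟨q, htq, hq'⟩ := NiceTreeDecomposition.exists_child₁ hb
    refine Runs.setNat_seq (Runs.setNat_seq ?_)
    have e1 : (NExp.input .child₁ (.var vT) (.const 0) : CExp).eval (connectedInput I G D) s₁ = q := by
      rw [← hq', ← input_child₁ t 0, ← ht₁]
      rfl
    have e2 : (NExp.var vTail : CExp).eval (connectedInput I G D) s₁ = m := hm₁
    have e3 : (NExp.plus (.var vTail) (.const 1) : CExp).eval (connectedInput I G D)
        (s₁.setNat aOrd m q) = m + 1 := congrArg (· + 1) hm₁
    rw [e1, e2, e3]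
    set s₂ := (s₁.setNat aOrd m q).setNat vTail
      ((NExp.const 0 : CExp).eval (connectedInput I G D) (s₁.setNat aOrd m q)) (m + 1) with hs₂
    have hm₂ : s₂.nat vTail 0 = m + 1 := by simp [hs₂, State.setNat_nat, NExp.eval]
    have ht₂ : s₂.nat vT 0 = t := ht₁
    have ho₂ : ∀ j, s₂.nat aOrd j = if j = m then (q : ℕ) else s'.nat aOrd j := by
      intro j
      simp [hs₂, hs₁, State.setNat_nat]
    have hq₂ := hq.push him ht htq (by omega) ho₂
    have hot₂ : s₂.nat aOrd i = t := by rw [ho₂, if_neg him.ne, ht]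
    refine Runs.cond (fun hb' => ?_) fun hb' => ?_ <;>
      rw [BExp.Holds, eval_tagExp ht₂, NExp.eval] at hb'
    swap
    · refine Runs.skip ?_
      rw [hm₂]
      refine hall hq₂ (by omega) hot₂ (fun j _ h => by omega) (fun j _ h => Or.inl h)
        fun r htr => Or.inr ⟨rfl, ?_⟩
      rw [NiceTreeDecomposition.child_iff] at htr
      generalize D.node t = a at *
      cases a <;>
        simp_all [NodeType.tag, NodeType.HasChild, NodeType.child₁, Fin.val_inj]
    obtain ⟨r, htr, hr'⟩ := NiceTreeDecomposition.exists_child₂ hb'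
    -- The two children of a join are distinct, so after the first push the second child has not yet
    -- been recorded as found.
    have hrq : r ≠ q := by
      generalize ha : D.node t = a at *
      cases a <;> simp [NodeType.tag] at hb'
      have := (NiceTreeDecomposition.valid_of_node ha).1
      rintro rfl
      exact this (Fin.ext (hq'.trans hr'.symm))
    refine Runs.setNat_seq (Runs.setNat ?_)
    have e4 : (NExp.input .child₂ (.var vT) (.const 0) : CExp).eval (connectedInput I G D) s₂ = r := by
      rw [← hr', ← input_child₂ t 0, ← ht₂]
      rfl
    have e5 : (NExp.var vTail : CExp).eval (connectedInput I G D) s₂ = m + 1 := hm₂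
    have e6 : (NExp.plus (.var vTail) (.const 1) : CExp).eval (connectedInput I G D)
        (s₂.setNat aOrd (m + 1) r) = m + 2 := congrArg (· + 1) hm₂
    rw [e4, e5, e6]
    set s₃ := (s₂.setNat aOrd (m + 1) r).setNat vTail
      ((NExp.const 0 : CExp).eval (connectedInput I G D) (s₂.setNat aOrd (m + 1) r)) (m + 2) with hs₃
    have hm₃ : s₃.nat vTail 0 = m + 2 := by simp [hs₃, State.setNat_nat, NExp.eval]
    have ho₃ : ∀ j, s₃.nat aOrd j = if j = m + 1 then (r : ℕ) else s₂.nat aOrd j := by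
      intro j
      simp [hs₃, State.setNat_nat]
    have hq₃ := hq₂.push (by omega) hot₂ htr (by simp [hrq]) ho₃
    rw [hm₃]
    refine hall hq₃ (by omega) (by rw [ho₃, if_neg (by omega), hot₂]) (fun j _ h => by omega)
      (fun j _ h => Or.inl (Or.inl h)) fun r' htr' => ?_
    rw [NiceTreeDecomposition.child_iff] at htr'
    generalize D.node t = a at *
    cases a <;> simp [NodeType.tag] at hb'
    simp only [NodeType.HasChild, NodeType.child₁, NodeType.child₂] at *
    rcases htr' with h | h
    · exact Or.inl (Or.inr ⟨trivial, Fin.ext (by rw [h, hq'])⟩)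
    · exact Or.inr ⟨trivial, Fin.ext (by rw [h, hr'])⟩
  · rintro s' ⟨hle, hq⟩ -
    have := hq.card_le
    have e : s'.nat vTail 0 = D.N := by omega
    rw [e] at hq
    exact hq.exists_isOrder
  · simp only [NExp.cost, Nat.sub_zero, add_assoc, Nat.reduceAdd]
    omega

end order

end RealRAM

/-! ### Filling all tables and selecting an entry of the root. -/

namespace RealRAM

section table

variable {I : KMedianInstance} {G : SimpleGraph (Fin I.n)} {D : NiceTreeDecomposition G}
  {W X : ℕ} {med : ℕ → ℕ} {pos : Fin D.N → ℕ} {s : State}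

/-- The order is traversed backwards, so children come before their parents. After `i` rounds
exactly the nodes at positions from `N - i` on are claimed to have tables. -/
theorem tableProg_spec (hX : Room D W X) (hord : D.IsOrder (s.nat aOrd) pos)
    (hmed : s.nat aMed = med) (hbase : s.nat aBase 0 = 0) (htop : s.nat vTop 0 = 0) :
    RunsIn (connectedInput I G D) ((D.N + 1) * (tableBody.bound X + 16)) tableProg s
      fun s' => ∀ t, D.IsTable I.k W (medCost I med) (s'.entry I.n) (s'.nat aFst) (s'.nat aLst) t ∧
        ∀ e < s'.nat aLst t, s'.nat aBase e = e * I.n := by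
  refine (RunsIn.for' (X := X) (c := vI) 0 D.N (fun i s' =>
    (∀ e ≤ s'.nat vTop 0, s'.nat aBase e = e * I.n) ∧
    ∀ t, D.N ≤ pos t + i → D.IsTable I.k W (medCost I med) (s'.entry I.n) (s'.nat aFst)
      (s'.nat aLst) t ∧ s'.nat aLst t ≤ s'.nat vTop 0) ?_ rfl rfl
    (Nat.zero_le _) (fun _ _ _ _ => rfl) ?_ ?_
    (R := fun s' => ∀ t, D.IsTable I.k W (medCost I med) (s'.entry I.n) (s'.nat aFst)
      (s'.nat aLst) t ∧ ∀ e < s'.nat aLst t, s'.nat aBase e = e * I.n) ?_).mono ?_ fun _ h => h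
  · intro j s v h
    rw [entry_setNat_of_lt (by omega)]
    exact h
  · refine ⟨fun e he => ?_, fun t ht => ?_⟩
    · rw [htop] at he
      rw [Nat.le_zero.1 he, hbase, zero_mul]
    · have := hord.lt t
      omega
  · rintro i s₁ - hi hF₁ ⟨hb, htab⟩ hc
    obtain ⟨t, ht⟩ := hord.surj (D.N - (i + 1)) (by omega)
    refine Runs.setNat_seq ?_
    have e0 : (NExp.read aOrd (.minus (.input .numNodes (.const 0) (.const 0))
        (.plus (.var vI) (.const 1))) : CExp).eval (connectedInput I G D) s₁ = t := by
      have : (NExp.read aOrd (.minus (.input .numNodes (.const 0) (.const 0))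
        (.plus (.var vI) (.const 1))) : CExp).eval (connectedInput I G D) s₁ =
        s₁.nat aOrd (D.N - (s₁.nat vI 0 + 1)) := rfl
      rw [this, hc, hF₁.nat aOrd rfl, ← ht, hord.eq]
    rw [e0]
    have hent : ∀ j, (s₁.setNat vT j t).entry I.n = s₁.entry I.n :=
      fun j => entry_setNat_of_lt (by omega)
    refine (nodeProg_spec (s := s₁.setNat vT 0 t) (t := t) (med := med) hX ?_
      ((hF₁.nat aMed rfl).trans hmed) hb ?_).mono ?_
    · simp [State.setNat_nat]
    · intro q hq
      rw [hent]
      refine htab q ?_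
      have := hord.child t q hq
      omega
    rintro s₂ ⟨h1, h2, h3, h4, h5, h6⟩
    rw [hent] at h6
    refine ⟨h2, fun q hq => ?_⟩
    by_cases hqt : q = t
    · subst hqt
      exact ⟨h1, h4⟩
    have hqi : D.N ≤ pos q + i := by
      have : pos q ≠ pos t := fun h => hqt (by
        have e1 := hord.eq q
        rw [h, hord.eq t] at e1
        exact (Fin.ext e1).symm)
      omega
    obtain ⟨a1, a2⟩ := htab q hqi
    have a3 : s₂.nat aLst q ≤ s₂.nat vTop 0 := by
      rw [(h5 q hqt).2]
      exact a2.trans h3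
    -- The current node `t` precedes all nodes treated earlier, so it is not a child of any of them,
    -- and their tables do not depend on what has just been written.
    refine ⟨a1.congr (fun r hr => h5 r ?_) (h5 q hqt).1 (h5 q hqt).2 (fun r hr e he => h6 e ?_)
      fun e he => h6 e (he.trans_le a2), a3⟩
    · rintro rfl
      have := hord.child q r hr
      omega
    · have := hord.child q r hr
      exact he.trans_le (htab r (by omega)).2
  · rintro s' ⟨hb, h⟩ - t
    obtain ⟨h1, h2⟩ := h t (by omega)
    exact ⟨h1, fun e he => hb e (by omega)⟩
  · simp only [NExp.cost, Nat.sub_zero, add_assoc, Nat.reduceAdd]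
    exact le_rfl

/-- The search for an entry of the root with `k` clusters. -/
theorem selectProg_spec {F L : ℕ → ℕ} (hF : s.nat aFst = F) (hL : s.nat aLst = L)
    (hle : F D.root ≤ L D.root) (hX : L D.root - F D.root ≤ X) :
    Runs (connectedInput I G D) X selectProg s fun s' =>
      (s'.nat vFnd 0 = 0 ∧ ∀ e, F D.root ≤ e → e < L D.root → (s.entry I.n e).cnt ≠ I.k) ∨
      (s'.nat vFnd 0 = 1 ∧ F D.root ≤ s'.nat aSel D.root ∧ s'.nat aSel D.root < L D.root ∧
        (s.entry I.n (s'.nat aSel D.root)).cnt = I.k) := by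
  refine Runs.setNat_seq (Runs.setNat_seq ?_)
  refine Runs.for (F D.root) (L D.root) (fun j s' =>
      (s'.nat vFnd 0 = 0 ∧ ∀ e, F D.root ≤ e → e < j → (s.entry I.n e).cnt ≠ I.k) ∨
      (s'.nat vFnd 0 = 1 ∧ F D.root ≤ s'.nat aSel D.root ∧ s'.nat aSel D.root < L D.root ∧
        (s.entry I.n (s'.nat aSel D.root)).cnt = I.k)) (fun _ _ _ h => h) rfl ?_ hle hX ?_ ?_ ?_
    fun s' h _ => h
  · rw [← hF]
    rfl
  · intro j s' hF' _
    have h1 : s'.nat aLst = L := (hF'.nat aLst rfl).trans hL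
    have h2 : s'.nat vT 0 = D.root := congrFun (hF'.nat vT rfl) 0
    simp only [NExp.eval, h1, h2]
  · exact Or.inl ⟨rfl, fun e h1 h2 => by omega⟩
  · intro j s₁ hj hj' hF₁ hJ hc
    have hent : s₁.entry I.n = s.entry I.n := hF₁.entry rfl rfl rfl rfl rfl rfl
    have hT : s₁.nat vT 0 = D.root := congrFun (hF₁.nat vT rfl) 0
    have hcnt : (NExp.read aCnt (.var vE₁) : CExp).eval (connectedInput I G D) s₁ =
        (s.entry I.n j).cnt := by
      rw [← hent, ← hc]
      rfl
    refine Runs.cond (fun hb => ?_) (fun hb => ?_) <;> rw [BExp.holds_eq, hcnt] at hb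
    · refine Runs.setNat_seq (Runs.setNat (Or.inr ?_))
      have e1 : (NExp.var vT : CExp).eval (connectedInput I G D) (s₁.setNat vFnd 0 1) = D.root := hT
      have e2 : (NExp.var vE₁ : CExp).eval (connectedInput I G D) (s₁.setNat vFnd 0 1) = j := hc
      change _ = 1 ∧ _
      simp only [NExp.eval] at e1 e2 ⊢
      rw [e1, e2, State.setNat_nat_self]
      exact ⟨rfl, hj, hj', hb⟩
    · refine Runs.skip ?_
      rcases hJ with ⟨h1, h2⟩ | h
      · refine Or.inl ⟨h1, fun e he he' => ?_⟩
        rcases Nat.lt_succ_iff_lt_or_eq.1 he' with h | rfl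
        · exact h2 e he h
        · exact hb
      · exact Or.inr h

end table

end RealRAM

/-! ### Following the origins of an entry from the root. -/

namespace NiceTreeDecomposition

variable {n : ℕ} {G : SimpleGraph (Fin n)} {D : NiceTreeDecomposition G}

theorem Child.one_le_tag {t q : Fin D.N} (h : D.Child t q) : 1 ≤ (D.node t).tag := by
  rw [child_iff] at h
  revert h
  cases D.node t <;> simp [NodeType.tag, NodeType.HasChild]

theorem Child.eq_child {t q : Fin D.N} (h : D.Child t q) :
    (D.node t).child₁ = q ∨ 4 ≤ (D.node t).tag ∧ (D.node t).child₂ = q := by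
  rw [child_iff] at h
  revert h
  cases D.node t <;> simp only [NodeType.tag, NodeType.HasChild, NodeType.child₁, NodeType.child₂]
  · exact False.elim
  · rintro rfl
    exact Or.inl rfl
  · rintro rfl
    exact Or.inl rfl
  · rintro rfl
    exact Or.inl rfl
  · rintro (rfl | rfl)
    · exact Or.inl rfl
    · exact Or.inr ⟨le_rfl, rfl⟩

/-- Values at the nodes may be defined from the root to the leaves. -/
theorem exists_topDown {α : Type*} (a : α) (f : Fin D.N → α → α) :
    ∃ S : Fin D.N → α, S D.root = a ∧ ∀ t q, D.Child t q → S q = f q (S t) := by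
  classical
  let par : Fin D.N → Fin D.N := fun q => if h : ∃ t, D.Child t q then h.choose else D.root
  have hpar : ∀ t q, D.Child t q → par q = t := by
    intro t q h
    have h' : ∃ t, D.Child t q := ⟨t, h⟩
    simp only [par, dif_pos h']
    exact h'.choose_spec.unique h
  -- Recursion on depth: the value of `q` at stage `m + 1` is computed from the value of its parent
  -- at stage `m`. Evaluating at the depth of the node gives the desired assignment.
  let S : ℕ → Fin D.N → α := fun m => Nat.rec (fun _ => a) (fun _ S q => f q (S (par q))) m
  refine ⟨fun q => S (D.T.dist D.root q) q, by simp [S], fun t q h => ?_⟩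
  dsimp only
  rw [h.dist, ← hpar t q h]

variable {k W : ℕ} {g : Fin n → ℕ → ℝ} {ent : ℕ → Entry n} {F L : ℕ → ℕ}

/-- The entries from which an entry of the root was obtained. -/
structure IsSelection (D : NiceTreeDecomposition G) (ent : ℕ → Entry n) (F L : ℕ → ℕ) (e : ℕ)
    (sel : Fin D.N → ℕ) : Prop where
  root : sel D.root = e
  le : ∀ t : Fin D.N, F t ≤ sel t
  lt : ∀ t : Fin D.N, sel t < L t
  ptr₁ : ∀ t q, D.Child t q → (D.node t).child₁ = q → sel q = (ent (sel t)).p₁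
  ptr₂ : ∀ t q, D.Child t q → 4 ≤ (D.node t).tag → (D.node t).child₂ = q →
    sel q = (ent (sel t)).p₂

theorem exists_isSelection (h : ∀ t, D.IsTable k W g ent F L t) {e : ℕ} (he : F D.root ≤ e)
    (he' : e < L D.root) : ∃ sel, D.IsSelection ent F L e sel := by
  -- The node is carried along with the entry, because a child must know its parent in order to
  -- decide which of the two pointers leads to it.
  obtain ⟨S, hS, hS'⟩ := exists_topDown (D := D) (α := ℕ × Fin D.N) (e, D.root) fun q a =>
    (if (D.node a.2).child₁ = q then (ent a.1).p₁ else (ent a.1).p₂, q)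
  have hsnd : ∀ t, (S t).2 = t := by
    intro t
    by_cases ht : t = D.root
    · rw [ht, hS]
    · obtain ⟨p, hp⟩ := exists_parent ht
      rw [hS' p t hp]
  have hptr₁ : ∀ t q, D.Child t q → (D.node t).child₁ = q → (S q).1 = (ent (S t).1).p₁ := by
    intro t q hq hq'
    rw [hS' t q hq, hsnd, if_pos hq']
  have hptr₂ : ∀ t q, D.Child t q → 4 ≤ (D.node t).tag → (D.node t).child₂ = q →
      (S q).1 = (ent (S t).1).p₂ := by
    intro t q hq ht hq'
    rw [hS' t q hq, hsnd, if_neg]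
    intro h
    generalize ha : D.node t = a at *
    cases a <;> simp [NodeType.tag] at ht
    exact (valid_of_node ha).1 (Fin.ext (h.trans hq'.symm))
  have hin : ∀ t : Fin D.N, F t ≤ (S t).1 ∧ (S t).1 < L t := by
    intro t
    induction t using down_induction with
    | h0 =>
      rw [hS]
      exact ⟨he, he'⟩
    | h t q hq ih =>
      have hr := ((h t).sound _ ih.1 ih.2).1
      rcases hq.eq_child with h1 | ⟨h1, h2⟩
      · rw [hptr₁ t q hq h1, ← h1]
        exact hr.1 hq.one_le_tag
      · rw [hptr₂ t q hq h1 h2, ← h2]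
        exact hr.2 h1
  exact ⟨fun t => (S t).1, by rw [hS], fun t => (hin t).1, fun t => (hin t).2, hptr₁, hptr₂⟩

/-- Each table entry is sound with respect to its own pointers, and by construction these point to
the entries selected at the children. -/
theorem IsSelection.consistent {e : ℕ} {sel : Fin D.N → ℕ} (hs : D.IsSelection ent F L e sel)
    (h : ∀ t, D.IsTable k W g ent F L t) :
    D.Consistent k g fun i => ent (nodeTable sel i) := by
  intro t
  obtain ⟨-, ⟨c, h2, h3⟩, h4⟩ := (h t).sound _ (hs.le t) (hs.lt t)
  have a1 : 1 ≤ (D.node t).tag →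
      ent (nodeTable sel (D.node t).child₁) = ent (ent (sel t)).p₁ := by
    intro ht
    obtain ⟨q, hq, hq'⟩ := exists_child₁ ht
    rw [hq', RealRAM.nodeTable_coe, hs.ptr₁ t q hq hq']
  have a2 : 4 ≤ (D.node t).tag →
      ent (nodeTable sel (D.node t).child₂) = ent (ent (sel t)).p₂ := by
    intro ht
    obtain ⟨q, hq, hq'⟩ := exists_child₂ ht
    rw [hq', RealRAM.nodeTable_coe, hs.ptr₂ t q hq ht hq']
  refine ⟨c, (NodeType.feas_congr a1 a2).2 h2, ?_, ?_⟩
  · dsimp only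
    rw [RealRAM.nodeTable_coe]
    exact (NodeType.leads_congr a1 a2).2 h3
  · dsimp only
    rw [RealRAM.nodeTable_coe, h4, NodeType.newCost_congr a1 a2]

/-- Bag vertices of `t` are forgotten at earlier positions of the order. When a vertex forgotten at
`t` copies a cluster number from the bag, that number is thus already known. -/
theorem IsOrder.forgetNode_lt {o : ℕ → ℕ} {pos : Fin D.N → ℕ} (h : D.IsOrder o pos) {t : Fin D.N}
    {u : Fin n} (hu : u ∈ D.bag t) : pos (D.forgetNode u) < pos t := by
  induction t using down_induction with
  | h0 => simp [D.bag_root] at hu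
  | h p t hpt ih =>
    rcases hpt.mem_bag_or_forgets hu with h' | h'
    · exact (ih h').trans (h.child p t hpt)
    · obtain ⟨s, hs⟩ := NodeType.forgets_iff.1 h'
      rw [forgetNode_eq hs]
      exact h.child p t hpt

theorem IsOrder.inj {o : ℕ → ℕ} {pos : Fin D.N → ℕ} (h : D.IsOrder o pos) {t t' : Fin D.N}
    (htt : pos t = pos t') : t = t' := by
  refine Fin.ext ?_
  rw [← h.eq t, htt, h.eq t']

end NiceTreeDecomposition

namespace RealRAM

theorem State.setNat_nat_eq_update (s : State) (a i v : ℕ) :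
    (s.setNat a i v).nat a = Function.update (s.nat a) i v := by
  funext j
  simp [State.setNat_nat, Function.update_apply]

section descend

variable {I : KMedianInstance} {G : SimpleGraph (Fin I.n)} {D : NiceTreeDecomposition G}
  {W X : ℕ} {med : ℕ → ℕ} {pos : Fin D.N → ℕ} {s : State}

/-- The vertex `v` either takes over the number of some companion or opens cluster `m`, with itself
as provisional center and its own facility as that of the cluster. -/
theorem clusterProg_spec {t : Fin D.N} {v : Fin I.n} {e m : ℕ} (ht : s.nat vT 0 = t)
    (hX : (D.bag t).card ≤ X) (hv : s.nat vV 0 = v) (hvt : v ∉ D.bag t) (he : s.nat vE₂ 0 = e)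
    (hb : s.nat aBase e = e * I.n) (hm : s.nat vCtr 0 = m) :
    Runs (connectedInput I G D) X clusterProg s fun s' =>
      ((∃ u ∈ D.bag t, (s.entry I.n e).lab u = (s.entry I.n e).lab v ∧
          s'.nat oClus = Function.update (s.nat oClus) v (s.nat oClus u)) ∧
        s'.nat oCen = s.nat oCen ∧ s'.nat aCF = s.nat aCF ∧ s'.nat vCtr 0 = m) ∨
      ((∀ u ∈ D.bag t, (s.entry I.n e).lab u ≠ (s.entry I.n e).lab v) ∧
        s'.nat oClus = Function.update (s.nat oClus) v m ∧
        s'.nat oCen = Function.update (s.nat oCen) m v ∧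
        s'.nat aCF = Function.update (s.nat aCF) m ((s.entry I.n e).fac v) ∧
        s'.nat vCtr 0 = m + 1) := by
  refine Runs.setNat_seq (Runs.seq' (R₁ := fun s' =>
    (s'.nat vFnd 0 = 1 ∧ ∃ u ∈ D.bag t, (s.entry I.n e).lab u = (s.entry I.n e).lab v ∧
      s'.nat oClus = Function.update (s.nat oClus) v (s.nat oClus u)) ∨
    (s'.nat vFnd 0 = 0 ∧ s'.nat oClus = s.nat oClus ∧
      ∀ u ∈ D.bag t, (s.entry I.n e).lab u ≠ (s.entry I.n e).lab v)) ?_ ?_)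
  · refine Runs.forBag t (fun A s' =>
      (s'.nat vFnd 0 = 1 ∧ ∃ u ∈ D.bag t, (s.entry I.n e).lab u = (s.entry I.n e).lab v ∧
        s'.nat oClus = Function.update (s.nat oClus) v (s.nat oClus u)) ∨
      (s'.nat vFnd 0 = 0 ∧ s'.nat oClus = s.nat oClus ∧
        ∀ u ∈ A, (s.entry I.n e).lab u ≠ (s.entry I.n e).lab v)) ht hX
      (fun _ _ _ h => h) (fun _ _ _ h => h) rfl rfl rfl (Or.inr ⟨rfl, rfl, by simp⟩) ?_
      fun s' h _ => h
    intro A u s' hut huA hA hF hJ hu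
    have hent : s'.entry I.n = s.entry I.n := hF.entry rfl rfl rfl rfl rfl rfl
    have he' : s'.nat vE₂ 0 = e := (congrFun (hF.nat vE₂ rfl) 0).trans he
    have hb' : s'.nat aBase e = e * I.n := (congrFun (hF.nat aBase rfl) e).trans hb
    have hv' : s'.nat vV 0 = v := (congrFun (hF.nat vV rfl) 0).trans hv
    refine Runs.cond (fun h => ?_) (fun h => ?_) <;>
      rw [BExp.holds_eq, eval_labExp (eE := .var vE₂) (uE := .var vU) he' hu hb',
        eval_labExp (eE := .var vE₂) (uE := .var vV) he' hv' hb', hent] at h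
    · refine Runs.setNat_seq (Runs.setNat (Or.inl ⟨rfl, u, hut, h, ?_⟩))
      have e1 : (NExp.var vV : CExp).eval (connectedInput I G D) (s'.setNat vFnd 0 1) = v := hv'
      have e2 : (NExp.read oClus (.var vU) : CExp).eval (connectedInput I G D)
          (s'.setNat vFnd 0 1) = s'.nat oClus u := by
        rw [← hu]
        rfl
      simp only [NExp.eval] at e1 e2 ⊢
      rw [e1, e2, State.setNat_nat_eq_update]
      -- As `v` is not in the bag, an earlier write of its number cannot have altered the number of
      -- `u` read now; with several companions the last write prevails.
      have huv : (u : ℕ) ≠ v := fun h => hvt (Fin.ext h ▸ hut)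
      change Function.update (s'.nat oClus) _ _ = _
      rcases hJ with ⟨-, w, -, -, h3⟩ | ⟨-, h3, -⟩
      · rw [h3, Function.update_idem, Function.update_of_ne huv]
      · rw [h3]
    · refine Runs.skip ?_
      rcases hJ with h1 | ⟨h1, h2, h3⟩
      · exact Or.inl h1
      · refine Or.inr ⟨h1, h2, fun w hw => ?_⟩
        rcases Finset.mem_insert.1 hw with rfl | hw
        · exact h
        · exact h3 w hw
  intro s' hJ hF
  have hent : s'.entry I.n = s.entry I.n := hF.entry rfl rfl rfl rfl rfl rfl
  have he' : s'.nat vE₂ 0 = e := (congrFun (hF.nat vE₂ rfl) 0).trans he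
  have hb' : s'.nat aBase e = e * I.n := (congrFun (hF.nat aBase rfl) e).trans hb
  have hv' : s'.nat vV 0 = v := (congrFun (hF.nat vV rfl) 0).trans hv
  have hm' : s'.nat vCtr 0 = m := (congrFun (hF.nat vCtr rfl) 0).trans hm
  have hcen : s'.nat oCen = s.nat oCen := hF.nat oCen rfl
  have hcf : s'.nat aCF = s.nat aCF := hF.nat aCF rfl
  refine Runs.cond (fun h => ?_) (fun h => ?_) <;> simp only [BExp.Holds, NExp.eval] at h
  · rcases hJ with ⟨h1, -⟩ | ⟨-, h2, h3⟩
    · omega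
    refine Runs.setNat_seq (Runs.setNat_seq (Runs.setNat_seq (Runs.setNat (Or.inr ⟨h3, ?_⟩))))
    have e1 : (NExp.var vV : CExp).eval (connectedInput I G D) s' = v := hv'
    have e2 : (NExp.var vCtr : CExp).eval (connectedInput I G D) s' = m := hm'
    rw [e1, e2]
    have e3 : (NExp.var vV : CExp).eval (connectedInput I G D) (s'.setNat oClus v m) = v := hv'
    have e4 : (NExp.var vCtr : CExp).eval (connectedInput I G D) (s'.setNat oClus v m) = m := hm'
    rw [e3, e4]
    have e5 : (facExp (.var vE₂) (.var vV)).eval (connectedInput I G D)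
        ((s'.setNat oClus v m).setNat oCen m v) = (s.entry I.n e).fac v := by
      rw [← hent]
      exact eval_facExp (x := connectedInput I G D) (s := s') (eE := .var vE₂) (uE := .var vV)
        he' hv' hb'
    have e6 : (NExp.var vCtr : CExp).eval (connectedInput I G D)
        ((s'.setNat oClus v m).setNat oCen m v) = m := hm'
    rw [e5, e6]
    have e7 : (NExp.plus (.var vCtr) (.const 1) : CExp).eval (connectedInput I G D)
        (((s'.setNat oClus v m).setNat oCen m v).setNat aCF m ((s.entry I.n e).fac v)) = m + 1 :=
      congrArg (· + 1) hm'
    rw [e7]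
    refine ⟨?_, ?_, ?_, rfl⟩
    · rw [← h2, ← State.setNat_nat_eq_update]
      rfl
    · rw [← hcen, ← State.setNat_nat_eq_update]
      rfl
    · rw [← hcf, ← State.setNat_nat_eq_update]
      rfl
  · rcases hJ with ⟨-, h2⟩ | ⟨h1, -⟩
    · exact Runs.skip (Or.inl ⟨h2, hcen, hcf, hm'⟩)
    · omega

end descend

end RealRAM

/-! ### Assigning cluster numbers from the root to the leaves. -/

namespace NiceTreeDecomposition

variable {n : ℕ} {G : SimpleGraph (Fin n)}

/-- The nodes before position `i` have been treated in the construction of the clusters. -/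
structure IsDescended (D : NiceTreeDecomposition G) (pos : Fin D.N → ℕ) (sel : Fin D.N → ℕ)
    (E : ℕ → Entry n) (i : ℕ) (asel clus cen cf : ℕ → ℕ) (m : ℕ) : Prop where
  sel : ∀ q : Fin D.N, (q = D.root ∨ ∃ t, D.Child t q ∧ pos t < i) → asel q = sel q
  founder : ∀ v : Fin n, pos (D.forgetNode v) < i → D.Founder E v →
    clus v < m ∧ cen (clus v) = v ∧ cf (clus v) = (D.lastEntry E v).fac v
  surj : ∀ j < m, ∃ v : Fin n, pos (D.forgetNode v) < i ∧ D.Founder E v ∧ clus v = j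
  follow : ∀ v : Fin n, pos (D.forgetNode v) < i → ¬ D.Founder E v →
    ∃ u ∈ D.bag (D.forgetNode v), (D.lastEntry E v).lab u = (D.lastEntry E v).lab v ∧
      clus v = clus u

variable {D : NiceTreeDecomposition G} {pos sel : Fin D.N → ℕ} {o : ℕ → ℕ} {E : ℕ → Entry n}
  {i m : ℕ} {asel asel' clus cen cf : ℕ → ℕ} {t : Fin D.N}

theorem IsDescended.sel_succ (h : D.IsDescended pos sel E i asel clus cen cf m)
    (ho : D.IsOrder o pos) (ht : pos t = i)
    (h1 : ∀ q, D.Child t q → asel' q = sel q) (h2 : ∀ q : Fin D.N, ¬ D.Child t q → asel' q = asel q)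
    (q : Fin D.N) (hq : q = D.root ∨ ∃ p, D.Child p q ∧ pos p < i + 1) : asel' q = sel q := by
  by_cases htq : D.Child t q
  · exact h1 q htq
  · rw [h2 q htq]
    refine h.sel q ?_
    rcases hq with hq | ⟨p, hp, hpi⟩
    · exact Or.inl hq
    · refine Or.inr ⟨p, hp, (Nat.lt_succ_iff_lt_or_eq.1 hpi).resolve_right fun hpi => htq ?_⟩
      rwa [← ho.inj (hpi.trans ht.symm)]

theorem IsDescended.succ_of_not_forget (h : D.IsDescended pos sel E i asel clus cen cf m)
    (ho : D.IsOrder o pos) (ht : pos t = i)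
    (h1 : ∀ q, D.Child t q → asel' q = sel q) (h2 : ∀ q : Fin D.N, ¬ D.Child t q → asel' q = asel q)
    (hn : ∀ v q, D.node t ≠ .forget v q) :
    D.IsDescended pos sel E (i + 1) asel' clus cen cf m := by
  have hlt : ∀ v, pos (D.forgetNode v) < i + 1 → pos (D.forgetNode v) < i := by
    intro v hv
    refine (Nat.lt_succ_iff_lt_or_eq.1 hv).resolve_right fun hv => ?_
    obtain ⟨q, hq⟩ := D.exists_node_forgetNode v
    rw [ho.inj (hv.trans ht.symm)] at hq
    exact hn v q hq
  refine ⟨h.sel_succ ho ht h1 h2, fun v hv => h.founder v (hlt v hv), fun j hj => ?_,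
    fun v hv => h.follow v (hlt v hv)⟩
  obtain ⟨v, hv, hv'⟩ := h.surj j hj
  exact ⟨v, by omega, hv'⟩

/-- The only vertex newly treated is `v`. Its number is written once, no vertex treated earlier
equals `v`, and companions of treated vertices were treated before them, so all earlier claims
persist. -/
theorem IsDescended.succ_of_forget (h : D.IsDescended pos sel E i asel clus cen cf m)
    (ho : D.IsOrder o pos) (ht : pos t = i)
    (h1 : ∀ q, D.Child t q → asel' q = sel q) (h2 : ∀ q : Fin D.N, ¬ D.Child t q → asel' q = asel q)
    {v : Fin n} {q : Fin D.N} (hn : D.node t = .forget v q) {clus' cen' cf' : ℕ → ℕ} {m' : ℕ}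
    (hc : ((∃ u ∈ D.bag t, (E q).lab u = (E q).lab v ∧
          clus' = Function.update clus v (clus u)) ∧ cen' = cen ∧ cf' = cf ∧ m' = m) ∨
      ((∀ u ∈ D.bag t, (E q).lab u ≠ (E q).lab v) ∧ clus' = Function.update clus v m ∧
        cen' = Function.update cen m v ∧ cf' = Function.update cf m ((E q).fac v) ∧ m' = m + 1)) :
    D.IsDescended pos sel E (i + 1) asel' clus' cen' cf' m' := by
  have hft : D.forgetNode v = t := forgetNode_eq hn
  have hlt : ∀ u, u ≠ v → pos (D.forgetNode u) < i + 1 → pos (D.forgetNode u) < i := by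
    intro u huv hu
    refine (Nat.lt_succ_iff_lt_or_eq.1 hu).resolve_right fun hu => huv ?_
    obtain ⟨q', hq'⟩ := D.exists_node_forgetNode u
    rw [ho.inj (hu.trans ht.symm), hn] at hq'
    injection hq' with h
    exact h.symm
  have hne : ∀ u, pos (D.forgetNode u) < i → u ≠ v := by
    rintro u hu rfl
    rw [hft] at hu
    omega
  have hbag : ∀ u, u ∈ D.bag t → u ≠ v := fun u hu => hne u (ht ▸ ho.forgetNode_lt hu)
  have hupd : ∀ (a : ℕ) (u : Fin n), u ≠ v → Function.update clus v a u = clus u := fun a u hu =>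
    Function.update_of_ne (fun h => hu (Fin.ext h)) _ _
  rcases hc with ⟨⟨u, hu, hlab, rfl⟩, rfl, rfl, rfl⟩ | ⟨hlab, rfl, rfl, rfl, rfl⟩
  · have hnf : ¬ D.Founder E v := by
      rw [founder_iff hn, not_not]
      exact ⟨u, hu, hlab⟩
    refine ⟨h.sel_succ ho ht h1 h2, fun w hw hwf => ?_, fun j hj => ?_, fun w hw hwf => ?_⟩
    · have hwv : w ≠ v := by
        rintro rfl
        exact hnf hwf
      rw [hupd _ _ hwv]
      exact h.founder w (hlt w hwv hw) hwf
    · obtain ⟨w, hw, hwf, hwj⟩ := h.surj j hj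
      refine ⟨w, by omega, hwf, ?_⟩
      rw [hupd _ _ (hne w hw), hwj]
    · by_cases hwv : w = v
      · subst hwv
        rw [hft, lastEntry_eq hn]
        exact ⟨u, hu, hlab, by rw [Function.update_self, hupd _ _ (hbag u hu)]⟩
      · have hwi := hlt w hwv hw
        obtain ⟨x, hx, hxl, hxc⟩ := h.follow w hwi hwf
        refine ⟨x, hx, hxl, ?_⟩
        rw [hupd _ _ hwv, hupd _ _ (hne x ((ho.forgetNode_lt hx).trans hwi)), hxc]
  · have hf : D.Founder E v := by
      rw [founder_iff hn]
      rintro ⟨u, hu, hu'⟩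
      exact hlab u hu hu'
    refine ⟨h.sel_succ ho ht h1 h2, fun w hw hwf => ?_, fun j hj => ?_, fun w hw hwf => ?_⟩
    · by_cases hwv : w = v
      · subst hwv
        rw [lastEntry_eq hn]
        simp
      · rw [hupd _ _ hwv]
        obtain ⟨a1, a2, a3⟩ := h.founder w (hlt w hwv hw) hwf
        rw [Function.update_of_ne a1.ne, Function.update_of_ne a1.ne]
        exact ⟨by omega, a2, a3⟩
    · rcases Nat.lt_succ_iff_lt_or_eq.1 hj with hj | rfl
      · obtain ⟨w, hw, hwf, hwj⟩ := h.surj j hj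
        refine ⟨w, by omega, hwf, ?_⟩
        rw [hupd _ _ (hne w hw), hwj]
      · exact ⟨v, by rw [hft]; omega, hf, by simp⟩
    · have hwv : w ≠ v := by
        rintro rfl
        exact hwf hf
      have hwi := hlt w hwv hw
      obtain ⟨x, hx, hxl, hxc⟩ := h.follow w hwi hwf
      refine ⟨x, hx, hxl, ?_⟩
      rw [hupd _ _ hwv, hupd _ _ (hne x ((ho.forgetNode_lt hx).trans hwi)), hxc]

/-- The clusters that result from the construction. -/
theorem IsDescended.clustering {k : ℕ} {g : Fin n → ℕ → ℝ}
    (h : D.IsDescended pos sel E D.N asel clus cen cf m) (ho : D.IsOrder o pos)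
    (hE : D.Consistent k g E) (hroot : (E D.root).cnt = k) :
    (∀ v : Fin n, clus v < k) ∧
      (∀ i < k, (G.induce {v : Fin n | clus v = i}).Connected) ∧
      (∀ i < k, ∃ c : Fin n, cen i = c ∧ clus c = i) ∧
      (∀ v : Fin n, cf (clus v) = (D.lastEntry E v).fac v) ∧
      ∑ v : Fin n, g v (cf (clus v)) = (E D.root).cost := by
  have hpos : ∀ v, pos (D.forgetNode v) < D.N := fun v => ho.lt _
  -- Before centers are moved, the center of a cluster is its founder, so the founder can be
  -- recovered from the cluster number.
  have hinj : ∀ u v : Fin n, D.Founder E u → D.Founder E v → clus u = clus v → u = v := by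
    intro u v hu hv huv
    refine Fin.ext ?_
    rw [← (h.founder u (hpos u) hu).2.1, huv, (h.founder v (hpos v) hv).2.1]
  obtain ⟨rfl, h1, h2, h3⟩ := hE.clustering (clus := fun v : Fin n => clus v)
    (fun v => h.follow v (hpos v)) hroot (fun v hv => (h.founder v (hpos v) hv).1) hinj
    (fun i hi => by
      obtain ⟨v, -, hv⟩ := h.surj i hi
      exact ⟨v, hv⟩)
  have h4 : ∀ v : Fin n, cf (clus v) = (D.lastEntry E v).fac v := by
    intro v
    obtain ⟨u, hu, hu', huv⟩ := h.surj _ (h1 v)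
    rw [← huv, (h.founder u hu hu').2.2, h3 u v huv]
  refine ⟨h1, h2, fun i hi => ?_, h4, ?_⟩
  · obtain ⟨v, hv, hv', rfl⟩ := h.surj i hi
    exact ⟨v, (h.founder v hv hv').2.1, rfl⟩
  · rw [hE.cost_root]
    exact Finset.sum_congr rfl fun v _ => by rw [h4]

end NiceTreeDecomposition

namespace RealRAM

section descend

variable {I : KMedianInstance} {G : SimpleGraph (Fin I.n)} {D : NiceTreeDecomposition G}
  {W X : ℕ} {med : ℕ → ℕ} {pos sel : Fin D.N → ℕ} {s : State} {ent : ℕ → Entry I.n} {F L : ℕ → ℕ}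
  {e : ℕ} {t : Fin D.N}

/-- The pointers of the selected entry become the selections of the children. At a forget node `vE₂`
then holds the selected entry of the child, the last one in which the forgotten vertex occurs, and
this is what `clusterProg` inspects. -/
theorem descendNodeProg_spec (hX : (D.bag t).card ≤ X) (ht : s.nat vT 0 = t)
    (hs : D.IsSelection ent F L e sel) (hent : s.entry I.n = ent)
    (hb : ∀ (q : Fin D.N), ∀ e < L q, s.nat aBase e = e * I.n) (hsel : s.nat aSel t = sel t) :
    Runs (connectedInput I G D) X descendNodeProg s fun s' =>
      (∀ q, D.Child t q → s'.nat aSel q = sel q) ∧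
      (∀ q : Fin D.N, ¬ D.Child t q → s'.nat aSel q = s.nat aSel q) ∧
      (((∀ v q, D.node t ≠ .forget v q) ∧ s'.nat oClus = s.nat oClus ∧
          s'.nat oCen = s.nat oCen ∧ s'.nat aCF = s.nat aCF ∧ s'.nat vCtr 0 = s.nat vCtr 0) ∨
        ∃ v q, D.node t = .forget v q ∧
          (((∃ u ∈ D.bag t, (ent (sel q)).lab u = (ent (sel q)).lab v ∧
              s'.nat oClus = Function.update (s.nat oClus) v (s.nat oClus u)) ∧
            s'.nat oCen = s.nat oCen ∧ s'.nat aCF = s.nat aCF ∧ s'.nat vCtr 0 = s.nat vCtr 0) ∨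
          ((∀ u ∈ D.bag t, (ent (sel q)).lab u ≠ (ent (sel q)).lab v) ∧
            s'.nat oClus = Function.update (s.nat oClus) v (s.nat vCtr 0) ∧
            s'.nat oCen = Function.update (s.nat oCen) (s.nat vCtr 0) v ∧
            s'.nat aCF = Function.update (s.nat aCF) (s.nat vCtr 0) ((ent (sel q)).fac v) ∧
            s'.nat vCtr 0 = s.nat vCtr 0 + 1))) := by
  refine Runs.seq' (readNodeProg_spec ht) ?_
  rintro s₁ ⟨c1, c2, c3, -⟩ hF₁
  have hent₁ : s₁.entry I.n = ent := (hF₁.entry rfl rfl rfl rfl rfl rfl).trans hent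
  have ht₁ : s₁.nat vT 0 = t := (congrFun (hF₁.nat vT rfl) 0).trans ht
  refine Runs.setNat_seq (Runs.setNat_seq ?_)
  have e1 : (NExp.read aSel (.var vT) : CExp).eval (connectedInput I G D) s₁ = sel t := by
    rw [← hsel, ← ht₁, ← hF₁.nat aSel rfl]
    rfl
  have e2 : (NExp.read aPtr₁ (.var vE₁) : CExp).eval (connectedInput I G D)
      (s₁.setNat vE₁ 0 (sel t)) = (ent (sel t)).p₁ := by
    rw [← hent₁]
    rfl
  have e0 : ∀ s, (NExp.const 0 : CExp).eval (connectedInput I G D) s = 0 := fun _ => rfl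
  rw [e1, e0, e0, e2]
  set s₃ := (s₁.setNat vE₁ 0 (sel t)).setNat vE₂ 0 (ent (sel t)).p₁ with hs₃
  have ht₃ : s₃.nat vT 0 = t := ht₁
  have hent₃ : s₃.entry I.n = ent :=
    (entry_setNat_of_lt (by omega)).trans ((entry_setNat_of_lt (by omega)).trans hent₁)
  have hsel₃ : s₃.nat aSel = s.nat aSel := hF₁.nat aSel rfl
  refine Runs.cond (fun htag => ?_) fun htag => ?_ <;>
    rw [BExp.Holds, eval_tagExp ht₃, NExp.eval] at htag
  swap
  · refine Runs.skip ⟨fun q hq => absurd hq.one_le_tag htag, fun q _ => by rw [hsel₃],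
      Or.inl ⟨fun v q h => htag (by simp [h, NodeType.tag]), hF₁.nat oClus rfl, hF₁.nat oCen rfl,
        hF₁.nat aCF rfl, congrFun (hF₁.nat vCtr rfl) 0⟩⟩
  obtain ⟨q, hq, hq'⟩ := NiceTreeDecomposition.exists_child₁ htag
  refine Runs.setNat_seq ?_
  have e3 : (NExp.var vS : CExp).eval (connectedInput I G D) s₃ = q := c1.trans hq'
  have e4 : (NExp.var vE₂ : CExp).eval (connectedInput I G D) s₃ = sel q := (hs.ptr₁ t q hq hq').symm
  rw [e3, e4]
  set s₄ := s₃.setNat aSel q (sel q) with hs₄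
  have hent₄ : s₄.entry I.n = ent := (entry_setNat_of_lt (by omega)).trans hent₃
  have hsel₄ : ∀ j, s₄.nat aSel j = if j = q then sel q else s.nat aSel j := by
    intro j
    rw [hs₄, State.setNat_nat, hsel₃]
    simp
  refine Runs.seq' (R₁ := fun s' => (∀ q, D.Child t q → s'.nat aSel q = sel q) ∧
      (∀ q : Fin D.N, ¬ D.Child t q → s'.nat aSel q = s.nat aSel q)) ?_ ?_
  · refine Runs.cond (fun htag' => ?_) fun htag' => ?_ <;>
      rw [BExp.Holds, eval_tagExp (s := s₄) (t := t) ht₃, NExp.eval] at htag'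
    · obtain ⟨r, hr, hr'⟩ := NiceTreeDecomposition.exists_child₂ htag'
      refine Runs.setNat ?_
      have e5 : (NExp.var vS₂ : CExp).eval (connectedInput I G D) s₄ = r := c2.trans hr'
      have e6 : (NExp.read aPtr₂ (.var vE₁) : CExp).eval (connectedInput I G D) s₄ = sel r := by
        rw [hs.ptr₂ t r hr htag' hr', ← hent₄]
        rfl
      rw [e5, e6]
      simp only [State.setNat_nat, true_and, hsel₄]
      refine ⟨fun x hx => ?_, fun x hx => ?_⟩
      · rcases hx.eq_child with h | ⟨-, h⟩
        · rw [hq'] at h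
          obtain rfl := Fin.ext h
          split_ifs with h'
          · rw [Fin.ext h']
          · rfl
        · rw [hr'] at h
          rw [if_pos h.symm, Fin.ext h]
      · rw [if_neg, if_neg]
        · intro h
          exact hx (Fin.ext h ▸ hq)
        · intro h
          exact hx (Fin.ext h ▸ hr)
    · refine Runs.skip ⟨fun x hx => ?_, fun x hx => ?_⟩
      · have h := hx.eq_child.resolve_right fun h => htag' h.1
        rw [hq'] at h
        rw [hsel₄, if_pos h.symm, Fin.ext h]
      · rw [hsel₄, if_neg]
        intro h
        exact hx (Fin.ext h ▸ hq)
  rintro s₅ ⟨a1, a2⟩ hF₅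
  have ht₅ : s₅.nat vT 0 = t := (congrFun (hF₅.nat vT rfl) 0).trans ht₃
  have hclus : s₅.nat oClus = s.nat oClus := (hF₅.nat oClus rfl).trans (hF₁.nat oClus rfl)
  have hcen : s₅.nat oCen = s.nat oCen := (hF₅.nat oCen rfl).trans (hF₁.nat oCen rfl)
  have hcf : s₅.nat aCF = s.nat aCF := (hF₅.nat aCF rfl).trans (hF₁.nat aCF rfl)
  have hctr : s₅.nat vCtr 0 = s.nat vCtr 0 :=
    congrFun ((hF₅.nat vCtr rfl).trans (hF₁.nat vCtr rfl)) 0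
  refine Runs.cond (fun htag' => ?_) fun htag' => ?_ <;>
    rw [BExp.holds_eq, eval_tagExp ht₅, NExp.eval] at htag'
  · obtain ⟨v, r, hn⟩ : ∃ v r, D.node t = .forget v r := by
      generalize D.node t = a at htag'
      cases a <;> simp [NodeType.tag] at htag' ⊢
    have hrq : (r : ℕ) = q := by
      rw [← hq', hn]
      rfl
    obtain rfl := Fin.ext hrq
    have hbag := NiceTreeDecomposition.valid_of_node hn
    have hent₅ : s₅.entry I.n = ent := (hF₅.entry rfl rfl rfl rfl rfl rfl).trans hent₄
    have hvv : s₅.nat vV 0 = v := by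
      refine (congrFun (hF₅.nat vV rfl) 0).trans (c3.trans ?_)
      rw [hn]
      rfl
    have hE₂ : s₅.nat vE₂ 0 = sel r := (congrFun (hF₅.nat vE₂ rfl) 0).trans e4
    have hb₅ : s₅.nat aBase (sel r) = sel r * I.n :=
      (congrFun ((hF₅.nat aBase rfl).trans (hF₁.nat aBase rfl)) _).trans (hb r _ (hs.lt r))
    refine (clusterProg_spec (t := t) (v := v) ht₅ hX hvv (by simp [hbag.2.2]) hE₂ hb₅
      hctr).frame.mono ?_
    rintro s₆ ⟨h, hF₆⟩
    rw [hF₆.nat aSel rfl]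
    rw [hent₅, hclus, hcen, hcf] at h
    exact ⟨a1, a2, Or.inr ⟨v, r, hn, h⟩⟩
  · refine Runs.skip ⟨a1, a2, Or.inl ⟨fun v q h => htag' ?_, hclus, hcen, hcf, hctr⟩⟩
    rw [h]
    rfl

theorem descendProg_spec (hX : ∀ t, (D.bag t).card ≤ X) (ho : D.IsOrder (s.nat aOrd) pos)
    (hs : D.IsSelection ent F L e sel) (hent : s.entry I.n = ent)
    (hb : ∀ (q : Fin D.N), ∀ e < L q, s.nat aBase e = e * I.n) (hsel : s.nat aSel D.root = e) :
    RunsIn (connectedInput I G D) (3 + (D.N + 1) * (descendBody.bound X + 16)) descendProg s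
      fun s' => ∃ m asel, D.IsDescended pos sel (fun i => ent (nodeTable sel i)) D.N asel
        (s'.nat oClus) (s'.nat oCen) (s'.nat aCF) m := by
  refine (RunsIn.setNat_seq (RunsIn.for' (X := X) (c := vI) 0 D.N (fun i s' =>
    D.IsDescended pos sel (fun i => ent (nodeTable sel i)) i (s'.nat aSel)
        (s'.nat oClus) (s'.nat oCen) (s'.nat aCF) (s'.nat vCtr 0))
    (fun _ _ _ h => h) rfl rfl (Nat.zero_le _) (fun _ _ _ _ => rfl) ?_ ?_
    (R := fun s' => ∃ m asel, D.IsDescended pos sel (fun i => ent (nodeTable sel i)) D.N asel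
        (s'.nat oClus) (s'.nat oCen) (s'.nat aCF) m) ?_)).mono ?_ fun _ h => h
  · refine ⟨?_, fun v hv => by omega, fun j hj => ?_, fun v hv => by omega⟩
    · rintro q (rfl | ⟨t, -, h⟩)
      · exact hsel.trans hs.root.symm
      · omega
    · exact absurd hj (Nat.not_lt_zero j)
  · rintro i s₁ - hi hF₁ hJ hc
    obtain ⟨t, ht⟩ := ho.surj i hi
    refine Runs.setNat_seq ?_
    have e0 : (NExp.read aOrd (.var vI) : CExp).eval (connectedInput I G D) s₁ = t := by
      rw [← ho.eq t, ht, ← hc]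
      exact congrFun (hF₁.nat aOrd rfl) _
    rw [e0]
    have hent₁ : (s₁.setNat vT 0 t).entry I.n = ent :=
      (entry_setNat_of_lt (by omega)).trans (((hF₁.entry rfl rfl rfl rfl rfl rfl).trans
        (entry_setNat_of_lt (by omega))).trans hent)
    have hsel₁ : (s₁.setNat vT 0 t).nat aSel t = sel t := by
      refine hJ.sel t ?_
      by_cases htr : t = D.root
      · exact Or.inl htr
      · obtain ⟨p, hp⟩ := NiceTreeDecomposition.exists_parent htr
        exact Or.inr ⟨p, hp, ht ▸ ho.child p t hp⟩
    refine (descendNodeProg_spec (s := s₁.setNat vT 0 t) (t := t) (hX t) rfl hs hent₁ ?_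
      hsel₁).mono ?_
    · intro q j hj
      exact (congrFun (hF₁.nat aBase rfl) j).trans (hb q j hj)
    rintro s₂ ⟨a1, a2, ⟨a3, b1, b2, b3, b4⟩ | ⟨v, q, hn, h⟩⟩
    · rw [b1, b2, b3, b4]
      exact hJ.succ_of_not_forget ho ht a1 a2 a3
    · refine hJ.succ_of_forget ho ht a1 a2 hn ?_
      rw [nodeTable_coe]
      exact h
  · intro s' h _
    exact ⟨_, _, h⟩
  · simp only [NExp.cost, Nat.sub_zero, add_assoc, Nat.reduceAdd]
    omega

end descend

end RealRAM

/-! ### Choosing centers, and correctness of the dynamic program. -/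

namespace RealRAM

section main

variable {I : KMedianInstance} {G : SimpleGraph (Fin I.n)} {D : NiceTreeDecomposition G}
  {W X : ℕ} {med : ℕ → ℕ} {s : State}

/-- A running minimum over all vertices, kept separately for each cluster. It starts from the
provisional centers, which already lie in their clusters, so membership never fails. -/
theorem centerProg_spec {clus cf : ℕ → ℕ} (hmed : s.nat aMed = med) (hclus : s.nat oClus = clus)
    (hcf : s.nat aCF = cf) (hlt : ∀ v : Fin I.n, clus v < I.k)
    (hc : ∀ i < I.k, ∃ c : Fin I.n, s.nat oCen i = c ∧ clus c = i) :
    RunsIn (connectedInput I G D) ((I.n + 1) * (centerBody.bound X + 16)) centerProg s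
      fun s' => s'.nat oClus = clus ∧ ∀ i < I.k, ∃ c : Fin I.n, s'.nat oCen i = c ∧ clus c = i ∧
        ∀ v : Fin I.n, clus v = i → medCost I med c (cf i) ≤ medCost I med v (cf i) := by
  refine (RunsIn.for' (X := X) (c := vV) 0 I.n (fun j s' =>
    ∀ i < I.k, ∃ c : Fin I.n, s'.nat oCen i = c ∧ clus c = i ∧
        ∀ v : Fin I.n, (v : ℕ) < j → clus v = i → medCost I med c (cf i) ≤ medCost I med v (cf i))
    (fun _ _ _ h => h) rfl rfl (Nat.zero_le _) (fun _ _ _ _ => rfl) ?_ ?_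
    (R := fun s' => s'.nat oClus = clus ∧
      ∀ i < I.k, ∃ c : Fin I.n, s'.nat oCen i = c ∧ clus c = i ∧
        ∀ v : Fin I.n, clus v = i → medCost I med c (cf i) ≤ medCost I med v (cf i))
      ?_).mono ?_ fun _ h => h
  · intro i hi
    obtain ⟨c, h1, h2⟩ := hc i hi
    exact ⟨c, h1, h2, fun v hv => absurd hv (Nat.not_lt_zero _)⟩
  · rintro j s₁ - hj hF₁ hJ hcj
    have hmed₁ : s₁.nat aMed = med := (hF₁.nat aMed rfl).trans hmed
    have hclus₁ : s₁.nat oClus = clus := (hF₁.nat oClus rfl).trans hclus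
    have hcf₁ : s₁.nat aCF = cf := (hF₁.nat aCF rfl).trans hcf
    set v : Fin I.n := ⟨j, hj⟩ with hv
    obtain ⟨c, h1, h2, h3⟩ := hJ (clus v) (hlt v)
    refine Runs.setNat_seq ?_
    have e0 : ∀ s, (NExp.const 0 : CExp).eval (connectedInput I G D) s = 0 := fun _ => rfl
    have e1 : (NExp.read oClus (.var vV) : CExp).eval (connectedInput I G D) s₁ = clus v := by
      simp only [NExp.eval, hcj, hclus₁, hv]
    rw [e1, e0]
    have e2 : (medDist (.var vV) (.var vU)).eval (connectedInput I G D)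
        (s₁.setNat vU 0 (clus v)) = medCost I med v (cf (clus v)) := by
      change I.distTable (s₁.nat vV 0) (s₁.nat aMed (s₁.nat aCF (clus v))) = _
      rw [hcj, hmed₁, hcf₁]
      rfl
    have e3 : (medDist (.read oCen (.var vU)) (.var vU)).eval (connectedInput I G D)
        (s₁.setNat vU 0 (clus v)) = medCost I med c (cf (clus v)) := by
      change I.distTable (s₁.nat oCen (clus v)) (s₁.nat aMed (s₁.nat aCF (clus v))) = _
      rw [h1, hmed₁, hcf₁]
      rfl
    refine Runs.cond (fun hb => ?_) (fun hb => ?_) <;> rw [BExp.Holds, e2, e3] at hb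
    · refine Runs.setNat ?_
      have e4 : (NExp.var vU : CExp).eval (connectedInput I G D) (s₁.setNat vU 0 (clus v)) =
          clus v := rfl
      have e5 : (NExp.var vV : CExp).eval (connectedInput I G D) (s₁.setNat vU 0 (clus v)) = v :=
        hcj
      rw [e4, e5]
      intro i hi
      rw [State.setNat_nat]
      by_cases hiv : i = clus v
      · subst hiv
        refine ⟨v, if_pos ⟨rfl, rfl⟩, rfl, fun u hu huv => ?_⟩
        rcases Nat.lt_succ_iff_lt_or_eq.1 hu with hu | hu
        · exact hb.trans (h3 u hu huv)
        · rw [show u = v from Fin.ext hu]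
      · obtain ⟨c', g1, g2, g3⟩ := hJ i hi
        refine ⟨c', (if_neg fun h => hiv h.2).trans g1, g2, fun u hu hui => ?_⟩
        rcases Nat.lt_succ_iff_lt_or_eq.1 hu with hu | hu
        · exact g3 u hu hui
        · rw [show u = v from Fin.ext hu] at hui
          exact absurd hui.symm hiv
    · refine Runs.skip fun i hi => ?_
      obtain ⟨c', g1, g2, g3⟩ := hJ i hi
      refine ⟨c', g1, g2, fun u hu hui => ?_⟩
      rcases Nat.lt_succ_iff_lt_or_eq.1 hu with hu | hu
      · exact g3 u hu hui
      · obtain rfl : u = v := Fin.ext hu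
        subst hui
        rw [show c' = c from Fin.ext (g1.symm.trans h1)]
        exact (not_le.1 hb).le
  · rintro s' h hF
    refine ⟨(hF.nat oClus rfl).trans hclus, fun i hi => ?_⟩
    obtain ⟨c, h1, h2, h3⟩ := h i hi
    exact ⟨c, h1, h2, fun v => h3 v v.2⟩
  · simp only [NExp.cost, Nat.sub_zero, add_assoc, Nat.reduceAdd]
    exact le_rfl

/-- The number of steps of the algorithm, given the facilities. -/
def mainTime (N n X : ℕ) : ℕ :=
  8 + (N + 1) * (orderBody.bound X + 16) + ((N + 1) * (tableBody.bound X + 16) +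
    (selectProg.bound X + (8 + (3 + (N + 1) * (descendBody.bound X + 16) +
      (n + 1) * (centerBody.bound X + 16)))))

theorem RunsIn.cond_le {Q : Type} {x : Input Q} {T : ℕ} {P P' : Prog Q} {s : State}
    {R : State → Prop} {b : BExp Q} (h : b.Holds x s → RunsIn x T P s R)
    (h' : ¬ b.Holds x s → RunsIn x T P' s R) : RunsIn x (1 + b.cost + T) (.cond b P P') s R := by
  by_cases hb : b.Holds x s
  · obtain ⟨s', t, h1, h2, h3⟩ := h hb
    exact ⟨s', _, .condTrue hb h1, by omega, h3⟩
  · obtain ⟨s', t, h1, h2, h3⟩ := h' hb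
    exact ⟨s', _, .condFalse hb h1, by omega, h3⟩

/-- The algorithm finds a connected clustering that is the best one for the given facilities. -/
theorem mainProg_spec (hX : Room D W X) (hmed : s.nat aMed = med) (hbase : s.nat aBase 0 = 0)
    (htop : s.nat vTop 0 = 0) :
    RunsIn (connectedInput I G D) (mainTime D.N I.n X) mainProg s fun s' =>
      ∀ (cl : Fin I.n → Fin I.k), (∀ i, (G.induce {v | cl v = i}).Connected) →
        ∀ fc : Fin I.n → ℕ, (∀ u v, cl u = cl v → fc u = fc v) → (∀ v, fc v < I.k) →
        ∃ clus cf : ℕ → ℕ, s'.nat oClus = clus ∧ (∀ v : Fin I.n, clus v < I.k) ∧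
          (∀ i < I.k, (G.induce {v : Fin I.n | clus v = i}).Connected) ∧
          (∀ i < I.k, ∃ c : Fin I.n, s'.nat oCen i = c ∧ clus c = i ∧
            ∀ v : Fin I.n, clus v = i → medCost I med c (cf i) ≤ medCost I med v (cf i)) ∧
          (∀ v : Fin I.n, cf (clus v) < I.k) ∧
          ∑ v : Fin I.n, medCost I med v (cf (clus v)) ≤ ∑ v, medCost I med v (fc v) := by
  have hk : 0 < I.k := by have := I.two_le_k; omega
  refine RunsIn.seq' (orderProg_spec X) ?_
  rintro s₁ ⟨pos, ho⟩ hF₁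
  refine RunsIn.seq' (tableProg_spec hX ho ((hF₁.nat aMed rfl).trans hmed)
    ((congrFun (hF₁.nat aBase rfl) 0).trans hbase)
    ((congrFun (hF₁.nat vTop rfl) 0).trans htop)) ?_
  intro s₂ htab hF₂
  have ho₂ : D.IsOrder (s₂.nat aOrd) pos := by rwa [hF₂.nat aOrd rfl]
  have htab' := fun t => (htab t).1
  refine RunsIn.seq' (selectProg_spec (X := X) rfl rfl (htab' D.root).le
    (((htab' D.root).card_le (hX.card _) hk).trans hX.entries_le)) ?_
  intro s₃ hsel hF₃
  have hent₃ : s₃.entry I.n = s₂.entry I.n := hF₃.entry rfl rfl rfl rfl rfl rfl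
  -- Completeness holds for all competing clusterings at once, since the tables were computed
  -- without reference to any of them.
  have hbest : ∀ (cl : Fin I.n → Fin I.k), (∀ i, (G.induce {v | cl v = i}).Connected) →
      ∀ fc : Fin I.n → ℕ, (∀ u v, cl u = cl v → fc u = fc v) → (∀ v, fc v < I.k) → ∃ e,
        s₂.nat aFst D.root ≤ e ∧ e < s₂.nat aLst D.root ∧ (s₂.entry I.n e).cnt = I.k ∧
        (s₂.entry I.n e).cost ≤ ∑ v, medCost I med v (fc v) :=
    fun cl hcl fc h1 h2 => NiceTreeDecomposition.exists_entry_of_clustering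
      (fun t => (htab' t).complete) hcl h1 h2
  refine (RunsIn.cond_le (T := 3 + (D.N + 1) * (descendBody.bound X + 16) +
      (I.n + 1) * (centerBody.bound X + 16)) (fun hb => ?_) fun hb => ?_).mono
      (by simp only [BExp.cost, NExp.cost]; omega) fun _ h => h
  · simp only [BExp.Holds, NExp.eval] at hb
    obtain ⟨-, h1, h2, h3⟩ := hsel.resolve_left fun h => by omega
    generalize he : s₃.nat aSel D.root = e at h1 h2 h3
    obtain ⟨sel, hs⟩ := NiceTreeDecomposition.exists_isSelection htab' h1 h2
    refine RunsIn.seq' (descendProg_spec (fun t => (hX.card t).trans hX.W_le)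
      (by rwa [hF₃.nat aOrd rfl]) hs hent₃ (fun q e he => ?_) he) ?_
    · rw [hF₃.nat aBase rfl]
      exact (htab q).2 e he
    rintro s₄ ⟨m, asel, hd⟩ hF₄
    have hroot : (s₂.entry I.n (nodeTable sel D.root)) = s₂.entry I.n e := by
      rw [nodeTable_coe, hs.root]
    obtain ⟨b1, b2, b3, b5, b4⟩ := hd.clustering ho₂ (hs.consistent htab')
      (by rw [hroot]; exact h3)
    refine (centerProg_spec (med := med) (X := X) ?_ rfl rfl b1 b3).mono le_rfl ?_
    · rw [hF₄.nat aMed rfl, hF₃.nat aMed rfl, hF₂.nat aMed rfl, hF₁.nat aMed rfl, hmed]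
    rintro s₅ ⟨a1, a2⟩ cl hcl fc hfc hfk
    refine ⟨_, _, a1, b1, b2, a2, fun v => ?_, ?_⟩
    · obtain ⟨q, hq⟩ := D.exists_node_forgetNode v
      rw [b5, NiceTreeDecomposition.lastEntry_eq hq]
      rw [nodeTable_coe]
      exact (((htab' q).bounded _ (hs.le q) (hs.lt q)).2 v
        (NiceTreeDecomposition.valid_of_node hq).2.1).1
    obtain ⟨e', c1, c2, c3, c4⟩ := hbest cl hcl fc hfc hfk
    rw [b4, hroot]
    refine le_trans (le_of_eq ?_) c4
    -- The root bag is empty, so root entries agree up to `Same` as soon as their counts agree. The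
    -- entry with count `k` is therefore unique, and the one selected is the one completeness
    -- provides.
    rw [(htab' D.root).inj e e' h1 h2 c1 c2 ⟨by rw [h3, c3], by simp [D.bag_root]⟩]
  · simp only [BExp.Holds, NExp.eval] at hb
    obtain ⟨-, h1⟩ := hsel.resolve_right fun h => by omega
    refine RunsIn.mono (T := 1) ⟨s₃, 1, .skip s₃, le_rfl, ?_⟩ (by omega) fun _ h => h
    intro cl hcl fc hfc hfk
    -- Without a root entry of count `k` there is no connected clustering, so nothing has to be
    -- produced.
    obtain ⟨e', c1, c2, c3, -⟩ := hbest cl hcl fc hfc hfk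
    exact absurd c3 (h1 e' c1 c2)

end main

end RealRAM

namespace RealRAM

/-! ### Running an algorithm for unconnected `k`-median -/

/-- The corresponding query for connected `k`-median. -/
def liftQuery : KMedianQuery → ConnectedQuery
  | .numPoints => .numPoints
  | .numClusters => .numClusters

/-- The arrays are renamed such that the first 50 arrays are not used. -/
def liftNExp : NExp KMedianQuery → CExp
  | .const c => .const c
  | .read a i => .read (a + 50) (liftNExp i)
  | .input q i j => .input (liftQuery q) (liftNExp i) (liftNExp j)
  | .plus e f => .plus (liftNExp e) (liftNExp f)
  | .minus e f => .minus (liftNExp e) (liftNExp f)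

def liftRExp : RExp KMedianQuery → RExp ConnectedQuery
  | .ofNat e => .ofNat (liftNExp e)
  | .read a i => .read (a + 50) (liftNExp i)
  | .input i j => .input (liftNExp i) (liftNExp j)
  | .plus e f => .plus (liftRExp e) (liftRExp f)
  | .minus e f => .minus (liftRExp e) (liftRExp f)
  | .times e f => .times (liftRExp e) (liftRExp f)
  | .divide e f => .divide (liftRExp e) (liftRExp f)

def liftBExp : BExp KMedianQuery → BExp ConnectedQuery
  | .natLe e f => .natLe (liftNExp e) (liftNExp f)
  | .realLe e f => .realLe (liftRExp e) (liftRExp f)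

def liftProg : Prog KMedianQuery → CProg
  | .skip => .skip
  | .setNat a i e => .setNat (a + 50) (liftNExp i) (liftNExp e)
  | .setReal a i e => .setReal (a + 50) (liftNExp i) (liftRExp e)
  | .seq P P' => .seq (liftProg P) (liftProg P')
  | .cond b P P' => .cond (liftBExp b) (liftProg P) (liftProg P')
  | .loop b P => .loop (liftBExp b) (liftProg P)

/-- The memory after renaming. -/
noncomputable def liftState (s : State) : State where
  nat a i := if a < 50 then 0 else s.nat (a - 50) i
  real a i := if a < 50 then 0 else s.real (a - 50) i

theorem liftState_init : liftState State.init = State.init := by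
  simp [liftState, State.init]

theorem liftState_setNat (s : State) (a i v : ℕ) :
    liftState (s.setNat a i v) = (liftState s).setNat (a + 50) i v := by
  simp only [liftState, State.setNat, State.mk.injEq, and_true]
  funext b j
  by_cases hb : b < 50
  · have : b ≠ a + 50 := by omega
    simp [hb, this]
  · have : b = a + 50 ↔ b - 50 = a := by omega
    simp [hb, this]

theorem liftState_setReal (s : State) (a i : ℕ) (v : ℝ) :
    liftState (s.setReal a i v) = (liftState s).setReal (a + 50) i v := by
  simp only [liftState, State.setReal, State.mk.injEq, true_and]
  funext b j
  by_cases hb : b < 50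
  · have : b ≠ a + 50 := by omega
    simp [hb, this]
  · have : b = a + 50 ↔ b - 50 = a := by omega
    simp [hb, this]

section lift

variable {I : KMedianInstance} {G : SimpleGraph (Fin I.n)} {D : NiceTreeDecomposition G}

theorem eval_liftNExp (s : State) (e : NExp KMedianQuery) :
    (liftNExp e).eval (connectedInput I G D) (liftState s) = e.eval (kMedianInput I) s := by
  induction e with
  | const c => rfl
  | read a i ih =>
    simp only [liftNExp, NExp.eval, ih]
    simp [liftState]
  | input q i j _ _ => cases q <;> rfl
  | plus e f ih ih' => simp only [liftNExp, NExp.eval, ih, ih']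
  | minus e f ih ih' => simp only [liftNExp, NExp.eval, ih, ih']

theorem cost_liftNExp (e : NExp KMedianQuery) : (liftNExp e).cost = e.cost := by
  induction e <;> simp_all [liftNExp, NExp.cost]

theorem eval_liftRExp (s : State) (e : RExp KMedianQuery) :
    (liftRExp e).eval (connectedInput I G D) (liftState s) = e.eval (kMedianInput I) s := by
  induction e with
  | ofNat e => simp only [liftRExp, RExp.eval, eval_liftNExp]
  | read a i =>
    simp only [liftRExp, RExp.eval, eval_liftNExp]
    simp [liftState]
  | input i j =>
    simp only [liftRExp, RExp.eval, eval_liftNExp]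
    rfl
  | plus e f ih ih' => simp only [liftRExp, RExp.eval, ih, ih']
  | minus e f ih ih' => simp only [liftRExp, RExp.eval, ih, ih']
  | times e f ih ih' => simp only [liftRExp, RExp.eval, ih, ih']
  | divide e f ih ih' => simp only [liftRExp, RExp.eval, ih, ih']

theorem cost_liftRExp (e : RExp KMedianQuery) : (liftRExp e).cost = e.cost := by
  induction e <;> simp_all [liftRExp, RExp.cost, cost_liftNExp]

theorem holds_liftBExp (s : State) (b : BExp KMedianQuery) :
    (liftBExp b).Holds (connectedInput I G D) (liftState s) ↔ b.Holds (kMedianInput I) s := by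
  cases b <;> simp only [liftBExp, BExp.Holds, eval_liftNExp, eval_liftRExp]

theorem cost_liftBExp (b : BExp KMedianQuery) : (liftBExp b).cost = b.cost := by
  cases b <;> simp only [liftBExp, BExp.cost, cost_liftNExp, cost_liftRExp]

/-- Renaming commutes with every step and preserves the cost of every expression, so the embedded
run takes exactly as many steps as the original one and leaves the first `50` arrays empty. -/
theorem Exec.lift {A : Prog KMedianQuery} {s s' : State} {t : ℕ}
    (h : Exec (kMedianInput I) A s s' t) :
    Exec (connectedInput I G D) (liftProg A) (liftState s) (liftState s') t := by
  induction h with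
  | skip s => exact .skip _
  | setNat a i e s =>
    have := Exec.setNat (x := connectedInput I G D) (a + 50) (liftNExp i) (liftNExp e) (liftState s)
    rwa [eval_liftNExp, eval_liftNExp, cost_liftNExp, cost_liftNExp, ← liftState_setNat] at this
  | setReal a i e s =>
    have := Exec.setReal (x := connectedInput I G D) (a + 50) (liftNExp i) (liftRExp e)
      (liftState s)
    rwa [eval_liftNExp, eval_liftRExp, cost_liftNExp, cost_liftRExp, ← liftState_setReal] at this
  | seq _ _ ih ih' => exact .seq ih ih'
  | condTrue hb _ ih =>
    rw [← cost_liftBExp]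
    exact .condTrue ((holds_liftBExp _ _).2 hb) ih
  | condFalse hb _ ih =>
    rw [← cost_liftBExp]
    exact .condFalse (fun h => hb ((holds_liftBExp _ _).1 h)) ih
  | loopTrue hb _ _ ih ih' =>
    rw [← cost_liftBExp]
    exact .loopTrue ((holds_liftBExp _ _).2 hb) ih ih'
  | loopFalse hb =>
    rw [← cost_liftBExp]
    exact .loopFalse (fun h => hb ((holds_liftBExp _ _).1 h))

end lift

end RealRAM

/-! ### The quality of the solution -/

namespace KMedianInstance

variable (I : KMedianInstance)

theorem cost_nonneg (c : Fin I.k → Fin I.n) : 0 ≤ I.cost c :=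
  Finset.sum_nonneg fun _ _ => Real.iInf_nonneg fun _ => I.d_nonneg _ _

theorem clusteringCost_eq (cluster : Fin I.n → Fin I.k) (center : Fin I.k → Fin I.n) :
    I.clusteringCost cluster center = ∑ v, I.d v (center (cluster v)) := by
  rw [clusteringCost, ← Finset.sum_fiberwise Finset.univ cluster]
  refine Finset.sum_congr rfl fun i _ => Finset.sum_congr rfl fun v hv => ?_
  rw [(Finset.mem_filter.1 hv).2]

theorem cost_le_clusteringCost (cluster : Fin I.n → Fin I.k) (center : Fin I.k → Fin I.n) :
    I.cost center ≤ I.clusteringCost cluster center := by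
  rw [clusteringCost_eq]
  exact Finset.sum_le_sum fun v _ =>
    ciInf_le ⟨0, by rintro _ ⟨i, rfl⟩; exact I.d_nonneg _ _⟩ (cluster v)

/-- Every cluster may use the facility that is nearest to its center. -/
theorem exists_facilities (c : Fin I.k → Fin I.n) (cluster : Fin I.n → Fin I.k)
    (center : Fin I.k → Fin I.n) : ∃ f : Fin I.k → Fin I.k,
      ∑ v, I.d v (c (f (cluster v))) ≤ 2 * I.clusteringCost cluster center + I.cost c := by
  have : Nonempty (Fin I.k) := ⟨⟨0, by have := I.two_le_k; omega⟩⟩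
  choose f hf using fun i => Finite.exists_min fun j => I.d (center i) (c j)
  refine ⟨f, ?_⟩
  rw [clusteringCost_eq, cost, Finset.mul_sum, ← Finset.sum_add_distrib]
  refine Finset.sum_le_sum fun v _ => ?_
  -- Compare the facility chosen for the cluster with the facility `c j` nearest to `v`: the center
  -- is no farther from the former than from the latter, and hence at distance at most `d center v +
  -- d v (c j)` from the chosen one.
  obtain ⟨j, hj⟩ := Finite.exists_min fun j => I.d v (c j)
  have h1 : I.d v (c j) ≤ ⨅ i, I.d v (c i) := le_ciInf hj
  have h2 := I.d_triangle v (center (cluster v)) (c (f (cluster v)))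
  have h3 := hf (cluster v) j
  have h4 := I.d_triangle (center (cluster v)) v (c j)
  have h5 := I.d_symm v (center (cluster v))
  linarith

/-- Replacing facilities by nearest vertices of the clusters. -/
theorem clusteringCost_le (cluster : Fin I.n → Fin I.k) (center : Fin I.k → Fin I.n)
    (f : Fin I.k → Fin I.n)
    (h : ∀ v, I.d (center (cluster v)) (f (cluster v)) ≤ I.d v (f (cluster v))) :
    I.clusteringCost cluster center ≤ 2 * ∑ v, I.d v (f (cluster v)) := by
  rw [clusteringCost_eq, Finset.mul_sum]
  refine Finset.sum_le_sum fun v _ => ?_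
  have h1 := I.d_triangle v (f (cluster v)) (center (cluster v))
  have h2 := I.d_symm (f (cluster v)) (center (cluster v))
  have h3 := h v
  linarith

/-- Three points at distance one, and two clusters. -/
noncomputable def threePoints : KMedianInstance where
  n := 3
  k := 2
  two_le_k := le_rfl
  k_le_n := by omega
  d u v := if u = v then 0 else 1
  d_nonneg u v := by split_ifs <;> norm_num
  d_eq_zero u v := by simp
  d_symm u v := by simp only [eq_comm]
  d_triangle u v w := by
    split_ifs with h1 h2 h3 h3 h2 h3 h3 <;> simp_all

end KMedianInstance

/-- A negative factor would force a negative cost on an instance in which some choice of centers has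
positive cost. Nonnegativity is needed to multiply the bound on the unconnected cost by `α`. -/
theorem IsKMedianApprox.nonneg {A : RealRAM.Prog KMedianQuery} {α : ℝ} {p : ℕ → ℕ}
    (h : IsKMedianApprox A α p) : 0 ≤ α := by
  obtain ⟨s, t, -, -, c, -, hc⟩ := h KMedianInstance.threePoints
  have h0 := KMedianInstance.threePoints.cost_nonneg c
  -- The centers are the points `0` and `1`; the point `2` is then at distance `1` from both.
  let c' : Fin 2 → Fin 3 := Fin.castSucc
  have h1 : 0 < KMedianInstance.threePoints.cost c' := by
    refine Finset.sum_pos' (fun v _ => Real.iInf_nonneg fun _ => KMedianInstance.d_nonneg _ _ _)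
      ⟨(2 : Fin 3), Finset.mem_univ _, lt_of_lt_of_le zero_lt_one ?_⟩
    have : Nonempty (Fin KMedianInstance.threePoints.k) := ⟨(0 : Fin 2)⟩
    refine le_ciInf fun i => ?_
    have hi : (2 : Fin 3) ≠ c' i := by
      revert i
      change ∀ i : Fin 2, _
      decide
    exact (if_neg hi).ge
  have h2 := hc c'
  by_contra hα
  have := mul_neg_of_neg_of_pos (not_le.1 hα) h1
  linarith

namespace RealRAM

/-! ### The running time -/

/-- A bound for the numbers of iterations in the treatment of a node. -/
def maxIter (k w : ℕ) : ℕ := (k * (w + 1)) ^ (w + 1) * (k + 1) + k + (w + 1)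

/-- Since `y = w * k ≥ 2`, each factor is bounded by a power of `y`: `k * (w + 1)` and `k + 1` by `y
^ 2`, and the final factor `2` by `y`. The resulting exponent `4 * w + 3` is at most `7 * w` because
`w ≥ 1`. -/
theorem maxIter_le {k w : ℕ} (hk : 2 ≤ k) (hw : 1 ≤ w) : maxIter k w ≤ (w * k) ^ (7 * w) := by
  have hy2 : 2 ≤ w * k := by nlinarith
  have hky : k ≤ w * k := Nat.le_mul_of_pos_left k hw
  have hwy : w + 1 ≤ w * k := by nlinarith
  generalize hy : w * k = y at *
  have h1 : (k * (w + 1)) ^ (w + 1) ≤ y ^ (4 * w) := by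
    have : k * (w + 1) ≤ y ^ 2 := by nlinarith
    calc (k * (w + 1)) ^ (w + 1) ≤ (y ^ 2) ^ (w + 1) := Nat.pow_le_pow_left this _
      _ = y ^ (2 * (w + 1)) := (pow_mul _ _ _).symm
      _ ≤ y ^ (4 * w) := Nat.pow_le_pow_right (by omega) (by omega)
  have h2 : k + 1 ≤ y ^ 2 := by nlinarith
  have h3 : k + (w + 1) ≤ y ^ (4 * w) * y ^ 2 := by
    have : 1 ≤ y ^ (4 * w) := Nat.one_le_pow _ _ (by omega)
    calc k + (w + 1) ≤ y ^ 2 := by nlinarith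
      _ ≤ _ := Nat.le_mul_of_pos_left _ this
  calc maxIter k w = (k * (w + 1)) ^ (w + 1) * (k + 1) + (k + (w + 1)) := add_assoc _ _ _
    _ ≤ y ^ (4 * w) * y ^ 2 + y ^ (4 * w) * y ^ 2 := add_le_add (Nat.mul_le_mul h1 h2) h3
    _ = y ^ (4 * w + 2) * 2 := by rw [pow_add]; ring
    _ ≤ y ^ (4 * w + 2) * y := Nat.mul_le_mul_left _ hy2
    _ = y ^ (4 * w + 3) := (pow_succ _ _).symm
    _ ≤ y ^ (7 * w) := Nat.pow_le_pow_right (by omega) (by omega)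

/-- The number of steps is of order `N + n` times a fixed polynomial in `maxIter k w`. Substituting
`(w * k) ^ (7 * w)` into a polynomial of fixed degree only multiplies the exponent by a constant. -/
theorem exists_mainTime_le : ∃ K c : ℕ, 1 ≤ K ∧ ∀ B N n k w, 2 ≤ k → k ≤ n → 1 ≤ w →
    N ≤ B * (n * w) → mainTime N n (maxIter k w) ≤ (B + 2) * K * (n * (w * k) ^ (c * w)) := by
  -- Sequencing the five program parts yields one polynomial bound for the sum of their step bounds.
  obtain ⟨K, d, h⟩ :=
    (orderBody ;; tableBody ;; selectProg ;; descendBody ;; centerBody).exists_bound_le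
  refine ⟨K + 83, 7 * d + 1, by omega, fun B N n k w hk hn hw hN => ?_⟩
  set y := w * k with hy
  have hwy : w ≤ y := Nat.le_mul_of_pos_right w (by omega)
  have hX : 1 ≤ maxIter k w := by
    unfold maxIter
    omega
  set X := maxIter k w with hXdef
  have h1 := h X hX
  have h2 : X ^ d ≤ y ^ (7 * d * w) := by
    calc X ^ d ≤ (y ^ (7 * w)) ^ d := Nat.pow_le_pow_left (maxIter_le hk hw) d
      _ = y ^ (7 * d * w) := by rw [← pow_mul]; congr 1; ring
  have h3 : 1 ≤ y ^ (7 * d * w) := Nat.one_le_pow _ _ (by omega)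
  -- Here `83 = 4 * 16 + 8 + 8 + 3` collects all additive constants in `mainTime`.
  have h4 : mainTime N n X ≤ (N + n + 2) *
      ((orderBody ;; tableBody ;; selectProg ;; descendBody ;; centerBody).bound X + 83) := by
    simp only [mainTime, Prog.bound]
    generalize orderBody.bound X = a₁
    generalize tableBody.bound X = a₂
    generalize selectProg.bound X = a₃
    generalize descendBody.bound X = a₄
    generalize centerBody.bound X = a₅
    nlinarith
  have h5 : (orderBody ;; tableBody ;; selectProg ;; descendBody ;; centerBody).bound X + 83 ≤
      (K + 83) * y ^ (7 * d * w) := by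
    rw [add_mul]
    exact add_le_add (h1.trans (Nat.mul_le_mul_left K h2)) (Nat.le_mul_of_pos_right 83 h3)
  -- Uses `2 ≤ k ≤ n` to absorb the summand `2`; the factor `w` left over goes into the exponent in
  -- the next estimate.
  have h6 : N + n + 2 ≤ (B + 2) * (n * w) := by nlinarith [Nat.le_mul_of_pos_right n hw]
  have h7 : w * y ^ (7 * d * w) ≤ y ^ ((7 * d + 1) * w) := by
    calc w * y ^ (7 * d * w) ≤ y ^ w * y ^ (7 * d * w) :=
          Nat.mul_le_mul_right _ (hwy.trans (Nat.le_self_pow (by omega) y))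
      _ = y ^ ((7 * d + 1) * w) := by rw [← pow_add]; congr 1; ring
  calc mainTime N n X ≤ (B + 2) * (n * w) * ((K + 83) * y ^ (7 * d * w)) :=
        h4.trans (Nat.mul_le_mul h6 h5)
    _ = (B + 2) * (K + 83) * (n * (w * y ^ (7 * d * w))) := by ring
    _ ≤ _ := by gcongr

/-- The algorithm for connected `k`-median. -/
def connectedProg (A : Prog KMedianQuery) : CProg := liftProg A ;; mainProg

/-- The output of the dynamic program is at least as good, with respect to the facilities, as any
feasible solution whose clusters use their nearest facilities. The factor `2 + α` comes from that
comparison, and the final factor `2` from moving the centers into the clusters. -/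
theorem connectedProg_spec {A : Prog KMedianQuery} {α : ℝ} {p : ℕ → ℕ}
    (hA : IsKMedianApprox A α p) (I : KMedianInstance) (G : SimpleGraph (Fin I.n))
    (D : NiceTreeDecomposition G) {w : ℕ} (hD : D.HasWidth w) :
    RunsIn (connectedInput I G D) (p I.n + mainTime D.N I.n (maxIter I.k w)) (connectedProg A)
      State.init fun s => (∃ cluster center, I.IsConnectedSolution G cluster center) →
        ∃ (cluster : Fin I.n → Fin I.k) (center : Fin I.k → Fin I.n),
          (∀ v : Fin I.n, s.nat 0 v = cluster v) ∧ (∀ i : Fin I.k, s.nat 1 i = center i) ∧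
          I.IsConnectedSolution G cluster center ∧
          ∀ cluster' center', I.IsConnectedSolution G cluster' center' →
            I.clusteringCost cluster center ≤
              (2 * α + 4) * I.clusteringCost cluster' center' := by
  have hα := hA.nonneg
  obtain ⟨s, t, h1, h2, c, h3, h4⟩ := hA I
  have hlift := h1.lift (G := G) (D := D)
  rw [liftState_init] at hlift
  have hX : Room D (w + 1) (maxIter I.k w) := by
    refine ⟨fun q => ?_, ?_, ?_, ?_⟩
    · rw [← hD]
      exact Finset.le_sup (f := fun t => (D.bag t).card) (Finset.mem_univ q)
    all_goals
      unfold maxIter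
      omega
  refine RunsIn.seq ⟨_, t, hlift, h2, (mainProg_spec hX rfl rfl rfl).mono le_rfl ?_⟩
  rintro s' h ⟨cl₀, ce₀, h₀⟩
  -- The output array `0` of the given algorithm has become array `50`, which is `aMed`.
  have hmed : ∀ (v : Fin I.n) (j : Fin I.k),
      medCost I ((liftState s).nat aMed) v j = I.d v (c j) := by
    intro v j
    have e : (liftState s).nat aMed j = c j := h3 j
    simp [medCost, KMedianInstance.distTable, e]
  obtain ⟨f₀, -⟩ := I.exists_facilities c cl₀ ce₀
  obtain ⟨clus, -, hclus, g1, g2, -⟩ := h cl₀ (fun i => (h₀ i).2) (fun v => f₀ (cl₀ v))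
    (fun u v huv => by rw [huv]) fun v => (f₀ (cl₀ v)).2
  -- The facility map extracted from the specification may depend on the competing solution, whereas
  -- the clusters and centers are fixed by the final memory. The comparison is thus made with a
  -- separate `f` for each competitor.
  have key : ∀ cluster' center', I.IsConnectedSolution G cluster' center' → ∃ f : Fin I.k → Fin I.k,
      (∀ i : Fin I.k, ∃ x : Fin I.n, s'.nat oCen i = x ∧ clus x = i ∧
        ∀ v : Fin I.n, clus v = i → I.d x (c (f i)) ≤ I.d v (c (f i))) ∧
      ∑ v : Fin I.n, I.d v (c (f ⟨clus v, g1 v⟩)) ≤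
        (2 + α) * I.clusteringCost cluster' center' := by
    intro cl ce hsol
    obtain ⟨f, hf⟩ := I.exists_facilities c cl ce
    obtain ⟨clus', cf, hclus', b1, b2, b3, b4, b5⟩ := h cl (fun i => (hsol i).2)
      (fun v => f (cl v)) (fun u v huv => by rw [huv]) fun v => (f (cl v)).2
    obtain rfl : clus = clus' := hclus.symm.trans hclus'
    have hcf : ∀ i : Fin I.k, cf i < I.k := by
      intro i
      obtain ⟨x, -, hx, -⟩ := b3 i i.2
      rw [← hx]
      exact b4 x
    have hmed' : ∀ (v : Fin I.n) (i : Fin I.k), medCost I ((liftState s).nat aMed) v (cf i) =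
        I.d v (c ⟨cf i, hcf i⟩) := fun v i => hmed v ⟨cf i, hcf i⟩
    refine ⟨fun i => ⟨cf i, hcf i⟩, fun i => ?_, ?_⟩
    · obtain ⟨x, hx, hx', hx''⟩ := b3 i i.2
      refine ⟨x, hx, hx', fun v hv => ?_⟩
      have := hx'' v hv
      rwa [hmed', hmed'] at this
    · have e1 : ∑ v : Fin I.n, medCost I ((liftState s).nat aMed) v (cf (clus v)) =
          ∑ v : Fin I.n, I.d v (c ⟨cf (clus v), hcf ⟨clus v, g1 v⟩⟩) :=
        Finset.sum_congr rfl fun v _ => hmed' v ⟨clus v, g1 v⟩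
      have e2 : ∑ v : Fin I.n, medCost I ((liftState s).nat aMed) v (f (cl v)) =
          ∑ v : Fin I.n, I.d v (c (f (cl v))) := Finset.sum_congr rfl fun v _ => hmed v _
      rw [e1, e2] at b5
      have h5 := h4 ce
      have h6 := mul_le_mul_of_nonneg_left (I.cost_le_clusteringCost cl ce) hα
      linarith
  obtain ⟨f₁, hf₁, -⟩ := key cl₀ ce₀ h₀
  choose x hx hx' hx'' using hf₁
  refine ⟨fun v => ⟨clus v, g1 v⟩, x, fun v => by rw [hclus], hx, fun i => ⟨Fin.ext (hx' i), ?_⟩,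
    fun cl ce hsol => ?_⟩
  · have : {v : Fin I.n | (⟨clus v, g1 v⟩ : Fin I.k) = i} = {v : Fin I.n | clus v = i} := by
      ext v
      simp [Fin.ext_iff]
    rw [this]
    exact g2 i i.2
  · obtain ⟨f, hf, hf'⟩ := key cl ce hsol
    refine (I.clusteringCost_le _ x (fun i => c (f i)) fun v => ?_).trans ?_
    · obtain ⟨y, hy, -, hy'⟩ := hf ⟨clus v, g1 v⟩
      -- Both are the content of the same cell of `oCen`, so the center found is nearest also with
      -- respect to the facility map belonging to this competitor.
      obtain rfl : x ⟨clus v, g1 v⟩ = y := Fin.ext ((hx _).symm.trans hy)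
      exact hy' v rfl
    · linarith

end RealRAM

theorem mainTheorem6 :
    ∃ (c : ℕ) (C : ℕ → ℕ), ∀ A : RealRAM.Prog KMedianQuery,
      ∃ P : RealRAM.Prog ConnectedQuery, ∀ (α : ℝ) (p : ℕ → ℕ), IsKMedianApprox A α p →
        (∀ B : ℕ, IsConnectedApprox P (2 * α + 4) B
          (fun n k w => C B * (p n + n * (w * k) ^ (c * w)))) ∧
        ((∃ q : Polynomial ℕ, ∀ n, p n ≤ q.eval n) →
          ∀ B : ℕ, ∃ (f : ℕ → ℕ) (q : Polynomial ℕ),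
            IsConnectedApprox P (2 * α + 4) B (fun n k w => f (max w k) * q.eval n)) := by
  obtain ⟨K, c, hK, hT⟩ := RealRAM.exists_mainTime_le
  refine ⟨c, fun B => (B + 2) * K, fun A => ⟨RealRAM.connectedProg A, fun α p hA => ?_⟩⟩
  have key : ∀ B : ℕ, IsConnectedApprox (RealRAM.connectedProg A) (2 * α + 4) B
      (fun n k w => (B + 2) * K * (p n + n * (w * k) ^ (c * w))) := by
    intro B I G D w hD hN
    -- For `w = 0` the bound on the number of nodes would be `0`, but there is a root.
    have hw : 1 ≤ w := by
      by_contra hw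
      obtain rfl : w = 0 := by omega
      have := D.root.pos
      simp at hN
      omega
    obtain ⟨s, t, h1, h2, h3⟩ := RealRAM.connectedProg_spec hA I G D hD
    refine ⟨s, t, h1, h2.trans ?_, h3⟩
    have h4 := hT B D.N I.n I.k w I.two_le_k I.k_le_n hw hN
    have h5 : p I.n ≤ (B + 2) * K * p I.n := Nat.le_mul_of_pos_left _ (by positivity)
    dsimp only
    rw [mul_add]
    exact add_le_add h5 h4
  refine ⟨key, ?_⟩
  rintro ⟨q, hq⟩ B
  -- Both `w` and `k` are at most `m = max w k`, so the power is at most `(m * m) ^ (c * m)`; the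
  -- added `Polynomial.X` accounts for the factor `n` in the second summand.
  refine ⟨fun m => (B + 2) * K * (1 + (m * m) ^ (c * m)), q + Polynomial.X, ?_⟩
  intro I G D w hD hN
  obtain ⟨s, t, h1, h2, h3⟩ := key B I G D w hD hN
  refine ⟨s, t, h1, h2.trans ?_, h3⟩
  have hm : 0 < max w I.k := lt_max_of_lt_right (by have := I.two_le_k; omega)
  have h4 : (w * I.k) ^ (c * w) ≤ (max w I.k * max w I.k) ^ (c * max w I.k) :=
    (Nat.pow_le_pow_left (Nat.mul_le_mul (le_max_left _ _) (le_max_right _ _)) _).trans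
      (Nat.pow_le_pow_right (by positivity) (Nat.mul_le_mul_left _ (le_max_left _ _)))
  have h5 := hq I.n
  dsimp only
  rw [Polynomial.eval_add, Polynomial.eval_X, mul_assoc _ (1 + _)]
  refine Nat.mul_le_mul_left _ ?_
  generalize (max w I.k * max w I.k) ^ (c * max w I.k) = z at h4 ⊢
  generalize (w * I.k) ^ (c * w) = y at h4 ⊢
  have h6 : I.n * y ≤ I.n * z := Nat.mul_le_mul_left _ h4
  nlinarith [Nat.zero_le (q.eval I.n * z)]
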